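/- **Setup.** Let $G$ be a group, $I$ a directed set and $\{G_i\mid i\in I\}$ a family of normal subgroups of finite index in $G$, directed by inclusion ($G_j\subseteq G_i$ for $i\le j$), with $\bigcap_{i\in I}G_i=\{1\}$. Let $K$ be a field. Let $C_*$ be a finite based free $\mathbb ZG$-chain complex, that is, a chain complex of left $\mathbb ZG$-modules with $C_n=0$ for $n<0$ and for all large $n$, each $C_n$ being equipped with a finite $\mathbb ZG$-basis. Put $C[i]_*=\mathbb Z[G/G_i]\otimes_{\mathbb ZG}C_*=\mathbb Z\otimes_{\mathbb ZG_i}C_*$, a finite based free $\mathbb Z[G/G_i]$-chain complex with differential $c[i]_*$, and also a finite based free $\mathbb Z$-chain complex. **Notation.** For a finitely generated abelian group $M$, $\operatorname{d}(M)$ is the minimal number of generators, $\operatorname{tors}(M)$ the torsion subgroup and $M_f=M/\operatorname{tors}(M)$. For a group $H$, a $\mathbb ZH$-module $M$ is *nilpotent* if it has a filtration $0=M_0\subseteq\dots\subseteq M_r=M$ by submodules with trivial $H$-action on all $M_k/M_{k-1}$; the least such $r$ is its *filtration length*. $H_n(C[i]_*;K)$ is the homology of $K\otimes_{\mathbb Z}C[i]_*$.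 Let $c[i]^{(2)}_n$ and $\Delta[i]^{(2)}_n$ be the differential and the Laplacian of the Hilbert chain complex $\mathbb C\otimes_{\mathbb Z}C[i]_*$, in which the given $\mathbb Z$-basis is orthonormal. Then $$\alpha[i]_n\colon \mathbb C\otimes_{\mathbb Z}H_n(C[i]_*)_f\to H_n^{(2)}\bigl(\mathbb C\otimes_{\mathbb Z}C[i]_*\bigr)\cong\ker\Delta[i]^{(2)}_n$$ is the canonical isomorphism; the source carries the Hilbert space structure in which a chosen $\mathbb Z$-basis of $H_n(C[i]_*)_f$ is orthonormal (the choice does not affect the determinant), the target the one of $\ker\Delta[i]_n^{(2)}$. $\det_{\mathcal N(\Gamma)}$ is the Fuglede--Kadison determinant over the group von Neumann algebra of the finite group $\Gamma$; $\rho^{(2)}(C[i]_*;\mathcal N(G/G_i))=-\sum_{n}(-1)^n\ln\det_{\mathcal N(G/G_i)}(c[i]_n^{(2)})$ is the $L^2$-torsion and $\rho^{\mathbb Z}(C[i]_*)=\sum_{n\ge0}(-1)^n\ln|\operatorname{tors}H_n(C[i]_*)|$ the integral torsion. **Proposition.** Let $d\ge 0$ be an integer. Assume that there are an infinite abelian normal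 subgroup $A\subseteq G$, an index $i_0\in I$ and an integer $r\ge 0$ such that $H_n(C[i]_*)$ is a nilpotent $\mathbb Z[A/(A\cap G_i)]$-module of filtration length $\le r$ for all $i\ge i_0$ and all $n\le d$. Then, for all $n\le d$: 1. $\displaystyle\lim_{i\in I}\frac{\operatorname{d}(H_n(C[i]_*))}{[G:G_i]}=0$; 2. $\displaystyle\lim_{i\in I}\frac{\dim_K H_n(C[i]_*;K)}{[G:G_i]}=0$; 3. $\displaystyle\lim_{i\in I}\frac{\ln|\operatorname{tors}(H_n(C[i]_*))|}{[G:G_i]}=0$; 4. $\displaystyle\lim_{i\in I}\frac{\bigl|\ln\det_{\mathcal N(\{1\})}(\alpha[i]_n)\bigr|}{[G:G_i]}=0$. Moreover: 5. if the nilpotency assumption holds in all degrees for the same $A$, that is, if there are $i_1\in I$ and $s\ge 0$ such that $H_n(C[i]_*)$ is a nilpotent $\mathbb Z[A/(A\cap G_i)]$-module of filtration length $\le s$ for all $i\ge i_1$ and all $n\ge 0$ (for instance if $C_n=0$ for $n>d$), then $$\lim_{i\in I}\rho^{(2)}\bigl(C[i]_*;\mathcal N(G/G_i)\bigr)=\lim_{i\in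 I}\frac{\rho^{\mathbb Z}(C[i]_*)}{[G:G_i]}=0.$$ -/

import Mathlib

open Filter Topology

universe u v w

noncomputable section

/-! ### Nilpotent modules over an integral group ring -/

section Nilpotent

variable (H : Type*) [Group H] (M : Type*) [AddCommGroup M] [Module (MonoidAlgebra ℤ H) M]

/-- `M` has a filtration `0 = F 0 ⊆ F 1 ⊆ ⋯ ⊆ F r = M` by `ℤ[H]`-submodules such that `H` acts
trivially on each quotient `F (k + 1) / F k`. -/
def HasTrivialFiltration (r : ℕ) : Prop :=
  ∃ F : ℕ → Submodule (MonoidAlgebra ℤ H) M,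
    F 0 = ⊥ ∧ F r = ⊤ ∧ (∀ k < r, F k ≤ F (k + 1)) ∧
      ∀ k < r, ∀ h : H, ∀ x ∈ F (k + 1), MonoidAlgebra.of ℤ H h • x - x ∈ F k

/-- Nilpotent `ℤ[H]`-modules. -/
def IsNilpotentModule : Prop := ∃ r : ℕ, HasTrivialFiltration H M r

/-- The filtration length of a nilpotent `ℤ[H]`-module: the minimal length of a filtration with
trivial action on the quotients. -/
def filtrationLength : ℕ := sInf {r : ℕ | HasTrivialFiltration H M r}

end Nilpotent

/-! ### Invariants of abelian groups -/

/-- The minimal number of generators of a (finitely generated) abelian group. -/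
def minGenerators (M : Type*) [AddCommGroup M] : ℕ :=
  sInf {n : ℕ | ∃ f : (Fin n → ℤ) →+ M, Function.Surjective f}

/-- The order of the torsion subgroup of a (finitely generated) abelian group. -/
def torsionOrder (M : Type*) [AddCommGroup M] : ℕ := Nat.card (Submodule.torsion ℤ M)

/-! ### Fuglede-Kadison determinants of maps of finite-dimensional Hilbert spaces -/

/-- The logarithm of the Fuglede-Kadison determinant of `f` with respect to a dimension function
`dimN` on the subspaces of the domain: the integral over `(0, ∞)` of `log t` against the spectral
density of `f`. As everything is finite-dimensional, the spectral density is a step function that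
jumps at `t > 0` by the dimension of the eigenspace of `f* f` for the eigenvalue `t ^ 2`. -/
def logFKDet {E F : Type*} [NormedAddCommGroup E] [InnerProductSpace ℂ E] [FiniteDimensional ℂ E]
    [NormedAddCommGroup F] [InnerProductSpace ℂ F] [FiniteDimensional ℂ F]
    (dimN : Submodule ℂ E → ℝ) (f : E →ₗ[ℂ] F) : ℝ :=
  ∑ᶠ t : Set.Ioi (0 : ℝ),
    Real.log t * dimN (Module.End.eigenspace (LinearMap.adjoint f ∘ₗ f) (((t : ℝ) : ℂ) ^ 2))

/-! ### Based free chain complexes -/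

/-- A nonnegatively graded chain complex of finitely generated based free left `R`-modules. Its
`n`-th chain module is `R ^ (ι n)` with the standard basis; the differential sends the basis
element `a` to `∑ b, mat n a b • b`, so it is `x ↦ x ᵥ* mat n`. -/
structure BasedComplex (R : Type u) [Ring R] where
  ι : ℕ → Type w
  [fintype : ∀ n, Fintype (ι n)]
  mat : ∀ n, Matrix (ι (n + 1)) (ι n) R
  mat_mul_mat : ∀ n, mat (n + 1) * mat n = 0

attribute [instance] BasedComplex.fintype

/-- A chain complex of left `R`-modules with a finite basis of each chain module, written out in
coordinates. -/
def BasedComplex.ofBases {R : Type u} [Ring R] (C : ChainComplex (ModuleCat.{v} R) ℕ)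
    {ι : ℕ → Type w} [∀ n, Fintype (ι n)] (b : ∀ n, Module.Basis (ι n) R (C.X n)) :
    BasedComplex.{u, w} R where
  ι := ι
  mat n := Matrix.of fun a c => (b n).repr ((C.d (n + 1) n).hom (b (n + 1) a)) c
  mat_mul_mat n := by
    have key : ∀ x : C.X (n + 2),
        (C.d (n + 1) n).hom ((C.d (n + 1 + 1) (n + 1)).hom x) = 0 := fun x => by
      rw [← ModuleCat.comp_apply, C.d_comp_d]; rfl
    ext a e
    have h := key (b (n + 1 + 1) a)
    rw [← (b (n + 1)).sum_repr ((C.d (n + 1 + 1) (n + 1)).hom (b (n + 1 + 1) a)), map_sum] at h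
    have h2 := congrArg (fun y => (b n).repr y e) h
    simpa [Matrix.mul_apply, Finsupp.finsetSum_apply] using h2

namespace BasedComplex

variable {R : Type u} [Ring R] (D : BasedComplex.{u, w} R)

/-- The chain modules. -/
abbrev X (n : ℕ) : Type (max u w) := D.ι n → R

/-- The differential from degree `n + 1` to degree `n`. -/
def d (n : ℕ) : D.X (n + 1) →ₗ[R] D.X n := (D.mat n).vecMulLinear

/-- The cycles. All chain modules in negative degrees vanish. -/
def cycles : ∀ n : ℕ, Submodule R (D.X n)
  | 0 => ⊤
  | n + 1 => LinearMap.ker (D.d n)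

/-- The boundaries. -/
def boundaries (n : ℕ) : Submodule R (D.X n) := LinearMap.range (D.d n)

/-- The `n`-th homology module. -/
abbrev Homology (n : ℕ) : Type (max u w) :=
  D.cycles n ⧸ (D.boundaries n).submoduleOf (D.cycles n)

/-- The based free complex `S ⊗_R D` for a ring homomorphism `φ : R → S`. -/
def baseChange {S : Type v} [Ring S] (φ : R →+* S) : BasedComplex.{v, w} S where
  ι := D.ι
  mat n := (D.mat n).map φ
  mat_mul_mat n := by
    rw [← Matrix.map_mul, D.mat_mul_mat]
    ext; simp

/-! #### Based free complexes over the integers -/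

section Integers

variable (E : BasedComplex.{0, w} ℤ)

/-- The integral torsion `∑ (-1) ^ n log |tors H_n|` (a finite sum for a bounded complex). -/
def integralTorsion : ℝ := ∑ᶠ n : ℕ, (-1 : ℝ) ^ n * Real.log (torsionOrder (E.Homology n))

/-- `dim_K H_n(E; K)`, where `H_n(E; K)` is the homology of `K ⊗ E`. -/
def betti (K : Type*) [Field K] (n : ℕ) : ℕ :=
  Module.finrank K ((E.baseChange (Int.castRingHom K)).Homology n)

/-- The Hilbert space `ℂ ⊗ E_n` in which the given basis is orthonormal. -/
abbrev L2 (n : ℕ) : Type w := EuclideanSpace ℂ (E.ι n)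

/-- The map `x ↦ 1 ⊗ x` from `E_n` to `ℂ ⊗ E_n`. -/
def toL2 (n : ℕ) : E.X n →+ E.L2 n where
  toFun x := WithLp.toLp 2 fun a => (x a : ℂ)
  map_zero' := by ext; simp
  map_add' x y := by ext; simp

open Classical in
/-- The differential `1 ⊗ d` of the Hilbert chain complex `ℂ ⊗ E`. -/
def l2d (n : ℕ) : E.L2 (n + 1) →ₗ[ℂ] E.L2 n :=
  Matrix.toEuclideanLin ((E.mat n).map (Int.cast : ℤ → ℂ)).transpose

/-- The combinatorial Laplacian of `ℂ ⊗ E`. -/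
def laplacian : ∀ n : ℕ, E.L2 n →ₗ[ℂ] E.L2 n
  | 0 => E.l2d 0 ∘ₗ LinearMap.adjoint (E.l2d 0)
  | n + 1 => LinearMap.adjoint (E.l2d n) ∘ₗ E.l2d n +
      E.l2d (n + 1) ∘ₗ LinearMap.adjoint (E.l2d (n + 1))

/-- The harmonic chains, with the Hilbert space structure inherited from `ℂ ⊗ E_n`. This is the
model used for the `L²`-homology of `ℂ ⊗ E`: the class of an `L²`-cycle corresponds to the
orthogonal projection of the cycle to the harmonic chains. -/
abbrev Harmonic (n : ℕ) : Submodule ℂ (E.L2 n) := LinearMap.ker (E.laplacian n)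

theorem toL2_d (n : ℕ) (x : E.X (n + 1)) : E.toL2 n (E.d n x) = E.l2d n (E.toL2 (n + 1) x) := by
  ext b
  simp [toL2, d, l2d, Matrix.toEuclideanLin, Matrix.toLpLin_apply, Matrix.vecMul, Matrix.mulVec,
    dotProduct, mul_comm]

theorem adjoint_l2d_of_mem_harmonic (n : ℕ) (x : E.L2 n) (hx : x ∈ E.Harmonic n) :
    LinearMap.adjoint (E.l2d n) x = 0 := by
  have h : inner ℂ (E.laplacian n x) x = 0 := by
    rw [LinearMap.mem_ker.1 hx, inner_zero_left]
  have h1 : inner ℂ (E.l2d n (LinearMap.adjoint (E.l2d n) x)) x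
      = ((‖LinearMap.adjoint (E.l2d n) x‖ ^ 2 : ℝ) : ℂ) := by
    rw [← LinearMap.adjoint_inner_right, inner_self_eq_norm_sq_to_K]; simp
  cases n with
  | zero =>
    have h2 := h1.symm.trans h
    simpa using h2
  | succ n =>
    have h3 : inner ℂ (LinearMap.adjoint (E.l2d n) (E.l2d n x)) x
        = ((‖E.l2d n x‖ ^ 2 : ℝ) : ℂ) := by
      rw [LinearMap.adjoint_inner_left, inner_self_eq_norm_sq_to_K]; simp
    have h4 : ‖E.l2d n x‖ ^ 2 + ‖LinearMap.adjoint (E.l2d (n + 1)) x‖ ^ 2 = 0 := by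
      have : inner ℂ (E.laplacian (n + 1) x) x =
          inner ℂ (LinearMap.adjoint (E.l2d n) (E.l2d n x)) x +
          inner ℂ (E.l2d (n + 1) (LinearMap.adjoint (E.l2d (n + 1)) x)) x := by
        rw [← inner_add_left]; rfl
      rw [h, h1, h3] at this
      exact_mod_cast this.symm
    have h5 : ‖LinearMap.adjoint (E.l2d (n + 1)) x‖ ^ 2 = 0 := by
      nlinarith [sq_nonneg ‖E.l2d n x‖, sq_nonneg ‖LinearMap.adjoint (E.l2d (n + 1)) x‖]
    simpa using h5

/-- The additive map that sends an integral cycle to the `L²`-homology class that it defines. -/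
def cyclesToHarmonic (n : ℕ) : E.cycles n →ₗ[ℤ] E.Harmonic n :=
  AddMonoidHom.toIntLinearMap
    (((E.Harmonic n).orthogonalProjectionOnto : E.L2 n →ₗ[ℂ] E.Harmonic n).toAddMonoidHom.comp
      ((E.toL2 n).comp (E.cycles n).subtype.toAddMonoidHom))

theorem cyclesToHarmonic_boundaries (n : ℕ) :
    (E.boundaries n).submoduleOf (E.cycles n) ≤ LinearMap.ker (E.cyclesToHarmonic n) := by
  rintro ⟨z, hz⟩ ⟨y, hy⟩
  change (E.Harmonic n).orthogonalProjectionOnto (E.toL2 n z) = 0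
  change E.d n y = z at hy
  rw [← hy, toL2_d]
  rw [Submodule.orthogonalProjectionOnto_eq_zero_iff]
  intro u hu
  rw [← LinearMap.adjoint_inner_left, E.adjoint_l2d_of_mem_harmonic n u hu, inner_zero_left]

/-- The canonical map from the integral homology to the `L²`-homology. -/
def homologyToHarmonic (n : ℕ) : E.Homology n →ₗ[ℤ] E.Harmonic n :=
  Submodule.liftQ _ (E.cyclesToHarmonic n) (E.cyclesToHarmonic_boundaries n)

theorem homologyToHarmonic_torsion (n : ℕ) :
    Submodule.torsion ℤ (E.Homology n) ≤ LinearMap.ker (E.homologyToHarmonic n) := by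
  intro x hx
  obtain ⟨⟨a, ha⟩, hax⟩ := hx
  have h : a • E.homologyToHarmonic n x = 0 := by
    rw [← map_smul]
    exact (congrArg _ hax).trans (map_zero _)
  rw [← Int.cast_smul_eq_zsmul ℂ] at h
  rcases smul_eq_zero.1 h with h | h
  · exact absurd (by exact_mod_cast h) (nonZeroDivisors.ne_zero ha)
  · exact h

/-- `H_n(E)_f`, the quotient of the homology by its torsion subgroup. -/
abbrev FreeHomology (n : ℕ) : Type w := E.Homology n ⧸ Submodule.torsion ℤ (E.Homology n)

/-- The canonical map from `H_n(E)_f` to the `L²`-homology. -/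
def freeHomologyToHarmonic (n : ℕ) : E.FreeHomology n →ₗ[ℤ] E.Harmonic n :=
  Submodule.liftQ _ (E.homologyToHarmonic n) (E.homologyToHarmonic_torsion n)

/-- The canonical map `α_n` from `ℂ ⊗ H_n(E)_f`, with the Hilbert space structure in which a chosen
`ℤ`-basis of `H_n(E)_f` is orthonormal, to the `L²`-homology of `ℂ ⊗ E`. -/
def alpha (n : ℕ) :
    EuclideanSpace ℂ (Module.Free.ChooseBasisIndex ℤ (E.FreeHomology n)) →ₗ[ℂ] E.Harmonic n :=
  (EuclideanSpace.basisFun _ ℂ).toBasis.constr ℂ fun j =>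
    E.freeHomologyToHarmonic n (Module.Free.chooseBasis ℤ (E.FreeHomology n) j)

/-- The logarithm of the Fuglede-Kadison determinant of `α_n` over the trivial group, for which the
von Neumann dimension is the complex dimension. -/
def logDetAlpha (n : ℕ) : ℝ := 
  logFKDet (E := EuclideanSpace ℂ (Module.Free.ChooseBasisIndex ℤ (E.FreeHomology n)))
    (F := E.Harmonic n) (fun V => (Module.finrank ℂ V : ℝ)) (E.alpha n)

end Integers

/-! #### Based free complexes over the integral group ring of a finite group -/

section FiniteGroup

variable {Γ : Type v} [Group Γ] [Finite Γ] (D : BasedComplex.{v, w} (MonoidAlgebra ℤ Γ))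

/-- The underlying based free complex over `ℤ` of a based free `ℤ[Γ]`-complex: the `ℤ`-basis
of `ℤ[Γ] ^ (ι n)` consists of the elements `g • a` with `g : Γ` and `a : ι n`, and the differential
sends `g • a` to `∑ b, (g * mat n a b) • b`. -/
def underlying : BasedComplex.{0, max w v} ℤ where
  ι n := D.ι n × Γ
  fintype n := letI := Fintype.ofFinite Γ; instFintypeProd (D.ι n) Γ
  mat n := Matrix.of fun p q => (D.mat n p.1 q.1).coeff (p.2⁻¹ * q.2)
  mat_mul_mat n := by
    classical
    let _ : Fintype Γ := Fintype.ofFinite Γ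
    have conv : ∀ (x y : MonoidAlgebra ℤ Γ) (g k : Γ),
        ∑ h : Γ, x.coeff (g⁻¹ * h) * y.coeff (h⁻¹ * k) = (x * y).coeff (g⁻¹ * k) := by
      intro x y g k
      rw [MonoidAlgebra.coeff_mul_apply_left, Finsupp.sum_fintype _ _ (by simp)]
      refine Fintype.sum_equiv (Equiv.mulLeft g⁻¹) _ _ fun h => ?_
      simp [mul_assoc]
    ext ⟨a, g⟩ ⟨c, k⟩
    have h := congrFun (congrFun (D.mat_mul_mat n) a) c
    rw [Matrix.mul_apply] at h ⊢
    rw [Fintype.sum_prod_type]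
    simp only [Matrix.of_apply, conv]
    have h' := congrArg (fun z : MonoidAlgebra ℤ Γ => z.coeff (g⁻¹ * k)) h
    simpa using h'

/-- The basis element `a = 1 • a` of the underlying `ℤ`-complex. -/
def unitIndex (n : ℕ) (a : D.ι n) : D.underlying.ι n := (a, (1 : Γ))

open Classical in
/-- The von Neumann dimension over `N(Γ)` of a (`Γ`-invariant) subspace of the `n`-th Hilbert chain
module `ℓ²(Γ) ^ (ι n)`: the von Neumann trace of the orthogonal projection to it, that is, the sum
over `a : ι n` of the coefficients `⟨1 • a, proj (1 • a)⟩`. -/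
def vnDim (n : ℕ) (V : Submodule ℂ (D.underlying.L2 n)) : ℝ :=
  ∑ a : D.ι n, (inner ℂ (EuclideanSpace.single (D.unitIndex n a) (1 : ℂ))
    (V.starProjection (EuclideanSpace.single (D.unitIndex n a) (1 : ℂ)))).re

/-- The `L²`-torsion over `N(Γ)`, that is `- ∑ (-1) ^ n log det_{N(Γ)} (c_n)`, where `c_n` is the
differential from degree `n` to degree `n - 1` (a finite sum for a bounded complex). As `c_0 = 0`
contributes nothing, the sum is indexed by the degree `n` of the target. -/
def l2Torsion : ℝ :=
  - ∑ᶠ n : ℕ, (-1 : ℝ) ^ (n + 1) * logFKDet (D.vnDim (n + 1)) (D.underlying.l2d n)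

end FiniteGroup

/-! #### The complexes attached to a normal subgroup -/

section Level

variable {G : Type u} [Group G] (D : BasedComplex.{u, w} (MonoidAlgebra ℤ G))
  (N : Subgroup G) [N.Normal]

/-- The based free `ℤ[G/N]`-complex `ℤ[G/N] ⊗_{ℤ[G]} D`, which is `ℤ ⊗_{ℤ[N]} D` with its residual
action of `G/N`. -/
def level : BasedComplex.{u, w} (MonoidAlgebra ℤ (G ⧸ N)) :=
  D.baseChange (MonoidAlgebra.mapDomainRingHom ℤ (QuotientGroup.mk' N))

/-- The canonical (injective) homomorphism from `A/(A ∩ N)` to `G/N`. -/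
def subgroupQuotientHom (A : Subgroup G) : A ⧸ N.subgroupOf A →* G ⧸ N :=
  QuotientGroup.map (N.subgroupOf A) N A.subtype le_rfl

/-- The homology of `ℤ ⊗_{ℤ[N]} D` as a module over `ℤ[A/(A ∩ N)]`. -/
abbrev levelHomology (A : Subgroup G) (n : ℕ) :
    ModuleCat (MonoidAlgebra ℤ (A ⧸ N.subgroupOf A)) :=
  (ModuleCat.restrictScalars
    (MonoidAlgebra.mapDomainRingHom ℤ (subgroupQuotientHom N A))).obj
      (ModuleCat.of (MonoidAlgebra ℤ (G ⧸ N)) ((D.level N).Homology n))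

/-- The homology of `ℤ ⊗_{ℤ[N]} D` in degree `n` is a nilpotent `ℤ[A/(A ∩ N)]`-module of filtration
length at most `r`. -/
def NilpotentAtLevel (A : Subgroup G) (n r : ℕ) : Prop :=
  IsNilpotentModule (A ⧸ N.subgroupOf A) (D.levelHomology N A n) ∧
    filtrationLength (A ⧸ N.subgroupOf A) (D.levelHomology N A n) ≤ r

/-- The based free `ℤ`-complex `ℤ ⊗_{ℤ[N]} D`. -/
def intLevel [N.FiniteIndex] : BasedComplex.{0, max w u} ℤ := (D.level N).underlying

end Level

end BasedComplex

end

/-! Write `N` for a member of the family, `B = A/(A ∩ N)`, `b = |B|` and `f = [G : AN]`, so that `[G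
: N] = b f`. As `A` is infinite and the family is directed with trivial intersection, `b` tends to
infinity. It therefore suffices to bound each invariant by `c f (1 + log b) ^ k` with `c` and `k`
independent of `N` (`exists_level_bounds`).

Generators. Over `ℤ[B]` the complex is still based free, of rank only `f` times the original rank.
The augmentation ideal `J` of `ℤ[B]` has partial free resolutions whose ranks are polynomial in `log
b`: `B` is exhausted by at most `log₂ b` cyclic steps, and each one enters through the 2-periodic
resolution of a cyclic group (`hasPartialResolution_step`). By dimension shifting, such a resolution
bounds the number of generators of cycles modulo `J` times cycles by the homology in lower degrees
and the chain rank. Nilpotency of length `r` says that `J ^ r` times the cycles consists of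
boundaries, so `r` layers of the `J`-adic filtration generate the homology
(`homologyGen_of_nilpotent`). Induction on the degree gives `f` times a power of `log b`
(`exists_relGen_bound`). Betti numbers over any field follow by counting ranks.

Torsion and regulator. The level `N` is compared with the level `AN`, whose index is only `f`.
Projection and its transpose form a transfer: one composite is multiplication by `b`, the other is
summation over `B`. By nilpotency the kernel on homology is killed by `b ^ r`
(`kerBound_levelTransfer`), so a bound on the number of generators makes the logarithm of its order
small. The transfer also scales the inner products of harmonic classes by `b`, so it changes the
logarithm of the regulator, the determinant of `α`, by at most a multiple of `f log b`
(`abs_logDetAlpha_le`). At level `AN` a trivial bound is enough: the logarithmic determinant of a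
differential is the logarithm of the torsion plus two logarithmic covolumes of integral lattices
(`logFKDet_l2d_eq`). All three summands are nonnegative, and their sum is at most the rank times the
logarithm of an operator norm bound that does not depend on the level.

Torsion invariants. In the alternating sum of those determinants the covolumes of the cycles
telescope. The `L²`-torsion is thus the alternating sum of the logarithms of torsion minus
regulator, divided by the index, and its limit follows degree by degree. -/

noncomputable section

/-! ### Relative generation of abelian groups -/

/-- The subgroup `Z` is contained in the subgroup generated by `B` and `k` further elements. -/
def RelGen {M : Type*} [AddCommGroup M] (k : ℕ) (B Z : AddSubgroup M) : Prop :=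
  ∃ v : Fin k → M, ∀ z ∈ Z, ∃ c : Fin k → ℤ, z - ∑ i, c i • v i ∈ B

namespace RelGen

variable {M M' : Type*} [AddCommGroup M] [AddCommGroup M'] {k l : ℕ} {B Z Z' : AddSubgroup M}

theorem of_fintype {κ : Type*} [Fintype κ] (v : κ → M)
    (h : ∀ z ∈ Z, ∃ c : κ → ℤ, z - ∑ i, c i • v i ∈ B) : RelGen (Fintype.card κ) B Z := by
  let e := Fintype.equivFin κ
  refine ⟨v ∘ e.symm, fun z hz => ?_⟩
  obtain ⟨c, hc⟩ := h z hz
  refine ⟨c ∘ e.symm, ?_⟩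
  have : ∑ i, (c ∘ e.symm) i • (v ∘ e.symm) i = ∑ i, c i • v i :=
    Fintype.sum_equiv e.symm _ _ fun _ => rfl
  rwa [this]

theorem mono_right (h : RelGen k B Z) (hZ : Z' ≤ Z) : RelGen k B Z' := by
  obtain ⟨v, hv⟩ := h
  exact ⟨v, fun z hz => hv z (hZ hz)⟩

theorem mono (h : RelGen k B Z) (hk : k ≤ l) : RelGen l B Z := by
  obtain ⟨v, hv⟩ := h
  obtain ⟨m, rfl⟩ := Nat.exists_eq_add_of_le hk
  refine ⟨Fin.append v 0, fun z hz => ?_⟩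
  obtain ⟨c, hc⟩ := hv z hz
  exact ⟨Fin.append c 0, by simpa [Fin.sum_univ_add] using hc⟩

/-- The generators can be chosen in `Z`, as subgroups of `ℤ ^ k` are generated by `k` elements. -/
theorem exists_mem (h : RelGen k B Z) : ∃ v : Fin k → M, (∀ i, v i ∈ Z) ∧
    ∀ z ∈ Z, ∃ c : Fin k → ℤ, z - ∑ i, c i • v i ∈ B := by
  obtain ⟨v, hv⟩ := h
  let φ : (Fin k → ℤ) →ₗ[ℤ] M := Fintype.linearCombination ℤ v
  have hφ : ∀ c, φ c = ∑ i, c i • v i := fun c => Fintype.linearCombination_apply ℤ v c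
  -- `P` consists of the coefficient vectors whose combination lies in `B ⊔ Z`. Each member of a
  -- basis of `P` yields an element of `B ⊔ Z`, which is moved into `Z` at the cost of an error in
  -- `B`.
  let P : Submodule ℤ (Fin k → ℤ) := (AddSubgroup.toIntSubmodule (B ⊔ Z)).comap φ
  obtain ⟨n, hn, ⟨bP⟩⟩ : ∃ n ≤ k, Nonempty (Module.Basis (Fin n) ℤ P) := by
    obtain ⟨n, bP⟩ := Submodule.basisOfPid (Pi.basisFun ℤ (Fin k)) P
    refine ⟨n, ?_, ⟨bP⟩⟩
    have h1 := Submodule.finrank_le P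
    rw [Module.finrank_eq_card_basis bP] at h1
    simpa using h1
  have hmem : ∀ j, ∃ z ∈ Z, φ (bP j) - z ∈ B := fun j => by
    obtain ⟨b, hb, z, hz, h⟩ := AddSubgroup.mem_sup.1 (bP j).2
    exact ⟨z, hz, by rw [← h]; simpa using hb⟩
  choose w hwZ hwB using hmem
  obtain ⟨m, rfl⟩ := Nat.exists_eq_add_of_le hn
  refine ⟨Fin.append w 0, fun i => ?_, fun z hz => ?_⟩
  · induction i using Fin.addCases with
    | left i => simpa using hwZ i
    | right i => simp [Z.zero_mem]
  · obtain ⟨c, hc⟩ := hv z hz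
    have hcP : c ∈ P := by
      change φ c ∈ B ⊔ Z
      have : φ c = -(z - φ c) + z := by abel
      rw [this]
      exact AddSubgroup.add_mem_sup (B.neg_mem (by rwa [hφ])) hz
    let e := bP.repr ⟨c, hcP⟩
    have he : φ c = ∑ j, e j • φ (bP j) := by
      have h1 := congrArg (φ ∘ₗ P.subtype) (bP.sum_repr ⟨c, hcP⟩)
      rw [map_sum] at h1
      simpa only [map_smul, LinearMap.comp_apply, Submodule.subtype_apply] using h1.symm
    refine ⟨Fin.append e 0, ?_⟩
    have h2 : z - ∑ i, (Fin.append e 0 : Fin (n + m) → ℤ) i • (Fin.append w 0 : Fin (n + m) → M) i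
        = (z - φ c) + ∑ j, e j • (φ (bP j) - w j) := by
      rw [he]
      simp [Fin.sum_univ_add, smul_sub]
    rw [h2]
    exact B.add_mem (by rwa [hφ]) (B.sum_mem fun j _ => B.zsmul_mem (hwB j) _)

theorem map {B' Z'' : AddSubgroup M'} (f : M →+ M') (h : RelGen k B Z) (hB : ∀ b ∈ B, f b ∈ B')
    (hZ : ∀ z' ∈ Z'', ∃ z ∈ Z, z' - f z ∈ B') : RelGen k B' Z'' := by
  obtain ⟨v, hv⟩ := h
  refine ⟨f ∘ v, fun z' hz' => ?_⟩
  obtain ⟨z, hz, hzz⟩ := hZ z' hz'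
  obtain ⟨c, hc⟩ := hv z hz
  refine ⟨c, ?_⟩
  have : z' - ∑ i, c i • (f ∘ v) i = (z' - f z) + f (z - ∑ i, c i • v i) := by simp
  rw [this]
  exact B'.add_mem hzz (hB _ hc)

/-- Generators of the image of `Z` can be chosen inside that image, by `exists_mem`, and hence be
lifted to `Z`. In particular the number of generators does not grow on passing to subgroups. -/
theorem comap {B' Z'' : AddSubgroup M'} (f : M →+ M') (h : RelGen k B' Z'')
    (hZ : ∀ z ∈ Z, f z ∈ Z'') (hB : ∀ z ∈ Z, f z ∈ B' → z ∈ B) : RelGen k B Z := by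
  have h1 : RelGen k B' (Z.map f) := h.mono_right (by rintro _ ⟨z, hz, rfl⟩; exact hZ z hz)
  obtain ⟨v, hvZ, hv⟩ := h1.exists_mem
  choose w hwZ hw using hvZ
  refine ⟨w, fun z hz => ?_⟩
  obtain ⟨c, hc⟩ := hv (f z) ⟨z, hz, rfl⟩
  refine ⟨c, hB _ (Z.sub_mem hz (Z.sum_mem fun i _ => Z.zsmul_mem (hwZ i) _)) ?_⟩
  simpa [hw] using hc

theorem trans (h : RelGen k B Z') (h' : RelGen l Z' Z) : RelGen (k + l) B Z := by
  obtain ⟨v, hv⟩ := h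
  obtain ⟨w, hw⟩ := h'
  refine ⟨Fin.append v w, fun z hz => ?_⟩
  obtain ⟨c, hc⟩ := hw z hz
  obtain ⟨e, he⟩ := hv _ hc
  refine ⟨Fin.append e c, ?_⟩
  simpa [Fin.sum_univ_add, sub_sub, add_comm] using he

theorem of_le (h : Z ≤ B) : RelGen 0 B Z := ⟨0, fun z hz => ⟨0, by simpa using h hz⟩⟩

end RelGen

/-! ### Chains with coefficients in a module -/

namespace BasedComplex

section Coefficients

variable {R : Type u} [CommRing R] (F : BasedComplex.{u, w} R)
  (X : Type*) [AddCommGroup X] [Module R X] {Y : Type*} [AddCommGroup Y] [Module R Y]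

/-- The differential of the complex `F ⊗_R X`. -/
def dCoeff (n : ℕ) : (F.ι (n + 1) → X) →ₗ[R] (F.ι n → X) where
  toFun x b := ∑ a, F.mat n a b • x a
  map_add' x y := by ext b; simp [Finset.sum_add_distrib]
  map_smul' r x := by ext b; simp [Finset.smul_sum, smul_comm r]

/-- The cycles of `F ⊗_R X`. -/
def cyclesCoeff : ∀ n, Submodule R (F.ι n → X)
  | 0 => ⊤
  | n + 1 => LinearMap.ker (F.dCoeff X n)

/-- The boundaries of `F ⊗_R X`. -/
def boundariesCoeff (n : ℕ) : Submodule R (F.ι n → X) := LinearMap.range (F.dCoeff X n)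

/-- The `n`-th homology of `F ⊗_R X` is generated by `k` elements as an abelian group. -/
def HomologyGen (k n : ℕ) : Prop :=
  RelGen k (F.boundariesCoeff X n).toAddSubgroup (F.cyclesCoeff X n).toAddSubgroup

variable {X}

theorem dCoeff_apply (n : ℕ) (x : F.ι (n + 1) → X) (b : F.ι n) :
    F.dCoeff X n x b = ∑ a, F.mat n a b • x a := rfl

theorem dCoeff_map (f : X →ₗ[R] Y) (n : ℕ) (x : F.ι (n + 1) → X) :
    F.dCoeff Y n (fun a => f (x a)) = fun b => f (F.dCoeff X n x b) := by
  ext b; simp [dCoeff_apply]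

theorem dCoeff_dCoeff (n : ℕ) (x : F.ι (n + 2) → X) :
    F.dCoeff X n (F.dCoeff X (n + 1) x) = 0 := by
  ext c
  simp only [dCoeff_apply, Finset.smul_sum, smul_smul, Pi.zero_apply]
  rw [Finset.sum_comm]
  refine Finset.sum_eq_zero fun a _ => ?_
  rw [← Finset.sum_smul]
  have := congrFun (congrFun (F.mat_mul_mat n) a) c
  rw [Matrix.mul_apply] at this
  simp_rw [mul_comm (F.mat n _ c)]
  rw [this]; simp

theorem boundariesCoeff_le_cyclesCoeff (n : ℕ) :
    F.boundariesCoeff X n ≤ F.cyclesCoeff X n := by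
  cases n with
  | zero => exact le_top
  | succ n => rintro _ ⟨x, rfl⟩; exact F.dCoeff_dCoeff n x

theorem map_mem_boundariesCoeff (f : X →ₗ[R] Y) (n : ℕ) {x : F.ι n → X}
    (hx : x ∈ F.boundariesCoeff X n) : (fun a => f (x a)) ∈ F.boundariesCoeff Y n := by
  obtain ⟨y, rfl⟩ := hx
  exact ⟨fun a => f (y a), F.dCoeff_map f n y⟩

theorem map_mem_cyclesCoeff (f : X →ₗ[R] Y) (n : ℕ) {x : F.ι n → X}
    (hx : x ∈ F.cyclesCoeff X n) : (fun a => f (x a)) ∈ F.cyclesCoeff Y n := by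
  cases n with
  | zero => trivial
  | succ n =>
    change F.dCoeff Y n _ = 0
    rw [F.dCoeff_map, show F.dCoeff X n x = 0 from hx]
    ext; simp

theorem mem_cyclesCoeff_pi {ρ n : ℕ} {x : F.ι n → Fin ρ → R}
    (h : x ∈ F.cyclesCoeff (Fin ρ → R) n) (j : Fin ρ) :
    (fun a => x a j) ∈ F.cyclesCoeff R n :=
  F.map_mem_cyclesCoeff (LinearMap.proj j) n h

theorem mem_cyclesCoeff_of_injective (f : X →ₗ[R] Y) (hf : Function.Injective f) (n : ℕ)
    {x : F.ι n → X} (hx : (fun a => f (x a)) ∈ F.cyclesCoeff Y n) : x ∈ F.cyclesCoeff X n := by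
  cases n with
  | zero => trivial
  | succ n =>
    change F.dCoeff X n _ = 0
    have h : F.dCoeff Y n _ = 0 := hx
    rw [F.dCoeff_map] at h
    ext a
    exact hf ((congrFun h a).trans (map_zero f).symm)

/-- The cycles of `F ⊗ X` that lift to cycles of `F ⊗ R ^ ρ`. -/
def liftableCycles {ρ : ℕ} (p : (Fin ρ → R) →ₗ[R] X) (n : ℕ) : Submodule R (F.ι n → X) :=
  (F.cyclesCoeff (Fin ρ → R) n).map (p.compLeft (F.ι n))

/-- The complex with coefficients in `R ^ ρ` is a sum of `ρ` copies of `F`, so its homology needs at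
most `ρ * k` generators; these are pushed forward along `p`. -/
theorem relGen_liftableCycles {ρ k n : ℕ} (p : (Fin ρ → R) →ₗ[R] X)
    (h : F.HomologyGen R k n) :
    RelGen (ρ * k) (F.boundariesCoeff X n).toAddSubgroup (F.liftableCycles p n).toAddSubgroup := by
  classical
  obtain ⟨v, hv⟩ := h
  have key := RelGen.of_fintype (B := (F.boundariesCoeff X n).toAddSubgroup)
    (Z := (F.liftableCycles p n).toAddSubgroup) (κ := Fin ρ × Fin k)
    (fun q a => p (Pi.single q.1 (v q.2 a))) ?_
  · simpa using key
  · rintro _ ⟨y, hy, rfl⟩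
    have hc : ∀ j, ∃ c : Fin k → ℤ, (fun a => y a j) - ∑ i, c i • v i ∈
        (F.boundariesCoeff R n).toAddSubgroup := fun j => hv _ (F.mem_cyclesCoeff_pi hy j)
    choose c hc using hc
    refine ⟨fun q => c q.1 q.2, ?_⟩
    have h1 : (p.compLeft (F.ι n)) y - ∑ q : Fin ρ × Fin k, c q.1 q.2 •
        (fun a => p (Pi.single q.1 (v q.2 a))) = ∑ j, fun a =>
          (p ∘ₗ LinearMap.single R (fun _ => R) j) (((fun a => y a j) - ∑ i, c j i • v i) a) := by
      ext a
      have h2 : p (y a) = ∑ j, p (Pi.single j (y a j)) := by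
        rw [← map_sum, Finset.univ_sum_single]
      simp only [Fintype.sum_prod_type, LinearMap.compLeft_apply, Pi.sub_apply,
        Finset.sum_apply, Pi.smul_apply, Function.comp, LinearMap.comp_apply,
        LinearMap.coe_single, map_sub, map_sum, Finset.sum_sub_distrib, h2]
      congr 1
      refine Finset.sum_congr rfl fun j _ => Finset.sum_congr rfl fun i _ => ?_
      rw [← LinearMap.single_apply (R := R) (φ := fun _ => R), 
        ← LinearMap.single_apply (R := R) (φ := fun _ => R), map_zsmul, map_zsmul]
    rw [h1]
    exact AddSubgroup.sum_mem _ fun j _ => F.map_mem_boundariesCoeff _ n (hc j)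

theorem exists_lift {p : Y →ₗ[R] X} (hp : Function.Surjective p) {n : ℕ} (x : F.ι n → X) :
    ∃ y : F.ι n → Y, (fun a => p (y a)) = x := by
  choose y hy using fun a => hp (x a)
  exact ⟨y, funext hy⟩

/-- The connecting homomorphism bounds the homology with coefficients in a quotient. -/
theorem relGen_cyclesCoeff_of_ker {ρ l n : ℕ} (p : (Fin ρ → R) →ₗ[R] X)
    (hp : Function.Surjective p) (h : F.HomologyGen (LinearMap.ker p) l n) :
    RelGen l (F.liftableCycles p (n + 1)).toAddSubgroup
      (F.cyclesCoeff X (n + 1)).toAddSubgroup := by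
  let W := (F.cyclesCoeff X (n + 1)).comap (p.compLeft (F.ι (n + 1)))
  let i := (LinearMap.ker p).subtype
  let S := (F.cyclesCoeff (LinearMap.ker p) n).map (i.compLeft (F.ι n))
  let T := (F.boundariesCoeff (LinearMap.ker p) n).map (i.compLeft (F.ι n))
  have h1 : RelGen l T.toAddSubgroup S.toAddSubgroup := by
    refine RelGen.map (i.compLeft (F.ι n)).toAddMonoidHom h (fun b hb => ⟨b, hb, rfl⟩) ?_
    rintro _ ⟨z, hz, rfl⟩
    exact ⟨z, hz, by simp [T]⟩
  -- The differential maps `W` to cycles with values in `ker p`. If `y ∈ W` has a boundary that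
  -- already bounds in `ker p`, then `y` becomes a cycle after subtracting a chain with values in
  -- `ker p`, so `y ∈ U`. Hence `W` modulo `U` embeds into the homology with coefficients in `ker
  -- p`.
  let U := (F.liftableCycles p (n + 1)).comap (p.compLeft (F.ι (n + 1)))
  have h2 : RelGen l U.toAddSubgroup W.toAddSubgroup := by
    refine RelGen.comap (F.dCoeff (Fin ρ → R) n).toAddMonoidHom h1 ?_ ?_
    · intro y hy
      have hy' : F.dCoeff X n (fun a => p (y a)) = 0 := hy
      rw [F.dCoeff_map] at hy'
      refine ⟨fun a => ⟨F.dCoeff _ n y a, congrFun hy' a⟩, ?_, rfl⟩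
      refine F.mem_cyclesCoeff_of_injective i (Submodule.injective_subtype _) n ?_
      change F.dCoeff _ n y ∈ _
      exact F.boundariesCoeff_le_cyclesCoeff n ⟨y, rfl⟩
    · rintro y hy ⟨_, ⟨s, rfl⟩, hs⟩
      refine ⟨y - fun a => i (s a), ?_, ?_⟩
      · change F.dCoeff _ n _ = 0
        rw [map_sub, F.dCoeff_map, sub_eq_zero]
        exact hs.symm
      · ext a
        simp [i]
  refine RelGen.map (p.compLeft (F.ι (n + 1))).toAddMonoidHom h2 (fun b hb => hb) ?_
  intro x hx
  obtain ⟨y, rfl⟩ := F.exists_lift hp x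
  exact ⟨y, hx, by
    change (fun a => p (y a)) - (p.compLeft _ y) ∈ _
    have : (fun a => p (y a)) - (p.compLeft _ y) = 0 := by ext; simp
    rw [this]; exact AddSubgroup.zero_mem _⟩

/-- In degree `0` every chain is a cycle, so every cycle lifts and no connecting homomorphism is
needed. -/
theorem homologyGen_zero_of_surjective {ρ k : ℕ} (p : (Fin ρ → R) →ₗ[R] X)
    (hp : Function.Surjective p) (h : F.HomologyGen R k 0) : F.HomologyGen X (ρ * k) 0 := by
  refine (F.relGen_liftableCycles p h).mono_right fun x _ => ?_
  obtain ⟨y, rfl⟩ := F.exists_lift hp x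
  exact ⟨y, trivial, rfl⟩

/-- This is the part of the long exact homology sequence of `0 → ker p → R ^ ρ → X → 0` around `X`:
the lifting cycles contribute `ρ * k`, the image of the connecting homomorphism contributes `l`. -/
theorem homologyGen_succ_of_surjective {ρ k l n : ℕ} (p : (Fin ρ → R) →ₗ[R] X)
    (hp : Function.Surjective p) (h : F.HomologyGen R k (n + 1))
    (h' : F.HomologyGen (LinearMap.ker p) l n) : F.HomologyGen X (ρ * k + l) (n + 1) :=
  (F.relGen_liftableCycles p h).trans (F.relGen_cyclesCoeff_of_ker p hp h')

end Coefficients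

end BasedComplex

/-! ### Partial free resolutions of bounded ranks -/

/-- `X` has the first `n` steps of a free resolution with all ranks at most `c`. -/
def HasPartialResolution (R : Type u) [CommRing R] (c : ℕ) :
    ℕ → ∀ (X : Type u) [AddCommGroup X] [Module R X], Prop
  | 0, _, _, _ => True
  | n + 1, X, _, _ => ∃ (ρ : ℕ) (p : (Fin ρ → R) →ₗ[R] X), ρ ≤ c ∧ Function.Surjective p ∧
      HasPartialResolution R c n (LinearMap.ker p)

namespace HasPartialResolution

variable {R : Type u} [CommRing R] {X Y Z : Type u} [AddCommGroup X] [Module R X]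
  [AddCommGroup Y] [Module R Y] [AddCommGroup Z] [Module R Z]

/-- Dimension shifting: one step of the resolution trades degree `q` with coefficients in `X` for
degree `q - 1` with coefficients in the first syzygy. After `q + 1` steps degree `0` has been dealt
with as well. -/
theorem homologyGen (F : BasedComplex.{u, w} R) {c : ℕ} {k : ℕ → ℕ} {q : ℕ}
    (h : HasPartialResolution R c (q + 1) X) (hk : ∀ j ≤ q, F.HomologyGen R (k j) j) :
    F.HomologyGen X (c * ∑ j ∈ Finset.range (q + 1), k j) q := by
  induction q generalizing X with
  | zero =>
    obtain ⟨ρ, p, hρ, hp, -⟩ := h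
    refine (F.homologyGen_zero_of_surjective p hp (hk 0 le_rfl)).mono ?_
    simpa using Nat.mul_le_mul_right _ hρ
  | succ q ih =>
    obtain ⟨ρ, p, hρ, hp, h'⟩ := h
    refine (F.homologyGen_succ_of_surjective p hp (hk _ le_rfl)
      (ih h' fun j hj => hk j (by omega))).mono ?_
    rw [Finset.sum_range_succ _ (q + 1), mul_add, add_comm]
    exact Nat.add_le_add_left (Nat.mul_le_mul_right _ hρ) _

theorem mono {c c' n : ℕ} (h : HasPartialResolution R c n X) (hc : c ≤ c') :
    HasPartialResolution R c' n X := by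
  induction n generalizing X with
  | zero => trivial
  | succ n ih =>
    obtain ⟨ρ, p, hρ, hp, h'⟩ := h
    exact ⟨ρ, p, hρ.trans hc, hp, ih h'⟩

theorem congr {c n : ℕ} (h : HasPartialResolution R c n X) (e : X ≃ₗ[R] Y) :
    HasPartialResolution R c n Y := by
  cases n with
  | zero => trivial
  | succ n =>
    obtain ⟨ρ, p, hρ, hp, h'⟩ := h
    refine ⟨ρ, e.toLinearMap ∘ₗ p, hρ, e.surjective.comp hp, ?_⟩
    rwa [LinearEquiv.ker_comp]

/-- The horseshoe lemma. -/
theorem extension {c c' n : ℕ} (hX : HasPartialResolution R c n X)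
    (hZ : HasPartialResolution R c' n Z) (f : X →ₗ[R] Y) (g : Y →ₗ[R] Z)
    (hf : Function.Injective f) (hfg : Function.Exact f g) (hg : Function.Surjective g) :
    HasPartialResolution R (c + c') n Y := by
  induction n generalizing X Y Z with
  | zero => trivial
  | succ n ih =>
    obtain ⟨ρ, p, hρ, hp, hX'⟩ := hX
    obtain ⟨σ, q, hσ, hq, hZ'⟩ := hZ
    -- The generators of `Z` are lifted to `Y`; together with those of `X` they generate `Y`, and
    -- the kernels again form a short exact sequence, to which the induction applies.
    obtain ⟨q', hq'⟩ := Module.projective_lifting_property g q hg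
    let e : (Fin (ρ + σ) → R) ≃ₗ[R] (Fin ρ → R) × (Fin σ → R) :=
      (LinearEquiv.funCongrLeft R R finSumFinEquiv).trans
        (LinearEquiv.sumArrowLequivProdArrow (Fin ρ) (Fin σ) R R)
    let t : (Fin ρ → R) × (Fin σ → R) →ₗ[R] Y := (f ∘ₗ p).coprod q'
    have ht : Function.Surjective t := fun y => by
      obtain ⟨s, hs⟩ := hq (g y)
      have h0 : g (y - q' s) = 0 := by
        rw [map_sub, ← LinearMap.comp_apply, hq', hs, sub_self]
      obtain ⟨x, hx⟩ := (hfg _).1 h0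
      obtain ⟨r, rfl⟩ := hp x
      exact ⟨(r, s), by simp [t, hx]⟩
    refine ⟨ρ + σ, t ∘ₗ e.toLinearMap, Nat.add_le_add hρ hσ, ht.comp e.surjective, ?_⟩
    have hgt : ∀ r s, g (t (r, s)) = q s := fun r s => by
      have : g (q' s) = q s := by rw [← LinearMap.comp_apply, hq']
      simp only [t, LinearMap.coprod_apply, LinearMap.comp_apply, map_add, this]
      rw [(hfg _).2 ⟨_, rfl⟩, zero_add]
    let f' : LinearMap.ker p →ₗ[R] LinearMap.ker t :=
      ((LinearMap.inl R _ _) ∘ₗ (LinearMap.ker p).subtype).codRestrict _ fun x => by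
        simp [t, show p x = 0 from x.2]
    let g' : LinearMap.ker t →ₗ[R] LinearMap.ker q :=
      ((LinearMap.snd R _ _) ∘ₗ (LinearMap.ker t).subtype).codRestrict _ fun x => by
        have := hgt x.1.1 x.1.2
        rw [show t (x.1.1, x.1.2) = 0 from x.2, map_zero] at this
        exact this.symm
    have key : HasPartialResolution R (c + c') n (LinearMap.ker t) := by
      refine ih hX' hZ' f' g' ?_ ?_ ?_
      · intro x y hxy
        have := congrArg (fun z : LinearMap.ker t => z.1.1) hxy
        exact Subtype.ext this
      · rintro ⟨⟨r, s⟩, hrs⟩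
        constructor
        · intro h
          have hs : s = 0 := congrArg Subtype.val h
          subst hs
          have hr : f (p r) = 0 := by simpa [t] using hrs
          exact ⟨⟨r, hf (hr.trans (map_zero f).symm)⟩, rfl⟩
        · rintro ⟨x, hx⟩
          rw [← hx]; rfl
      · rintro ⟨s, hs⟩
        have h0 : g (q' s) = 0 := by
          rw [← LinearMap.comp_apply, hq']; exact hs
        obtain ⟨x, hx⟩ := (hfg _).1 h0
        obtain ⟨r, rfl⟩ := hp x
        exact ⟨⟨(-r, s), by simp [t, hx]⟩, rfl⟩
    refine key.congr (LinearEquiv.ofSubmodules e.symm _ _ ?_)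
    ext x
    simp only [Submodule.mem_map, LinearMap.mem_ker, LinearMap.comp_apply]
    constructor
    · rintro ⟨y, hy, rfl⟩; simpa using hy
    · intro hx; exact ⟨e x, hx, by simp⟩

/-- A cyclic module has a resolution that starts with one generator. -/
theorem of_ideal {c n : ℕ} {J : Ideal R} (h : HasPartialResolution R c n J) (hc : 1 ≤ c)
    (x : X) (hx : ∀ y : X, ∃ r : R, r • x = y) (hJ : ∀ r : R, r • x = 0 ↔ r ∈ J) :
    HasPartialResolution R c (n + 1) X := by
  refine ⟨1, (LinearMap.toSpanSingleton R X x) ∘ₗ LinearMap.proj 0, hc, fun y => ?_, ?_⟩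
  · obtain ⟨r, hr⟩ := hx y
    exact ⟨fun _ => r, hr⟩
  · let e : R ≃ₗ[R] (Fin 1 → R) := (LinearEquiv.funUnique (Fin 1) R R).symm
    refine h.congr (LinearEquiv.ofSubmodules e _ _ ?_)
    ext r
    simp only [Submodule.mem_map, LinearMap.mem_ker, LinearMap.comp_apply]
    constructor
    · rintro ⟨s, hs, rfl⟩; exact (hJ s).2 hs
    · intro hr
      refine ⟨r 0, (hJ _).1 hr, ?_⟩
      ext i; rw [Subsingleton.elim i 0]; rfl

end HasPartialResolution

end

noncomputable section

/-! ### Generation of the homology from a resolution of the augmentation ideal -/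

/-- Every element of the product is `∑ j, t j • z j` with `z j ∈ Z`, so the products of the `t j`
with the given generators suffice. -/
theorem RelGen.ideal_smul {R M : Type*} [CommRing R] [AddCommGroup M] [Module R M]
    {ρ k : ℕ} (t : Fin ρ → R) {B Z : Submodule R M}
    (h : RelGen k B.toAddSubgroup Z.toAddSubgroup) :
    RelGen (ρ * k) (Ideal.span (Set.range t) • B).toAddSubgroup
      (Ideal.span (Set.range t) • Z).toAddSubgroup := by
  obtain ⟨v, hv⟩ := h
  have key := RelGen.of_fintype (B := (Ideal.span (Set.range t) • B).toAddSubgroup)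
    (Z := (Ideal.span (Set.range t) • Z).toAddSubgroup) (κ := Fin ρ × Fin k)
    (fun q => t q.1 • v q.2) ?_
  · simpa using key
  · intro x hx
    have hx' : ∃ z : Fin ρ → M, (∀ j, z j ∈ Z) ∧ x = ∑ j, t j • z j := by
      refine Submodule.smul_induction_on (p := fun x => ∃ z : Fin ρ → M, (∀ j, z j ∈ Z) ∧
        x = ∑ j, t j • z j) hx ?_ ?_
      · intro r hr z hz
        obtain ⟨c, hc⟩ := (Ideal.mem_span_range_iff_exists_fun).1 hr
        refine ⟨fun j => c j • z, fun j => Z.smul_mem _ hz, ?_⟩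
        rw [← hc, Finset.sum_smul]
        exact Finset.sum_congr rfl fun j _ => by rw [smul_smul, mul_comm]
      · rintro _ _ ⟨z, hz, rfl⟩ ⟨z', hz', rfl⟩
        exact ⟨z + z', fun j => Z.add_mem (hz j) (hz' j), by simp [Finset.sum_add_distrib]⟩
    obtain ⟨z, hz, rfl⟩ := hx'
    choose c hc using fun j => hv (z j) (hz j)
    refine ⟨fun q => c q.1 q.2, ?_⟩
    have : ∑ j, t j • z j - ∑ q : Fin ρ × Fin k, c q.1 q.2 • t q.1 • v q.2
        = ∑ j, t j • (z j - ∑ i, c j i • v i) := by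
      simp only [Fintype.sum_prod_type, smul_sub, Finset.sum_sub_distrib, Finset.smul_sum]
      congr 1
      exact Finset.sum_congr rfl fun j _ => Finset.sum_congr rfl fun i _ => smul_comm _ _ _
    rw [this]
    exact AddSubgroup.sum_mem _ fun j _ =>
      Submodule.smul_mem_smul (Ideal.subset_span ⟨j, rfl⟩) (hc j)

/-- The `s`-th layer of the adic filtration of `Z` is covered by the products of `s` ideal
generators with the first layer, hence needs at most `ρ ^ s * k` generators; the `r` layers are
added up. -/
theorem RelGen.ideal_pow_smul {R M : Type*} [CommRing R] [AddCommGroup M] [Module R M]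
    {ρ k : ℕ} (t : Fin ρ → R) {Z : Submodule R M}
    (h : RelGen k (Ideal.span (Set.range t) • Z).toAddSubgroup Z.toAddSubgroup) (r : ℕ) :
    RelGen (k * ∑ s ∈ Finset.range r, ρ ^ s) (Ideal.span (Set.range t) ^ r • Z).toAddSubgroup
      Z.toAddSubgroup := by
  have step : ∀ s, RelGen (ρ ^ s * k) (Ideal.span (Set.range t) ^ (s + 1) • Z).toAddSubgroup
      (Ideal.span (Set.range t) ^ s • Z).toAddSubgroup := by
    intro s
    induction s with
    | zero => simpa using h
    | succ s ih =>
      have := ih.ideal_smul t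
      rw [← mul_smul, ← mul_smul, ← pow_succ', ← pow_succ', ← mul_assoc, ← pow_succ'] at this
      exact this
  induction r with
  | zero => simpa using RelGen.of_le (le_refl Z.toAddSubgroup)
  | succ r ih =>
    have := (step r).trans ih
    rwa [add_comm, mul_comm _ k, ← mul_add, ← Finset.sum_range_succ] at this

theorem LinearMap.apply_eq_sum_single {R M : Type*} [CommRing R] [AddCommGroup M] [Module R M]
    {ρ : ℕ} (p : (Fin ρ → R) →ₗ[R] M) (y : Fin ρ → R) :
    p y = ∑ j, y j • p (Pi.single j 1) := by
  rw [LinearMap.pi_apply_eq_sum_univ p y]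
  refine Finset.sum_congr rfl fun j _ => ?_
  congr 2
  ext i
  simp [Pi.single_apply, eq_comm]

namespace BasedComplex

variable {R : Type u} [CommRing R] (F : BasedComplex.{u, w} R)

/-- The inclusion of `I • cycles` in the cycles is split at the cycles with all coordinates in `I`.
Above this point the quotient embeds into chains modulo `I`, which by `hI` are generated by the
basis as an abelian group. Below it, the question is which cycles with coefficients in `I` lift
along `p`, and the connecting homomorphism measures this in degree `n - 1`. -/
theorem relGen_ideal_smul_cycles {I : Ideal R} (hI : ∀ x : R, ∃ m : ℤ, x - m ∈ I) {ρ l n : ℕ}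
    (p : (Fin ρ → R) →ₗ[R] I) (hp : Function.Surjective p)
    (h : ∀ m, n = m + 1 → F.HomologyGen (LinearMap.ker p) l m) :
    RelGen (l + Fintype.card (F.ι n)) (I • F.cyclesCoeff R n).toAddSubgroup
      (F.cyclesCoeff R n).toAddSubgroup := by
  classical
  let IC : Submodule R (F.ι n → R) := Submodule.pi Set.univ fun _ => I
  have h1 : RelGen (Fintype.card (F.ι n)) IC.toAddSubgroup (⊤ : AddSubgroup (F.ι n → R)) := by
    refine RelGen.of_fintype (fun a => Pi.single a 1) fun z _ => ?_
    choose m hm using fun a => hI (z a)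
    refine ⟨m, fun a _ => ?_⟩
    simpa [Finset.sum_apply, Pi.single_apply] using hm a
  have h2 : RelGen (Fintype.card (F.ι n)) (IC ⊓ F.cyclesCoeff R n).toAddSubgroup
      (F.cyclesCoeff R n).toAddSubgroup :=
    h1.comap (AddMonoidHom.id _) (fun _ _ => trivial) fun z hz hz' => ⟨hz', hz⟩
  refine RelGen.trans ?_ h2
  -- A lift to `R ^ ρ` has components that are cycles over `R`, and `p` recombines them with the
  -- ideal generators `p (Pi.single j 1)` as coefficients.
  have hlift : ∀ y ∈ F.liftableCycles p n, (fun a => (y a : R)) ∈ I • F.cyclesCoeff R n := by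
    rintro _ ⟨x, hx, rfl⟩
    have : (fun a => ((p.compLeft (F.ι n) x a : I) : R)) =
        ∑ j, (p (Pi.single j 1) : R) • fun a => x a j := by
      ext a
      rw [LinearMap.compLeft_apply, Function.comp, LinearMap.apply_eq_sum_single p (x a)]
      simp [Finset.sum_apply, mul_comm]
    rw [this]
    exact Submodule.sum_mem _ fun j _ => Submodule.smul_mem_smul (p _).2
      (F.mem_cyclesCoeff_pi hx j)
  cases n with
  | zero =>
    refine (RelGen.of_le ?_).mono (Nat.zero_le l)
    rintro y ⟨hy, -⟩
    obtain ⟨x, hx⟩ := F.exists_lift hp (n := 0) fun a => (⟨y a, hy a trivial⟩ : I)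
    have := hlift _ ⟨x, trivial, hx⟩
    exact this
  | succ n =>
    refine RelGen.map (I.subtype.compLeft (F.ι (n + 1))).toAddMonoidHom
      (F.relGen_cyclesCoeff_of_ker p hp (h n rfl)) hlift ?_
    rintro y ⟨hy, hy'⟩
    refine ⟨fun a => ⟨y a, hy a trivial⟩, ?_, ?_⟩
    · exact F.mem_cyclesCoeff_of_injective I.subtype Subtype.val_injective (n + 1) hy'
    · have : y - (I.subtype.compLeft (F.ι (n + 1))) (fun a => ⟨y a, hy a trivial⟩) = 0 := by
        ext; simp
      change y - (I.subtype.compLeft (F.ι (n + 1))) (fun a => ⟨y a, hy a trivial⟩) ∈ _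
      rw [this]; exact AddSubgroup.zero_mem _

/-- The kernel of the first step of the resolution of `I` has a resolution of length `n`, which is
what dimension shifting from degree `n - 1` consumes. This bounds the top layer of the `I`-adic
filtration of the cycles, and by `hr` the `r`-th power already lies in the boundaries. Only degrees
below `n` enter, so the bound can be iterated. -/
theorem homologyGen_of_nilpotent {I : Ideal R} (hI : ∀ x : R, ∃ m : ℤ, x - m ∈ I) {c r n : ℕ}
    {k : ℕ → ℕ} (h : HasPartialResolution R c (n + 1) I)
    (hk : ∀ j < n, F.HomologyGen R (k j) j)
    (hr : I ^ r • F.cyclesCoeff R n ≤ F.boundariesCoeff R n) :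
    F.HomologyGen R ((c * ∑ j ∈ Finset.range n, k j + Fintype.card (F.ι n)) *
      ∑ s ∈ Finset.range r, c ^ s) n := by
  obtain ⟨ρ, p, hρ, hp, hres⟩ := h
  have h1 := F.relGen_ideal_smul_cycles hI (n := n) (l := c * ∑ j ∈ Finset.range n, k j) p hp (by
    rintro m rfl
    exact hres.homologyGen F fun j hj => hk j (by omega))
  have hspan : Ideal.span (Set.range fun j => (p (Pi.single j 1) : R)) = I := by
    apply le_antisymm
    · rw [Ideal.span_le]; rintro _ ⟨j, rfl⟩; exact (p _).2
    · intro x hx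
      obtain ⟨y, hy⟩ := hp ⟨x, hx⟩
      have h2 := congrArg Subtype.val (LinearMap.apply_eq_sum_single p y)
      rw [hy] at h2
      rw [show x = _ from h2, AddSubmonoidClass.coe_finsetSum]
      exact Ideal.sum_mem _ fun j _ => Ideal.mul_mem_left _ _ (Ideal.subset_span ⟨j, rfl⟩)
  have h2 := RelGen.ideal_pow_smul (fun j => (p (Pi.single j 1) : R)) (by rwa [hspan]) r
    (Z := F.cyclesCoeff R n)
  rw [hspan] at h2
  refine (RelGen.map (AddMonoidHom.id _) h2 (fun b hb => hr hb) fun z hz =>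
    ⟨z, hz, by simp⟩).mono ?_
  exact Nat.mul_le_mul_left _ (Finset.sum_le_sum fun s _ => Nat.pow_le_pow_left hρ s)

end BasedComplex

/-! ### Resolutions over the group ring of a finite abelian group -/

namespace HasPartialResolution

/-- The quotient `V/J` is cyclic, generated by the class of `x`, with annihilator `A`. So its
resolution starts with one generator and continues with one of `A`; the horseshoe lemma adds a
resolution of `J`. -/
theorem ideal_step {R : Type u} [CommRing R] {J V A : Ideal R} (hJV : J ≤ V) (x : R)
    (hx : x ∈ V) (hV : ∀ y ∈ V, ∃ r : R, y - r * x ∈ J) (hA : ∀ r, r * x ∈ J ↔ r ∈ A)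
    {c c' n : ℕ} (hc' : 1 ≤ c') (h : HasPartialResolution R c (n + 1) J)
    (h' : HasPartialResolution R c' n A) : HasPartialResolution R (c + c') (n + 1) V := by
  let J' : Submodule R V := Submodule.comap V.subtype J
  have hZ : HasPartialResolution R c' (n + 1) (V ⧸ J') := by
    refine of_ideal h' hc' (J'.mkQ ⟨x, hx⟩) (fun y => ?_) fun r => ?_
    · obtain ⟨⟨y, hy⟩, rfl⟩ := J'.mkQ_surjective y
      obtain ⟨r, hr⟩ := hV y hy
      refine ⟨r, ?_⟩
      rw [← map_smul, ← sub_eq_zero, ← map_sub, Submodule.mkQ_apply, Submodule.Quotient.mk_eq_zero]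
      change r * x - y ∈ J
      rw [← neg_sub]; exact J.neg_mem hr
    · rw [← map_smul, Submodule.mkQ_apply, Submodule.Quotient.mk_eq_zero]
      exact hA r
  refine extension h hZ (Submodule.inclusion hJV) J'.mkQ (Submodule.inclusion_injective _) ?_
    J'.mkQ_surjective
  intro y
  rw [Submodule.mkQ_apply, Submodule.Quotient.mk_eq_zero]
  constructor
  · intro hy; exact ⟨⟨y, hy⟩, rfl⟩
  · rintro ⟨z, rfl⟩; exact z.2

theorem bot {R : Type u} [CommRing R] (c n : ℕ) :
    HasPartialResolution R c n (⊥ : Ideal R) := by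
  have : ∀ X : Type u, ∀ [AddCommGroup X] [Module R X] [Subsingleton X],
      HasPartialResolution R c n X := by
    induction n with
    | zero => intros; trivial
    | succ n ih =>
      intro X _ _ _
      exact ⟨0, 0, Nat.zero_le _, fun x => ⟨0, Subsingleton.elim _ _⟩, ih _⟩
  exact this _

end HasPartialResolution

namespace GroupRing

open MonoidAlgebra

section Cyclic

variable {Q : Type u} [CommGroup Q] (τ : Q)

/-- The norm element of the cyclic group generated by `τ`. -/
def norm : MonoidAlgebra ℤ Q := ∑ j ∈ Finset.range (orderOf τ), of ℤ Q (τ ^ j)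

theorem norm_mul_sub_one : norm τ * (of ℤ Q τ - 1) = 0 := by
  have h := geom_sum_mul (of ℤ Q τ) (orderOf τ)
  simp only [← map_pow] at h
  rw [norm, h, pow_orderOf_eq_one, map_one, sub_self]

/-- The projection to the group ring of the quotient by `τ`. -/
abbrev proj : MonoidAlgebra ℤ Q →+* MonoidAlgebra ℤ (Q ⧸ Subgroup.zpowers τ) :=
  mapDomainRingHom ℤ (QuotientGroup.mk' (Subgroup.zpowers τ))

/-- An element of `Q` differs from its coset representative by a power of `τ`, and `τ ^ j - 1` is a
multiple of `τ - 1`. -/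
theorem sub_mapDomain_out_mem [Finite Q] (x : MonoidAlgebra ℤ Q) :
    x - mapDomain Quotient.out (proj τ x) ∈ Ideal.span {of ℤ Q τ - 1} := by
  induction x using MonoidAlgebra.induction_linear with
  | zero => simp
  | add x y hx hy =>
    rw [map_add, mapDomain_add, add_sub_add_comm]
    exact Ideal.add_mem _ hx hy
  | single q m =>
    obtain ⟨j, hj⟩ : ∃ j : ℕ, q = τ ^ j * (Quotient.out (q : Q ⧸ Subgroup.zpowers τ)) := by
      have h1 : q * (Quotient.out (q : Q ⧸ Subgroup.zpowers τ))⁻¹ ∈ Subgroup.zpowers τ := by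
        rw [mul_comm]
        exact QuotientGroup.eq.1 (Quotient.out_eq' (q : Q ⧸ Subgroup.zpowers τ))
      obtain ⟨j, hj⟩ := mem_powers_iff_mem_zpowers.2 h1
      exact ⟨j, by rw [show τ ^ j = _ from hj]; simp⟩
    have h2 : single q m - mapDomain Quotient.out (proj τ (single q m)) =
        (single (Quotient.out (q : Q ⧸ Subgroup.zpowers τ)) m) * (of ℤ Q τ ^ j - 1) := by
      rw [mul_sub, mul_one, ← map_pow, of_apply, single_mul_single, mul_one,
        mul_comm _ (τ ^ j), ← hj]
      simp
    rw [h2]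
    refine Ideal.mul_mem_left _ _ ?_
    rw [← geom_sum_mul]
    exact Ideal.mul_mem_left _ _ (Ideal.subset_span rfl)

theorem mem_span_of_proj_eq_zero [Finite Q] {x : MonoidAlgebra ℤ Q} (hx : proj τ x = 0) :
    x ∈ Ideal.span {of ℤ Q τ - 1} := by
  have := sub_mapDomain_out_mem τ x
  rwa [hx, mapDomain_zero, sub_zero] at this

theorem proj_eq_zero_of_mem_span {x : MonoidAlgebra ℤ Q} (hx : x ∈ Ideal.span {of ℤ Q τ - 1}) :
    proj τ x = 0 := by
  obtain ⟨y, rfl⟩ := Ideal.mem_span_singleton'.1 hx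
  have : proj τ (of ℤ Q τ) = 1 := by
    have h1 : (QuotientGroup.mk' (Subgroup.zpowers τ)) τ = 1 :=
      (QuotientGroup.eq_one_iff τ).2 (Subgroup.mem_zpowers τ)
    simp only [of_apply, mapDomainRingHom_apply, mapDomain_single]
    rw [h1]; rfl
  rw [map_mul, map_sub, this, map_one, sub_self, mul_zero]

/-- The norm maps to the integer `orderOf τ` in the group ring of the quotient, which is
torsion-free. Hence the image of `x` there vanishes. -/
theorem mem_span_of_norm_mul_eq_zero [Finite Q] {x : MonoidAlgebra ℤ Q} (hx : norm τ * x = 0) :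
    x ∈ Ideal.span {of ℤ Q τ - 1} := by
  have h1 : proj τ (norm τ) = (orderOf τ : MonoidAlgebra ℤ (Q ⧸ Subgroup.zpowers τ)) := by
    have : ∀ j : ℕ, proj τ (of ℤ Q (τ ^ j)) = 1 := fun j => by
      have h := proj_eq_zero_of_mem_span τ (x := of ℤ Q (τ ^ j) - 1) (by
        rw [map_pow, ← geom_sum_mul]
        exact Ideal.mul_mem_left _ _ (Ideal.subset_span rfl))
      rwa [map_sub, map_one, sub_eq_zero] at h
    rw [norm, map_sum, Finset.sum_congr rfl fun j _ => this j]
    simp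
  have h2 : (orderOf τ : MonoidAlgebra ℤ (Q ⧸ Subgroup.zpowers τ)) * proj τ x = 0 := by
    rw [← h1, ← map_mul, hx, map_zero]
  apply mem_span_of_proj_eq_zero
  rw [← nsmul_eq_mul] at h2
  ext q
  have h3 : orderOf τ • (proj τ x).coeff q = 0 := by
    rw [← coeff_smul_apply, h2]; rfl
  exact (smul_eq_zero.1 h3).resolve_left (orderOf_pos τ).ne'

/-- Such an `x` has coefficients that are constant on the cosets of `τ`, so it is the norm times its
restriction `w` to a set of coset representatives. -/
theorem mem_span_norm [Finite Q] {x : MonoidAlgebra ℤ Q} (hx : (of ℤ Q τ - 1) * x = 0) :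
    ∃ w, x = w * norm τ := by
  classical
  have hinv : ∀ (j : ℕ) q, x.coeff ((τ ^ j)⁻¹ * q) = x.coeff q := by
    intro j q
    have h : of ℤ Q (τ ^ j) * x = x := by
      rw [map_pow, ← sub_eq_zero, ← sub_one_mul, ← geom_sum_mul, mul_assoc, hx, mul_zero]
    conv_rhs => rw [← h, of_apply, coeff_single_mul_apply]
    simp
  let _ := Fintype.ofFinite Q
  let w : MonoidAlgebra ℤ Q := .ofCoeff <| Finsupp.equivFunOnFinite.symm fun q =>
    if q = Quotient.out (q : Q ⧸ Subgroup.zpowers τ) then x.coeff q else 0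
  have hw : ∀ q, w.coeff q =
      if q = Quotient.out (q : Q ⧸ Subgroup.zpowers τ) then x.coeff q else 0 := fun q => rfl
  refine ⟨w, ?_⟩
  ext q
  rw [mul_comm, norm, Finset.sum_mul, coeff_sum, Finsupp.finsetSum_apply]
  obtain ⟨j, hj, hjq⟩ : ∃ j < orderOf τ,
      (τ ^ j)⁻¹ * q = Quotient.out (q : Q ⧸ Subgroup.zpowers τ) := by
    have h1 : q * (Quotient.out (q : Q ⧸ Subgroup.zpowers τ))⁻¹ ∈ Subgroup.zpowers τ := by
      rw [mul_comm]
      exact QuotientGroup.eq.1 (Quotient.out_eq' (q : Q ⧸ Subgroup.zpowers τ))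
    obtain ⟨j, hj⟩ := (mem_powers_iff_mem_zpowers.2 h1)
    refine ⟨j % orderOf τ, Nat.mod_lt _ (orderOf_pos τ), ?_⟩
    rw [pow_mod_orderOf, show τ ^ j = _ from hj]
    simp
  have hmk : ∀ i : ℕ, (((τ ^ i)⁻¹ * q : Q) : Q ⧸ Subgroup.zpowers τ) = q := fun i => by
    rw [QuotientGroup.eq]
    simp only [mul_inv_rev, inv_inv, mul_comm _ (τ ^ i), mul_assoc, inv_mul_cancel, mul_one]
    exact Subgroup.pow_mem _ (Subgroup.mem_zpowers τ) i
  rw [Finset.sum_eq_single_of_mem j (Finset.mem_range.2 hj)]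
  · rw [of_apply, coeff_single_mul_apply, one_mul, hw, if_pos (by rw [hmk, hjq]), hinv]
  · intro i hi hij
    rw [of_apply, coeff_single_mul_apply, one_mul, hw, if_neg]
    rw [hmk, ← hjq]
    intro h
    refine hij (pow_injOn_Iio_orderOf (Finset.mem_range.1 hi) hj ?_)
    simpa using h

end Cyclic

section Tower

variable {B : Type u} [CommGroup B]

/-- The kernel of the map of group rings that is induced by a group homomorphism. -/
abbrev homKer {Q : Type u} [CommGroup Q] (ψ : B →* Q) : Ideal (MonoidAlgebra ℤ B) :=
  RingHom.ker (mapDomainRingHom ℤ ψ)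

/-- With `J` and `J'` the kernels before and after dividing by `τ`, the quotient `J'/J` is generated
by `t - 1` with annihilator `V`, and `V/J` is generated by a lift of the norm with annihilator `J'`.
This 2-periodicity gives a recursion that expresses the ranks for `J'` by those for `J` and by those
for `J'` in length two less. The base `3 * (i + 1)` grows by `3` per cyclic step, which absorbs the
two extra terms of the recursion. -/
theorem hasPartialResolution_step {Q : Type u} [CommGroup Q] [Finite Q] (ψ : B →* Q)
    (hψ : Function.Surjective ψ) (τ : Q) {i : ℕ}
    (h : ∀ n, HasPartialResolution (MonoidAlgebra ℤ B) ((3 * (i + 1)) ^ n) n (homKer ψ)) (n : ℕ) :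
    HasPartialResolution (MonoidAlgebra ℤ B) ((3 * (i + 2)) ^ n) n
      (homKer ((QuotientGroup.mk' (Subgroup.zpowers τ)).comp ψ)) := by
  obtain ⟨t, rfl⟩ := hψ τ
  set J := homKer ψ
  set J' := homKer ((QuotientGroup.mk' (Subgroup.zpowers (ψ t))).comp ψ)
  let Ψ : MonoidAlgebra ℤ B →+* MonoidAlgebra ℤ Q := mapDomainRingHom ℤ ψ
  have hΨ : Function.Surjective Ψ := fun y => by
    refine ⟨mapDomain (Function.surjInv hψ) y, ?_⟩
    change mapDomain ψ (mapDomain _ y) = y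
    apply coeff_injective
    rw [coeff_mapDomain, coeff_mapDomain, ← Finsupp.mapDomain_comp, Function.comp_surjInv hψ,
      Finsupp.mapDomain_id]
  have hof : ∀ b, Ψ (of ℤ B b) = of ℤ Q (ψ b) := fun b => by simp [Ψ]
  have hJ : ∀ x, x ∈ J ↔ Ψ x = 0 := fun x => Iff.rfl
  have hJ' : ∀ x, x ∈ J' ↔ proj (ψ t) (Ψ x) = 0 := fun x => by
    rw [← RingHom.comp_apply]
    change mapDomainRingHom ℤ _ x = 0 ↔ _
    rw [mapDomainRingHom_comp]
  let x₀ : MonoidAlgebra ℤ B := of ℤ B t - 1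
  have hx₀ : Ψ x₀ = of ℤ Q (ψ t) - 1 := by rw [map_sub, hof, map_one]
  obtain ⟨N, hN⟩ := hΨ (norm (ψ t))
  let V : Ideal (MonoidAlgebra ℤ B) := Submodule.comap (LinearMap.mulRight _ x₀) J
  have hV : ∀ x, x ∈ V ↔ Ψ x * (of ℤ Q (ψ t) - 1) = 0 := fun x => by
    change Ψ (x * x₀) = 0 ↔ _
    rw [map_mul, hx₀]
  have hJV : J ≤ V := fun x hx => J.mul_mem_right _ hx
  have hJJ' : J ≤ J' := fun x hx => by rw [hJ', (hJ x).1 hx, map_zero]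
  have stepV : ∀ {c c' n : ℕ}, 1 ≤ c' → HasPartialResolution (MonoidAlgebra ℤ B) c (n + 1) J →
      HasPartialResolution (MonoidAlgebra ℤ B) c' n J' → HasPartialResolution (MonoidAlgebra ℤ B) (c + c') (n + 1) V := by
    refine fun hc' => HasPartialResolution.ideal_step hJV N ?_ ?_ ?_ hc'
    · rw [hV, hN, norm_mul_sub_one]
    · intro y hy
      rw [hV, mul_comm] at hy
      obtain ⟨w, hw⟩ := mem_span_norm (ψ t) hy
      obtain ⟨r, rfl⟩ := hΨ w
      exact ⟨r, by rw [hJ, map_sub, map_mul, hN, hw, sub_self]⟩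
    · intro r
      rw [hJ, hJ', map_mul, hN, mul_comm]
      refine ⟨fun hr => proj_eq_zero_of_mem_span _ (mem_span_of_norm_mul_eq_zero _ hr),
        fun hr => ?_⟩
      obtain ⟨y, hy⟩ := Ideal.mem_span_singleton'.1 (mem_span_of_proj_eq_zero _ hr)
      rw [← hy, mul_left_comm, norm_mul_sub_one, mul_zero]
  have stepJ' : ∀ {c c' n : ℕ}, 1 ≤ c' → HasPartialResolution (MonoidAlgebra ℤ B) c (n + 1) J →
      HasPartialResolution (MonoidAlgebra ℤ B) c' n V → HasPartialResolution (MonoidAlgebra ℤ B) (c + c') (n + 1) J' := by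
    refine fun hc' => HasPartialResolution.ideal_step hJJ' x₀ ?_ ?_ ?_ hc'
    · rw [hJ', hx₀]; exact proj_eq_zero_of_mem_span _ (Ideal.subset_span rfl)
    · intro y hy
      rw [hJ'] at hy
      obtain ⟨w, hw⟩ := Ideal.mem_span_singleton'.1 (mem_span_of_proj_eq_zero _ hy)
      obtain ⟨r, rfl⟩ := hΨ w
      exact ⟨r, by rw [hJ, map_sub, map_mul, hx₀, hw, sub_self]⟩
    · intro r; exact Iff.rfl
  induction n using Nat.strong_induction_on with
  | _ n ih =>
    match n with
    | 0 => trivial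
    | 1 =>
      refine (stepJ' le_rfl (h 1) (c' := 1) trivial).mono ?_
      simp only [pow_one]; omega
    | n + 2 =>
      -- One full period: length `n` for `J'` gives length `n + 1` for `V`, and this gives length `n
      -- + 2` for `J'`.
      have hV' := stepV (Nat.one_le_pow _ _ (by omega)) (h (n + 1)) (ih n (by omega))
      refine (stepJ' (Nat.le_add_left_of_le (Nat.one_le_pow _ _ (by omega))) (h (n + 2)) hV').mono
        ?_
      have e : 3 * (i + 2) = 3 * (i + 1) + 3 := by ring
      have hp : (3 * (i + 1)) ^ (n + 1) ≤ (3 * (i + 2)) ^ (n + 1) := Nat.pow_le_pow_left (by omega) _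
      have hp' : (3 * (i + 2)) ^ n ≤ (3 * (i + 2)) ^ (n + 1) :=
        Nat.pow_le_pow_right (by omega) (by omega)
      calc (3 * (i + 1)) ^ (n + 2) + ((3 * (i + 1)) ^ (n + 1) + (3 * (i + 2)) ^ n)
          ≤ 3 * (i + 1) * (3 * (i + 2)) ^ (n + 1) + ((3 * (i + 2)) ^ (n + 1)
            + (3 * (i + 2)) ^ (n + 1)) := by
            rw [pow_succ' (3 * (i + 1)) (n + 1)]
            exact Nat.add_le_add (Nat.mul_le_mul_left _ hp) (Nat.add_le_add hp hp')
        _ ≤ (3 * (i + 2)) ^ (n + 2) := by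
            rw [pow_succ' (3 * (i + 2)) (n + 1), e]
            generalize (3 * (i + 1) + 3) ^ (n + 1) = y
            nlinarith

/-- The augmentation ideal of the group ring of a finite abelian group has a partial resolution
whose ranks are polynomial in the logarithm of the order of the group. -/
theorem exists_hasPartialResolution (B : Type u) [CommGroup B] [Finite B] :
    ∃ (a : ℕ) (I : Ideal (MonoidAlgebra ℤ B)), 2 ^ a ≤ Nat.card B ∧
      I = Ideal.span (Set.range fun b => of ℤ B b - 1) ∧
      ∀ n, HasPartialResolution (MonoidAlgebra ℤ B) ((3 * (a + 1)) ^ n) n I := by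
  -- Induction over a tower of quotients of `B`, from `Q = B` with zero kernel down to the trivial
  -- group, whose kernel is the augmentation ideal. Each step divides by a nontrivial cyclic
  -- subgroup and so at least halves `Q`; the invariant `2 ^ i * |Q| ≤ |B|` bounds the number of
  -- steps.
  suffices H : ∀ (m : ℕ) (Q : Type u) [CommGroup Q] [Finite Q] (ψ : B →* Q) (i : ℕ),
      Nat.card Q ≤ m → Function.Surjective ψ → 2 ^ i * Nat.card Q ≤ Nat.card B →
      (∀ n, HasPartialResolution (MonoidAlgebra ℤ B) ((3 * (i + 1)) ^ n) n (homKer ψ)) →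
      ∃ (a : ℕ) (I : Ideal (MonoidAlgebra ℤ B)), 2 ^ a ≤ Nat.card B ∧
        I = Ideal.span (Set.range fun b => of ℤ B b - 1) ∧
        ∀ n, HasPartialResolution (MonoidAlgebra ℤ B) ((3 * (a + 1)) ^ n) n I by
    refine H _ B (MonoidHom.id B) 0 le_rfl Function.surjective_id (by simp) fun n => ?_
    have : homKer (MonoidHom.id B) = ⊥ := by
      rw [eq_bot_iff]; intro x hx
      have hx' : mapDomainRingHom ℤ (MonoidHom.id B) x = 0 := hx
      simpa using hx'
    rw [this]; exact HasPartialResolution.bot _ _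
  intro m
  induction m with
  | zero =>
    intro Q _ _ ψ i hm
    have := Nat.card_pos (α := Q)
    omega
  | succ m ih =>
    intro Q _ _ ψ i hm hψ hcard h
    rcases subsingleton_or_nontrivial Q with hQ | hQ
    · refine ⟨i, homKer ψ, ?_, ?_, h⟩
      · have := Nat.card_pos (α := Q)
        exact le_trans (Nat.le_mul_of_pos_right _ this) hcard
      · apply le_antisymm
        · intro x hx
          have hsum : ∀ x : MonoidAlgebra ℤ B, x - single 1 (mapDomain ψ x |>.coeff 1) ∈
              Ideal.span (Set.range fun b => of ℤ B b - 1) := by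
            intro x
            induction x using MonoidAlgebra.induction_linear with
            | zero => simp
            | add x y hx hy =>
              rw [mapDomain_add, coeff_add, Finsupp.add_apply, single_add, add_sub_add_comm]
              exact Ideal.add_mem _ hx hy
            | single b m =>
              rw [mapDomain_single, Subsingleton.elim (ψ b) 1]
              have : single b m - single 1 ((single (1 : Q) m).coeff 1) =
                  single 1 m * (of ℤ B b - 1) := by
                rw [mul_sub, mul_one, of_apply, single_mul_single]; simp
              rw [this]
              exact Ideal.mul_mem_left _ _ (Ideal.subset_span ⟨b, rfl⟩)
          have := hsum x
          rwa [show mapDomain ψ x = 0 from hx, coeff_zero, Finsupp.zero_apply, single_zero,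
            sub_zero] at this
        · rw [Ideal.span_le]
          rintro _ ⟨b, rfl⟩
          change mapDomainRingHom ℤ ψ _ = 0
          rw [map_sub, map_one, sub_eq_zero]
          simp [Subsingleton.elim (ψ b) 1, one_def]
    · obtain ⟨τ, hτ⟩ := exists_ne (1 : Q)
      have hc := Subgroup.card_eq_card_quotient_mul_card_subgroup (Subgroup.zpowers τ)
      have h2 : 2 ≤ Nat.card (Subgroup.zpowers τ) := by
        rw [Nat.card_zpowers]
        have := orderOf_pos τ
        have : orderOf τ ≠ 1 := fun h => hτ (orderOf_eq_one_iff.1 h)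
        omega
      have hpos := Nat.card_pos (α := Q ⧸ Subgroup.zpowers τ)
      refine ih (Q ⧸ Subgroup.zpowers τ) ((QuotientGroup.mk' _).comp ψ) (i + 1) ?_
        ((QuotientGroup.mk'_surjective _).comp hψ) ?_ (hasPartialResolution_step ψ hψ τ h)
      · nlinarith
      · refine le_trans ?_ hcard
        rw [hc, pow_succ, mul_assoc, mul_comm 2]
        exact Nat.mul_le_mul_left _ (Nat.mul_le_mul_left _ h2)

end Tower

end GroupRing

end

/-! ### Restriction of the complex to a finite abelian group that acts nilpotently -/

noncomputable section

theorem Ideal.pow_smul_le_of_filtration {R M : Type*} [CommRing R] [AddCommGroup M] [Module R M]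
    (I : Ideal R) (U : ℕ → Submodule R M) (r : ℕ) (h : ∀ k < r, I • U (k + 1) ≤ U k) :
    I ^ r • U r ≤ U 0 := by
  have hpow : ∀ j ≤ r, I ^ j • U r ≤ U (r - j) := by
    intro j hj
    induction j with
    | zero => simp
    | succ j ih =>
      rw [pow_succ', mul_smul]
      refine le_trans (Submodule.smul_mono le_rfl (ih (by omega))) ?_
      have h1 := h (r - (j + 1)) (by omega)
      rwa [show r - (j + 1) + 1 = r - j by omega] at h1
  simpa using hpow r le_rfl

namespace BasedComplex

section Underlying

theorem coeff_mul_eq_sum {Γ : Type*} [Group Γ] [Fintype Γ] (x y : MonoidAlgebra ℤ Γ) (k : Γ) :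
    (x * y).coeff k = ∑ g : Γ, x.coeff g * y.coeff (g⁻¹ * k) := by
  rw [MonoidAlgebra.coeff_mul_apply_left, Finsupp.sum_fintype _ _ (by simp)]

variable {Γ : Type v} [Group Γ] [Finite Γ] (D : BasedComplex.{v, w} (MonoidAlgebra ℤ Γ))

/-- The coordinates of a chain with respect to the `ℤ`-basis of the underlying complex. -/
def toUnderlying (n : ℕ) : D.X n ≃+ D.underlying.X n where
  toFun x p := (x p.1).coeff p.2
  invFun y a := .ofCoeff <| Finsupp.equivFunOnFinite.symm fun g => y (a, g)
  left_inv x := by ext; rfl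
  right_inv y := by ext; rfl
  map_add' x y := by ext; rfl

theorem toUnderlying_apply (n : ℕ) (x : D.X n) (a : D.ι n) (g : Γ) :
    D.toUnderlying n x (a, g) = (x a).coeff g := rfl

/-- The left translation by a group element on the chains of the underlying complex. -/
def translate (n : ℕ) (g : Γ) : D.underlying.X n →+ D.underlying.X n where
  toFun x p := x (p.1, g⁻¹ * p.2)
  map_zero' := rfl
  map_add' _ _ := rfl

theorem translate_apply (n : ℕ) (g : Γ) (x : D.underlying.X n) (p : D.ι n × Γ) :
    D.translate n g x p = x (p.1, g⁻¹ * p.2) := rfl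

theorem toUnderlying_of_smul (n : ℕ) (g : Γ) (x : D.X n) :
    D.toUnderlying n (MonoidAlgebra.of ℤ Γ g • x) = D.translate n g (D.toUnderlying n x) := by
  ext ⟨a, h⟩
  rw [translate_apply, toUnderlying_apply, toUnderlying_apply, Pi.smul_apply, smul_eq_mul,
    MonoidAlgebra.of_apply, MonoidAlgebra.coeff_single_mul_apply, one_mul]

theorem underlying_d_apply [Fintype Γ] (n : ℕ) (x : D.underlying.X (n + 1)) (c : D.ι n) (k : Γ) :
    D.underlying.d n x (c, k) =
      ∑ a : D.ι (n + 1), ∑ g : Γ, x (a, g) * (D.mat n a c).coeff (g⁻¹ * k) := by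
  have : D.underlying.d n x (c, k) = ∑ p : D.ι (n + 1) × Γ,
      x p * (D.mat n p.1 c).coeff (p.2⁻¹ * k) := by
    change (∑ p, _) = _
    exact Finset.sum_congr (congrArg (fun i : Fintype _ => @Finset.univ _ i)
      (Subsingleton.elim _ _)) fun _ _ => rfl
  rw [this, Fintype.sum_prod_type]

theorem toUnderlying_d (n : ℕ) (x : D.X (n + 1)) :
    D.toUnderlying n (D.d n x) = D.underlying.d n (D.toUnderlying (n + 1) x) := by
  let _ := Fintype.ofFinite Γ
  ext ⟨c, k⟩
  rw [underlying_d_apply, toUnderlying_apply]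
  have : D.d n x c = ∑ a, x a * D.mat n a c := rfl
  rw [this, MonoidAlgebra.coeff_sum, Finsupp.finsetSum_apply]
  exact Finset.sum_congr rfl fun a _ => coeff_mul_eq_sum _ _ _

theorem toUnderlying_mem_boundaries {n : ℕ} {x : D.X n} :
    D.toUnderlying n x ∈ D.underlying.boundaries n ↔ x ∈ D.boundaries n := by
  constructor
  · rintro ⟨y, hy⟩
    obtain ⟨z, rfl⟩ := (D.toUnderlying (n + 1)).surjective y
    rw [← toUnderlying_d] at hy
    exact ⟨z, (D.toUnderlying n).injective hy⟩
  · rintro ⟨y, rfl⟩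
    exact ⟨D.toUnderlying _ y, (D.toUnderlying_d n y).symm⟩

theorem toUnderlying_mem_cycles {n : ℕ} {x : D.X n} :
    D.toUnderlying n x ∈ D.underlying.cycles n ↔ x ∈ D.cycles n := by
  cases n with
  | zero => exact Iff.rfl
  | succ n =>
    change D.underlying.d n _ = 0 ↔ D.d n x = 0
    rw [← toUnderlying_d, map_eq_zero_iff _ (D.toUnderlying n).injective]

/-- There is a filtration of length `r` from the boundaries to the cycles of the underlying complex
such that the elements of `S` act trivially on the quotients. -/
def NilpotentTranslation (S : Set Γ) (n r : ℕ) : Prop :=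
  ∃ F : ℕ → AddSubgroup (D.underlying.X n), F 0 = (D.underlying.boundaries n).toAddSubgroup ∧
    F r = (D.underlying.cycles n).toAddSubgroup ∧
    (∀ k ≤ r, ∀ g ∈ S, ∀ x ∈ F k, D.translate n g x ∈ F k) ∧
    ∀ k < r, ∀ g ∈ S, ∀ x ∈ F (k + 1), D.translate n g x - x ∈ F k

theorem nilpotentTranslation_of_hasTrivialFiltration {H : Type v} [Group H] (φ : H →* Γ)
    {n s r : ℕ} (hs : s ≤ r) (h : HasTrivialFiltration H
      ((ModuleCat.restrictScalars (MonoidAlgebra.mapDomainRingHom ℤ φ)).obj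
        (ModuleCat.of (MonoidAlgebra ℤ Γ) (D.Homology n))) s) :
    D.NilpotentTranslation (Set.range φ) n r := by
  obtain ⟨F, hF0, hFs, -, hF⟩ := h
  let q : D.cycles n →+ (ModuleCat.restrictScalars (MonoidAlgebra.mapDomainRingHom ℤ φ)).obj
        (ModuleCat.of (MonoidAlgebra ℤ Γ) (D.Homology n)) :=
    (Submodule.mkQ ((D.boundaries n).submoduleOf (D.cycles n))).toAddMonoidHom
  have hq : ∀ g z, q (MonoidAlgebra.of ℤ Γ (φ g) • z) = MonoidAlgebra.of ℤ H g • q z := by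
    intro g z
    refine (map_smul (Submodule.mkQ ((D.boundaries n).submoduleOf (D.cycles n))) _ z).trans ?_
    rw [ModuleCat.restrictScalars.smul_def (MonoidAlgebra.mapDomainRingHom ℤ φ)]
    simp only [MonoidAlgebra.of_apply, MonoidAlgebra.mapDomainRingHom_apply,
      MonoidAlgebra.mapDomain_single]
    rfl
  let j : D.cycles n →+ D.underlying.X n :=
    (D.toUnderlying n).toAddMonoidHom.comp (D.cycles n).subtype.toAddMonoidHom
  have hj : ∀ g z, j (MonoidAlgebra.of ℤ Γ g • z) = D.translate n g (j z) :=
    fun g z => D.toUnderlying_of_smul n g z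
  -- The filtration of the homology is pulled back to the cycles; `min k s` keeps it constant beyond
  -- its own length `s`, so that the length is exactly `r`.
  refine ⟨fun k => ((F (min k s)).toAddSubgroup.comap q).map j, ?_, ?_, ?_, ?_⟩
  · ext x
    obtain ⟨y, rfl⟩ := (D.toUnderlying n).surjective x
    change _ ↔ _ ∈ D.underlying.boundaries n
    rw [toUnderlying_mem_boundaries]
    have hq0 : ∀ z : D.cycles n, q z = 0 ↔ (z : D.X n) ∈ D.boundaries n := fun z =>
      Submodule.Quotient.mk_eq_zero _
    simp only [Nat.zero_min, hF0]
    constructor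
    · rintro ⟨z, hz, hzy⟩
      rw [← (D.toUnderlying n).injective hzy]
      exact (hq0 z).1 hz
    · intro hy
      have hyc : y ∈ D.cycles n := by
        obtain ⟨w, rfl⟩ := hy
        cases n with
        | zero => trivial
        | succ n =>
          change D.d n (D.d (n + 1) w) = 0
          simp only [d, Matrix.vecMulLinear_apply, Matrix.vecMul_vecMul, D.mat_mul_mat,
            Matrix.vecMul_zero]
      exact ⟨⟨y, hyc⟩, (hq0 ⟨y, hyc⟩).2 hy, rfl⟩
  · ext x
    obtain ⟨y, rfl⟩ := (D.toUnderlying n).surjective x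
    change _ ↔ _ ∈ D.underlying.cycles n
    rw [toUnderlying_mem_cycles]
    simp only [min_eq_right hs, hFs]
    constructor
    · rintro ⟨z, -, hzy⟩
      rw [← (D.toUnderlying n).injective hzy]
      exact z.2
    · intro hy
      exact ⟨⟨y, hy⟩, trivial, rfl⟩
  · rintro k - _ ⟨g, rfl⟩ _ ⟨z, hz, rfl⟩
    refine ⟨MonoidAlgebra.of ℤ Γ (φ g) • z, ?_, hj _ _⟩
    change q _ ∈ F _
    rw [hq]
    exact Submodule.smul_mem _ _ hz
  · rintro k - _ ⟨g, rfl⟩ _ ⟨z, hz, rfl⟩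
    refine ⟨MonoidAlgebra.of ℤ Γ (φ g) • z - z, ?_, by rw [map_sub, hj]⟩
    change q _ ∈ F _
    rw [map_sub, hq]
    rcases lt_or_ge k s with hk | hk
    · rw [min_eq_left hk.le]
      refine hF k hk g _ ?_
      have : q z ∈ F (min (k + 1) s) := hz
      rwa [min_eq_left hk] at this
    · rw [min_eq_right hk, hFs]; trivial

theorem underlying_ext {B : Type*} [Group B] {φ : B →* Γ} {T : Set Γ}
    (hT : Function.Bijective fun p : B × T => φ p.1 * (p.2 : Γ)) {n : ℕ}
    {x y : D.underlying.X n}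
    (h : ∀ a b (t : T), x (a, φ b * t) = y (a, φ b * t)) : x = y := by
  ext ⟨a, g⟩
  obtain ⟨⟨b, t⟩, rfl⟩ := hT.2 g
  exact h a b t

end Underlying

section Restrict

variable {Γ : Type u} [Group Γ] [Finite Γ] (D : BasedComplex.{u, w} (MonoidAlgebra ℤ Γ))
  {B : Type u} [CommGroup B] [Finite B] (φ : B →* Γ) {T : Set Γ}
  (hT : Function.Bijective fun p : B × T => φ p.1 * (p.2 : Γ))

/-- The restriction of a based free complex to a subgroup with right transversal `T`. -/
def restrict : BasedComplex.{u, max w u} (MonoidAlgebra ℤ B) where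
  ι n := D.ι n × T
  fintype n := letI := Fintype.ofFinite T; instFintypeProd (D.ι n) T
  mat n := Matrix.of fun p q => .ofCoeff <| Finsupp.equivFunOnFinite.symm fun b =>
    (D.mat n p.1 q.1).coeff ((p.2 : Γ)⁻¹ * (φ b * q.2))
  mat_mul_mat n := by
    let _ : Fintype Γ := Fintype.ofFinite Γ
    let _ : Fintype B := Fintype.ofFinite B
    let _ : Fintype T := Fintype.ofFinite T
    ext ⟨a, s⟩ ⟨c, t⟩ b
    have h := congrFun (congrFun (D.mat_mul_mat n) a) c
    have h' := congrArg (fun z : MonoidAlgebra ℤ Γ => z.coeff ((s : Γ)⁻¹ * (φ b * t))) h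
    simp only [Matrix.mul_apply, MonoidAlgebra.coeff_sum, Finsupp.finsetSum_apply] at h'
    rw [Matrix.mul_apply, MonoidAlgebra.coeff_sum, Finsupp.finsetSum_apply]
    refine Eq.trans ?_ h'
    refine (Fintype.sum_prod_type _).trans (Finset.sum_congr rfl fun e _ => ?_)
    rw [coeff_mul_eq_sum, ← Equiv.sum_comp (Equiv.mulLeft (s : Γ)⁻¹),
      ← (Equiv.ofBijective _ hT).sum_comp, Fintype.sum_prod_type_right]
    refine Finset.sum_congr rfl fun t' _ => ?_
    rw [coeff_mul_eq_sum]
    refine Finset.sum_congr rfl fun b' _ => ?_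
    change (D.mat (n + 1) a e).coeff _ * (D.mat n e c).coeff _ =
      (D.mat (n + 1) a e).coeff _ * (D.mat n e c).coeff _
    congr 2
    simp [mul_assoc]

variable {φ}

theorem card_restrict_ι (n : ℕ) :
    Fintype.card ((D.restrict φ hT).ι n) = Fintype.card (D.ι n) * (Nat.card Γ / Nat.card B) := by
  let _ : Fintype T := Fintype.ofFinite T
  have h1 : Nat.card Γ = Nat.card B * Nat.card T := by
    rw [← Nat.card_prod]; exact (Nat.card_congr (Equiv.ofBijective _ hT)).symm
  rw [h1, Nat.mul_div_cancel_left _ Nat.card_pos]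
  change Fintype.card (D.ι n × T) = _
  rw [Fintype.card_prod, Nat.card_eq_fintype_card]

/-- The coordinates of a chain of the restricted complex with respect to the `ℤ`-basis of the
underlying complex. -/
def restrictToUnderlying (n : ℕ) :
    ((D.restrict φ hT).ι n → MonoidAlgebra ℤ B) ≃+ D.underlying.X n where
  toFun x p := (x (p.1, ((Equiv.ofBijective _ hT).symm p.2).2)).coeff
    ((Equiv.ofBijective _ hT).symm p.2).1
  invFun y q := .ofCoeff <| Finsupp.equivFunOnFinite.symm fun b => y (q.1, φ b * q.2)
  left_inv x := by
    ext ⟨a, t⟩ b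
    have h : (Equiv.ofBijective _ hT).symm (φ b * t) = (b, t) :=
      (Equiv.ofBijective _ hT).symm_apply_apply (b, t)
    simp [h]
  right_inv y := by
    ext ⟨a, g⟩
    have h := (Equiv.ofBijective _ hT).apply_symm_apply g
    exact congrArg (fun g => y (a, g)) h
  map_add' x y := by ext; rfl

theorem restrictToUnderlying_apply (n : ℕ) (x : (D.restrict φ hT).ι n → MonoidAlgebra ℤ B)
    (a : D.ι n) (b : B) (t : T) :
    D.restrictToUnderlying hT n x (a, φ b * t) = (x (a, t)).coeff b := by
  have h : (Equiv.ofBijective _ hT).symm (φ b * t) = (b, t) :=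
    (Equiv.ofBijective _ hT).symm_apply_apply (b, t)
  change (x (a, ((Equiv.ofBijective _ hT).symm (φ b * t)).2)).coeff
    ((Equiv.ofBijective _ hT).symm (φ b * t)).1 = _
  rw [h]

theorem restrictToUnderlying_dCoeff (n : ℕ)
    (x : (D.restrict φ hT).ι (n + 1) → MonoidAlgebra ℤ B) :
    D.restrictToUnderlying hT n ((D.restrict φ hT).dCoeff _ n x) =
      D.underlying.d n (D.restrictToUnderlying hT (n + 1) x) := by
  let _ : Fintype Γ := Fintype.ofFinite Γ
  let _ : Fintype B := Fintype.ofFinite B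
  let _ : Fintype T := Fintype.ofFinite T
  refine D.underlying_ext hT fun c b t => ?_
  rw [restrictToUnderlying_apply, underlying_d_apply]
  change (∑ q, (D.restrict φ hT).mat n q (c, t) • x q).coeff b = _
  rw [MonoidAlgebra.coeff_sum, Finsupp.finsetSum_apply]
  refine (Fintype.sum_prod_type _).trans (Finset.sum_congr rfl fun a _ => ?_)
  rw [← (Equiv.ofBijective _ hT).sum_comp, Fintype.sum_prod_type_right]
  refine Finset.sum_congr rfl fun s _ => ?_
  rw [smul_eq_mul, mul_comm, coeff_mul_eq_sum]
  refine Finset.sum_congr rfl fun b' _ => ?_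
  rw [Equiv.ofBijective_apply, restrictToUnderlying_apply]
  congr 1
  change (D.mat n a c).coeff ((s : Γ)⁻¹ * (φ (b'⁻¹ * b) * t)) = _
  congr 1
  simp [mul_assoc]

theorem restrictToUnderlying_of_smul (n : ℕ) (b : B)
    (x : (D.restrict φ hT).ι n → MonoidAlgebra ℤ B) :
    D.restrictToUnderlying hT n (MonoidAlgebra.of ℤ B b • x) =
      D.translate n (φ b) (D.restrictToUnderlying hT n x) := by
  refine D.underlying_ext hT fun a b' t => ?_
  have h : (φ b)⁻¹ * (φ b' * t) = φ (b⁻¹ * b') * t := by simp [mul_assoc]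
  rw [translate_apply]
  change _ = D.restrictToUnderlying hT n x (a, (φ b)⁻¹ * (φ b' * t))
  rw [h, restrictToUnderlying_apply, restrictToUnderlying_apply]
  change (MonoidAlgebra.of ℤ B b * x (a, t)).coeff b' = _
  rw [MonoidAlgebra.of_apply, MonoidAlgebra.coeff_single_mul_apply, one_mul]

theorem restrictToUnderlying_mem_boundaries {n : ℕ}
    {x : (D.restrict φ hT).ι n → MonoidAlgebra ℤ B} :
    D.restrictToUnderlying hT n x ∈ D.underlying.boundaries n ↔
      x ∈ (D.restrict φ hT).boundariesCoeff _ n := by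
  constructor
  · rintro ⟨y, hy⟩
    obtain ⟨z, rfl⟩ := (D.restrictToUnderlying hT (n + 1)).surjective y
    rw [← restrictToUnderlying_dCoeff] at hy
    exact ⟨z, (D.restrictToUnderlying hT n).injective hy⟩
  · rintro ⟨y, rfl⟩
    exact ⟨D.restrictToUnderlying hT _ y, (D.restrictToUnderlying_dCoeff hT n y).symm⟩

theorem restrictToUnderlying_mem_cycles {n : ℕ}
    {x : (D.restrict φ hT).ι n → MonoidAlgebra ℤ B} :
    D.restrictToUnderlying hT n x ∈ D.underlying.cycles n ↔
      x ∈ (D.restrict φ hT).cyclesCoeff _ n := by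
  cases n with
  | zero => exact Iff.rfl
  | succ n =>
    change D.underlying.d n _ = 0 ↔ (D.restrict φ hT).dCoeff _ n x = 0
    rw [← restrictToUnderlying_dCoeff,
      map_eq_zero_iff _ (D.restrictToUnderlying hT n).injective]

/-- The filtration steps are invariant under `B`, hence are submodules over its group ring. The
augmentation ideal is generated by the elements `b - 1`, and each of these lowers the filtration by
one. -/
theorem augmentation_pow_smul_cycles_le {n r : ℕ}
    (h : D.NilpotentTranslation (Set.range φ) n r) :
    Ideal.span (Set.range fun b => MonoidAlgebra.of ℤ B b - 1) ^ r •
      (D.restrict φ hT).cyclesCoeff (MonoidAlgebra ℤ B) n ≤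
      (D.restrict φ hT).boundariesCoeff (MonoidAlgebra ℤ B) n := by
  obtain ⟨F, hF0, hFr, hinv, hF⟩ := h
  have key : ∀ k (hk : k ≤ r) (x : (D.restrict φ hT).ι n → MonoidAlgebra ℤ B)
      (y : MonoidAlgebra ℤ B), D.restrictToUnderlying hT n x ∈ F k →
        D.restrictToUnderlying hT n (y • x) ∈ F k := by
    intro k hk x y hx
    induction y using MonoidAlgebra.induction_linear with
    | zero => rw [zero_smul, map_zero]; exact AddSubgroup.zero_mem _
    | add y z hy hz => rw [add_smul, map_add]; exact AddSubgroup.add_mem _ hy hz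
    | single b m =>
      have : MonoidAlgebra.single b m • x = m • MonoidAlgebra.of ℤ B b • x := by
        rw [← smul_assoc, MonoidAlgebra.of_apply, MonoidAlgebra.smul_single, smul_eq_mul, mul_one]
      rw [this, map_zsmul, restrictToUnderlying_of_smul]
      exact AddSubgroup.zsmul_mem _ (hinv k hk _ ⟨b, rfl⟩ _ hx) _
  let U : ℕ → Submodule (MonoidAlgebra ℤ B) ((D.restrict φ hT).ι n → MonoidAlgebra ℤ B) :=
    fun k =>
    { (F (min k r)).comap (D.restrictToUnderlying hT n).toAddMonoidHom with
      smul_mem' := fun y x hx => key _ (min_le_right k r) x y hx }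
  have hU : ∀ k ≤ r, ∀ x, x ∈ U k ↔ D.restrictToUnderlying hT n x ∈ F k := fun k hk x => by
    change _ ∈ F (min k r) ↔ _
    rw [min_eq_left hk]
    rfl
  have h1 := Ideal.pow_smul_le_of_filtration
    (Ideal.span (Set.range fun b => MonoidAlgebra.of ℤ B b - 1)) U r fun k hk => by
      rw [Submodule.smul_le]
      intro y hy x hx
      induction hy using Submodule.span_induction with
      | mem y hy =>
        obtain ⟨b, rfl⟩ := hy
        change (MonoidAlgebra.of ℤ B b - 1) • x ∈ _
        rw [hU _ hk] at hx
        rw [hU _ hk.le, sub_smul, one_smul, map_sub, restrictToUnderlying_of_smul]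
        exact hF k hk _ ⟨b, rfl⟩ _ hx
      | zero => rw [zero_smul]; exact Submodule.zero_mem _
      | add y z _ _ hy hz => rw [add_smul]; exact Submodule.add_mem _ hy hz
      | smul a y _ hy => rw [smul_assoc]; exact Submodule.smul_mem _ _ hy
  have hUr : U r = (D.restrict φ hT).cyclesCoeff (MonoidAlgebra ℤ B) n := by
    ext z
    rw [hU _ le_rfl, hFr, ← restrictToUnderlying_mem_cycles]
    rfl
  rw [hUr] at h1
  intro x hx
  have h2 := h1 hx
  rw [hU _ (Nat.zero_le r), hF0] at h2
  exact (D.restrictToUnderlying_mem_boundaries hT).1 h2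

end Restrict

/-- If `y` exceeds the ranks of a partial resolution polynomially, then the number of generators of
the homology of a complex with nilpotent homology is at most polynomial in `y`. -/
theorem exists_homologyGen_bound (r n : ℕ) : ∃ e : ℕ, ∀ {R : Type u} [CommRing R]
    (F : BasedComplex.{u, w} R) (I : Ideal R) (y f : ℕ), 2 ≤ y → (∀ x : R, ∃ m : ℤ, x - m ∈ I) →
    (∀ j, HasPartialResolution R (y ^ j) j I) → (∀ j ≤ n, Fintype.card (F.ι j) ≤ f) →
    (∀ j ≤ n, I ^ r • F.cyclesCoeff R j ≤ F.boundariesCoeff R j) →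
    ∀ j ≤ n, F.HomologyGen R (f * y ^ e) j := by
  have main : ∀ e n : ℕ, ∃ e' ≥ e, ∀ {R : Type u} [CommRing R]
      (F : BasedComplex.{u, w} R) (I : Ideal R) (y f : ℕ), 2 ≤ y →
      (∀ x : R, ∃ m : ℤ, x - m ∈ I) →
      (∀ j, HasPartialResolution R (y ^ j) j I) → (∀ j ≤ n, Fintype.card (F.ι j) ≤ f) →
      (∀ j ≤ n, I ^ r • F.cyclesCoeff R j ≤ F.boundariesCoeff R j) →
      (∀ j < n, F.HomologyGen R (f * y ^ e) j) → F.HomologyGen R (f * y ^ e') n := by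
    intro e n
    -- In the first bracket, `n + 1` is the exponent of the resolution ranks, `n` bounds the number
    -- of lower degrees through `n ≤ y ^ n`, `e` comes from the lower degrees, and the last `1` pays
    -- for adding the chain rank, as `2 ≤ y`. The second bracket bounds the sum of `r` powers, again
    -- with `r ≤ y ^ r`.
    refine ⟨(n + 1 + n + e + 1) + (r + (n + 1) * r), by omega,
      fun F I y f hy hI hres hcard hnil hk => ?_⟩
    refine (F.homologyGen_of_nilpotent hI (hres (n + 1)) (k := fun _ => f * y ^ e) hk
      (hnil n le_rfl)).mono ?_
    have hy1 : 1 ≤ y := by omega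
    have hpow : ∀ m : ℕ, m ≤ y ^ m := fun m => (Nat.lt_pow_self hy).le
    have h1 : ∑ s ∈ Finset.range r, (y ^ (n + 1)) ^ s ≤ y ^ (r + (n + 1) * r) := by
      refine (Finset.sum_le_card_nsmul _ _ (y ^ ((n + 1) * r)) fun s hs => ?_).trans ?_
      · rw [← pow_mul]
        exact Nat.pow_le_pow_right hy1 (Nat.mul_le_mul_left _ (Finset.mem_range.1 hs).le)
      · rw [Finset.card_range, smul_eq_mul, pow_add]
        exact Nat.mul_le_mul_right _ (hpow r)
    have h2 : y ^ (n + 1) * ∑ _j ∈ Finset.range n, f * y ^ e + Fintype.card (F.ι n) ≤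
        f * y ^ (n + 1 + n + e + 1) := by
      rw [Finset.sum_const, Finset.card_range, smul_eq_mul]
      calc y ^ (n + 1) * (n * (f * y ^ e)) + Fintype.card (F.ι n)
          ≤ y ^ (n + 1) * (y ^ n * (f * y ^ e)) + f * 1 := by
            rw [mul_one]
            exact Nat.add_le_add (Nat.mul_le_mul_left _ (Nat.mul_le_mul_right _ (hpow n)))
              (hcard n le_rfl)
        _ ≤ f * y ^ (n + 1 + n + e) + f * y ^ (n + 1 + n + e) := by
            refine Nat.add_le_add (le_of_eq (by ring)) (Nat.mul_le_mul_left _ ?_)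
            exact Nat.one_le_pow _ _ hy1
        _ ≤ f * y ^ (n + 1 + n + e + 1) := by
            rw [pow_succ, ← mul_assoc, ← mul_two]
            exact Nat.mul_le_mul_left _ hy
    refine (Nat.mul_le_mul h2 h1).trans (le_of_eq ?_)
    rw [pow_add _ (n + 1 + n + e + 1), mul_assoc]
  induction n with
  | zero =>
    obtain ⟨e', -, he'⟩ := main 0 0
    refine ⟨e', fun F I y f hy hI hres hcard hnil j hj => ?_⟩
    obtain rfl : j = 0 := by omega
    exact he' F I y f hy hI hres hcard hnil fun j hj => absurd hj (by omega)
  | succ n ih =>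
    obtain ⟨e, he⟩ := ih
    obtain ⟨e', hee', he'⟩ := main e (n + 1)
    refine ⟨e', fun F I y f hy hI hres hcard hnil => ?_⟩
    have h1 := he F I y f hy hI hres (fun j hj => hcard j (by omega))
      (fun j hj => hnil j (by omega))
    intro j hj
    rcases Nat.lt_or_ge j (n + 1) with hj' | hj'
    · exact (h1 j (by omega)).mono (Nat.mul_le_mul_left _ (Nat.pow_le_pow_right (by omega) hee'))
    · obtain rfl : j = n + 1 := by omega
      exact he' F I y f hy hI hres hcard hnil fun j hj => h1 j (by omega)

/-- The number of generators of the homology of the underlying complex, if a finite abelian group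
`B` acts nilpotently, is small in comparison to the rank. -/
theorem exists_relGen_bound (r n : ℕ) : ∃ e : ℕ, ∀ {Γ : Type u} [Group Γ] [Finite Γ]
    (D : BasedComplex.{u, w} (MonoidAlgebra ℤ Γ)) {B : Type u} [CommGroup B] [Finite B]
    (φ : B →* Γ) (m : ℕ), Function.Injective φ → (∀ j ≤ n, Fintype.card (D.ι j) ≤ m) →
    (∀ j ≤ n, D.NilpotentTranslation (Set.range φ) j r) → ∀ j ≤ n,
    RelGen (m * (Nat.card Γ / Nat.card B) * (3 * (Nat.log 2 (Nat.card B) + 1)) ^ e)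
      (D.underlying.boundaries j).toAddSubgroup (D.underlying.cycles j).toAddSubgroup := by
  obtain ⟨e, he⟩ := exists_homologyGen_bound.{u, max u w} r n
  refine ⟨e, fun {Γ} _ _ D {B} _ _ φ m hφ hm hnil j hj => ?_⟩
  -- A right transversal of the image of `B` turns the `ℤ[Γ]`-basis into a `ℤ[B]`-basis.
  obtain ⟨T, hT, -⟩ := Subgroup.exists_isComplement_right φ.range 1
  have hT' : Function.Bijective fun p : B × T => φ p.1 * (p.2 : Γ) := by
    have h1 : Function.Bijective (Prod.map φ.rangeRestrict (id : T → T)) :=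
      Function.Bijective.prodMap ⟨fun x y h => hφ (congrArg Subtype.val h),
        φ.rangeRestrict_surjective⟩ Function.bijective_id
    exact Function.Bijective.comp hT h1
  obtain ⟨a, I, ha, rfl, hI⟩ := GroupRing.exists_hasPartialResolution B
  have haug : ∀ x : MonoidAlgebra ℤ B, ∃ m : ℤ,
      x - m ∈ Ideal.span (Set.range fun b => MonoidAlgebra.of ℤ B b - 1) := by
    intro x
    induction x using MonoidAlgebra.induction_linear with
    | zero => exact ⟨0, by simp⟩
    | add x y hx hy =>
      obtain ⟨k, hk⟩ := hx
      obtain ⟨l, hl⟩ := hy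
      refine ⟨k + l, ?_⟩
      rw [Int.cast_add, add_sub_add_comm]
      exact Ideal.add_mem _ hk hl
    | single b k =>
      refine ⟨k, ?_⟩
      have : MonoidAlgebra.single b k - (k : MonoidAlgebra ℤ B) =
          (k : MonoidAlgebra ℤ B) * (MonoidAlgebra.of ℤ B b - 1) := by
        rw [mul_sub, mul_one, MonoidAlgebra.of_apply, ← zsmul_eq_mul, MonoidAlgebra.smul_single,
          smul_eq_mul, mul_one]
      rw [this]
      exact Ideal.mul_mem_left _ _ (Ideal.subset_span ⟨b, rfl⟩)
  have hgen := he (D.restrict φ hT') _ (3 * (a + 1)) (m * (Nat.card Γ / Nat.card B)) (by omega)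
    haug hI (fun i hi => by
      rw [card_restrict_ι]; exact Nat.mul_le_mul_right _ (hm i hi))
    (fun i hi => D.augmentation_pow_smul_cycles_le hT' (hnil i hi)) j hj
  have hlog : a ≤ Nat.log 2 (Nat.card B) := Nat.le_log_of_pow_le (by norm_num) ha
  refine (RelGen.map (D.restrictToUnderlying hT' j).toAddMonoidHom hgen
    (fun b hb => (D.restrictToUnderlying_mem_boundaries hT').2 hb) fun z hz => ?_).mono
    (Nat.mul_le_mul_left _ (Nat.pow_le_pow_left (by omega) _))
  obtain ⟨x, rfl⟩ := (D.restrictToUnderlying hT' j).surjective z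
  refine ⟨x, (D.restrictToUnderlying_mem_cycles hT').1 hz, ?_⟩
  have : D.restrictToUnderlying hT' j x - (D.restrictToUnderlying hT' j).toAddMonoidHom x = 0 :=
    sub_self _
  rw [this]; exact AddSubgroup.zero_mem _

end BasedComplex

end

noncomputable section

/-! ### Numbers of generators, torsion and Betti numbers -/

theorem minGenerators_le {M : Type*} [AddCommGroup M] {k : ℕ}
    (h : ∃ f : (Fin k → ℤ) →+ M, Function.Surjective f) : minGenerators M ≤ k :=
  Nat.sInf_le h

theorem RelGen.exists_surjective {M : Type*} [AddCommGroup M] {k : ℕ} {B Z : Submodule ℤ M}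
    (h : RelGen k B.toAddSubgroup Z.toAddSubgroup) :
    ∃ f : (Fin k → ℤ) →+ Z ⧸ B.submoduleOf Z, Function.Surjective f := by
  obtain ⟨v, hvZ, hv⟩ := h.exists_mem
  let f := Fintype.linearCombination ℤ fun i => (B.submoduleOf Z).mkQ ⟨v i, hvZ i⟩
  refine ⟨f.toAddMonoidHom, fun x => ?_⟩
  obtain ⟨⟨z, hz⟩, rfl⟩ := (B.submoduleOf Z).mkQ_surjective x
  obtain ⟨c, hc⟩ := hv z hz
  refine ⟨c, ?_⟩
  change f c = _
  rw [Fintype.linearCombination_apply, eq_comm, ← sub_eq_zero]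
  simp only [← map_smul, ← map_sum, ← map_sub]
  rw [Submodule.mkQ_apply, Submodule.Quotient.mk_eq_zero]
  change Z.subtype _ ∈ B
  simpa using hc

/-- The generators can be taken in `K`, where `m` kills them, so coefficients in `{0, …, m - 1}`
suffice. -/
theorem card_le_of_relGen {M : Type*} [AddCommGroup M] {k m : ℕ} (hm : 0 < m) {K : AddSubgroup M}
    (h : RelGen k ⊥ K) (hK : ∀ x ∈ K, m • x = 0) : Finite K ∧ Nat.card K ≤ m ^ k := by
  obtain ⟨v, hvZ, hv⟩ := h.exists_mem
  let f : (Fin k → Fin m) → K := fun c => ⟨∑ i, ((c i : ℕ) : ℤ) • v i,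
    K.sum_mem fun i _ => K.zsmul_mem (hvZ i) _⟩
  have hf : Function.Surjective f := by
    rintro ⟨x, hx⟩
    obtain ⟨c, hc⟩ := hv x hx
    have hpos : (0 : ℤ) < m := by exact_mod_cast hm
    refine ⟨fun i => ⟨(c i % m).toNat, ?_⟩, ?_⟩
    · have := Int.emod_lt_of_pos (c i) hpos
      omega
    · apply Subtype.ext
      change ∑ i, (((c i % m).toNat : ℕ) : ℤ) • v i = x
      rw [AddSubgroup.mem_bot, sub_eq_zero] at hc
      rw [hc]
      refine Finset.sum_congr rfl fun i _ => ?_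
      rw [Int.toNat_of_nonneg (Int.emod_nonneg _ hpos.ne')]
      conv_rhs => rw [← Int.emod_add_mul_ediv (c i) m, add_smul, mul_comm, mul_smul, natCast_zsmul,
        hK _ (hvZ i), smul_zero, add_zero]
  refine ⟨Finite.of_surjective f hf, ?_⟩
  calc Nat.card K ≤ Nat.card (Fin k → Fin m) := Nat.card_le_card_of_surjective f hf
    _ = m ^ k := by simp

/-- The kernel of the map on torsion subgroups sits in a group with `k` generators, so it needs at
most `k` generators itself; being killed by `m`, it has at most `m ^ k` elements. -/
theorem torsionOrder_le_of_hom {M M' : Type*} [AddCommGroup M] [AddCommGroup M']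
    [Module.Finite ℤ M'] {k m : ℕ} (hm : 0 < m)
    (h : ∃ f : (Fin k → ℤ) →+ M, Function.Surjective f) (f : M →ₗ[ℤ] M')
    (hf : ∀ x, f x = 0 → m • x = 0) : torsionOrder M ≤ m ^ k * torsionOrder M' := by
  obtain ⟨g, hg⟩ := h
  have hgen : RelGen k ⊥ (⊤ : AddSubgroup M) := by
    refine ⟨fun i => g (Pi.single i 1), fun z _ => ?_⟩
    obtain ⟨c, rfl⟩ := hg z
    refine ⟨c, ?_⟩
    rw [AddSubgroup.mem_bot, sub_eq_zero]
    have := LinearMap.apply_eq_sum_single g.toIntLinearMap c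
    exact this
  let T := Submodule.torsion ℤ M
  let T' := Submodule.torsion ℤ M'
  have hT' : Finite T' := Module.finite_of_fg_torsion _ Submodule.torsion_isTorsion
  have hmap : ∀ x : T, f x ∈ T' := by
    rintro ⟨x, ⟨a, ha⟩⟩
    refine ⟨a, ?_⟩
    have h1 : (a : ℤ) • x = 0 := ha
    change (a : ℤ) • f x = 0
    rw [← map_smul, h1, map_zero]
  let φ : T →+ T' := ((f ∘ₗ T.subtype).codRestrict T' hmap).toAddMonoidHom
  have hker : Finite φ.ker ∧ Nat.card φ.ker ≤ m ^ k := by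
    refine card_le_of_relGen hm (hgen.comap T.subtype.toAddMonoidHom (fun _ _ => trivial)
      fun z _ hz => ?_) fun x hx => ?_
    · rw [AddSubgroup.mem_bot] at hz ⊢
      exact Subtype.ext hz
    · exact Subtype.ext (hf x.1 (congrArg Subtype.val hx))
  have hcard : Nat.card T = Nat.card (T ⧸ φ.ker) * Nat.card φ.ker :=
    AddSubgroup.card_eq_card_quotient_mul_card_addSubgroup φ.ker
  have hquot : Nat.card (T ⧸ φ.ker) ≤ Nat.card T' := by
    rw [Nat.card_congr (QuotientAddGroup.quotientKerEquivRange φ).toEquiv]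
    exact Nat.card_le_card_of_injective _ Subtype.val_injective
  change Nat.card T ≤ m ^ k * Nat.card T'
  rw [hcard, mul_comm]
  exact Nat.mul_le_mul hker.2 hquot

theorem LinearMap.finrank_range_add_finrank_ker_int {ι κ : Type*} [Fintype ι] [Fintype κ]
    (f : (ι → ℤ) →ₗ[ℤ] (κ → ℤ)) :
    Module.finrank ℤ (LinearMap.range f) + Module.finrank ℤ (LinearMap.ker f) =
      Fintype.card ι := by
  rw [← f.quotKerEquivRange.finrank_eq, Submodule.finrank_quotient_add_finrank]
  exact Module.finrank_fintype_fun_eq_card ℤ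

namespace BasedComplex

variable (E : BasedComplex.{0, w} ℤ)

theorem cycles_saturated {n : ℕ} {x : E.X n} {m : ℤ} (hm : m ≠ 0) (h : m • x ∈ E.cycles n) :
    x ∈ E.cycles n := by
  cases n with
  | zero => trivial
  | succ n =>
    change E.d n (m • x) = 0 at h
    rw [map_smul, smul_eq_zero] at h
    exact h.resolve_left hm

/-- There is a basis of the chains which contains a basis of the cycles. -/
theorem exists_basis_cycles (n : ℕ) : ∃ (b : Module.Basis (E.ι n) ℤ (E.X n))
    (f : Fin (Module.finrank ℤ (E.cycles n)) ↪ E.ι n), ∀ i, b (f i) ∈ E.cycles n := by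
  obtain ⟨m, ⟨bM, bN, f, a, hsnf⟩⟩ :=
    Submodule.smithNormalForm (Pi.basisFun ℤ (E.ι n)) (E.cycles n)
  have hm : m = Module.finrank ℤ (E.cycles n) := by
    rw [Module.finrank_eq_card_basis bN, Fintype.card_fin]
  subst hm
  refine ⟨bM, f, fun i => ?_⟩
  -- The cycles are saturated, so a basis vector with a nonzero multiple in the cycles is itself a
  -- cycle.
  have hne : a i ≠ 0 := by
    intro h0
    have := hsnf i
    rw [h0, zero_smul] at this
    exact bN.ne_zero i (Subtype.ext this)
  exact E.cycles_saturated hne (by rw [← hsnf i]; exact (bN i).2)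

theorem finrank_boundaries_add_finrank_cycles (n : ℕ) :
    Module.finrank ℤ (E.boundaries n) + Module.finrank ℤ (E.cycles (n + 1)) =
      Fintype.card (E.ι (n + 1)) := by
  exact LinearMap.finrank_range_add_finrank_ker_int (E.d n)

theorem boundaries_le_cycles {R : Type u} [Ring R] (D : BasedComplex.{u, w} R) (n : ℕ) :
    D.boundaries n ≤ D.cycles n := by
  cases n with
  | zero => exact le_top
  | succ n =>
    rintro _ ⟨w, rfl⟩
    change D.d n (D.d (n + 1) w) = 0
    simp only [d, Matrix.vecMulLinear_apply, Matrix.vecMul_vecMul, D.mat_mul_mat,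
      Matrix.vecMul_zero]

variable (K : Type*) [Field K]

/-- The reduction of chains modulo the kernel of `ℤ → K`. -/
def castChains (n : ℕ) : E.X n →+ (E.baseChange (Int.castRingHom K)).X n where
  toFun x a := (x a : K)
  map_zero' := funext fun _ => Int.cast_zero
  map_add' _ _ := funext fun _ => Int.cast_add _ _

theorem castChains_d (n : ℕ) (x : E.X (n + 1)) :
    E.castChains K n (E.d n x) = (E.baseChange (Int.castRingHom K)).d n (E.castChains K _ x) := by
  ext a
  change ((∑ b, x b * E.mat n b a : ℤ) : K) = ∑ b, (x b : K) * ((E.mat n b a : ℤ) : K)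
  push_cast
  rfl

/-- A basis of the integral cycles is part of a basis of the chains, so it stays linearly
independent over `K` in any characteristic. Its reductions lie in the span of the boundaries over
`K` and `k` further vectors. -/
theorem finrank_cycles_le {n k : ℕ}
    (h : RelGen k (E.boundaries n).toAddSubgroup (E.cycles n).toAddSubgroup) :
    Module.finrank ℤ (E.cycles n) ≤
      Module.finrank K ((E.baseChange (Int.castRingHom K)).boundaries n) + k := by
  classical
  obtain ⟨b, f, hb⟩ := E.exists_basis_cycles n
  obtain ⟨v, hv⟩ := h
  have hli : LinearIndependent K fun i => E.castChains K n (b i) := by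
    let P : Matrix (E.ι n) (E.ι n) ℤ := Matrix.of fun i => b i
    have hP : IsUnit P := by
      have h1 : ((Pi.basisFun ℤ (E.ι n)).toMatrix b) * (b.toMatrix (Pi.basisFun ℤ (E.ι n))) = 1 :=
        Module.Basis.toMatrix_mul_toMatrix_flip _ _
      have h2 : IsUnit ((Pi.basisFun ℤ (E.ι n)).toMatrix b) := by
        rw [Matrix.isUnit_iff_isUnit_det]
        exact Matrix.isUnit_det_of_right_inverse h1
      have h3 : P = ((Pi.basisFun ℤ (E.ι n)).toMatrix b).transpose := by
        ext i j; rfl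
      rw [h3, Matrix.isUnit_transpose]
      exact h2
    have h4 : IsUnit (P.map (Int.castRingHom K)) := hP.map (Int.castRingHom K).mapMatrix
    exact Matrix.linearIndependent_rows_iff_isUnit.2 h4
  have hli' : LinearIndependent K fun i => E.castChains K n (b (f i)) := hli.comp f f.injective
  have hspan : Submodule.span K (Set.range fun i => E.castChains K n (b (f i))) ≤
      (E.baseChange (Int.castRingHom K)).boundaries n ⊔
        Submodule.span K (Set.range fun j => E.castChains K n (v j)) := by
    rw [Submodule.span_le]
    rintro _ ⟨i, rfl⟩
    obtain ⟨c, ⟨y, hy⟩⟩ := hv _ (hb i)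
    have h1 : E.castChains K n (b (f i)) = E.castChains K n (E.d n y) +
        ∑ j, (c j : K) • E.castChains K n (v j) := by
      have h2 : b (f i) = E.d n y + ∑ j, c j • v j := by rw [hy]; abel
      rw [h2, map_add, map_sum]
      simp only [map_zsmul, Int.cast_smul_eq_zsmul]
    change E.castChains K n (b (f i)) ∈ _
    rw [h1]
    refine Submodule.add_mem_sup ⟨_, (E.castChains_d K n y).symm⟩ ?_
    exact Submodule.sum_mem _ fun j _ => Submodule.smul_mem _ _ (Submodule.subset_span ⟨j, rfl⟩)
  have h1 := finrank_span_eq_card hli'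
  rw [Fintype.card_fin] at h1
  rw [← h1]
  refine (Submodule.finrank_mono hspan).trans ((Submodule.finrank_add_le_finrank_add_finrank _ _).trans
    (Nat.add_le_add_left ?_ _))
  exact (finrank_range_le_card _).trans (by simp)

theorem betti_add_finrank_boundaries (n : ℕ) :
    E.betti K n + Module.finrank K ((E.baseChange (Int.castRingHom K)).boundaries n) =
      Module.finrank K ((E.baseChange (Int.castRingHom K)).cycles n) := by
  rw [← (Submodule.submoduleOfEquivOfLe
    ((E.baseChange (Int.castRingHom K)).boundaries_le_cycles n)).finrank_eq]
  exact Submodule.finrank_quotient_add_finrank _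

theorem betti_zero_le {k : ℕ}
    (h : RelGen k (E.boundaries 0).toAddSubgroup (E.cycles 0).toAddSubgroup) :
    E.betti K 0 ≤ k := by
  have h1 := E.finrank_cycles_le K h
  have h2 := E.betti_add_finrank_boundaries K 0
  have h3 : Module.finrank K ((E.baseChange (Int.castRingHom K)).cycles 0) =
      Fintype.card (E.ι 0) := finrank_top _ _ |>.trans (Module.finrank_fintype_fun_eq_card K)
  have h4 : Module.finrank ℤ (E.cycles 0) = Fintype.card (E.ι 0) :=
    finrank_top _ _ |>.trans (Module.finrank_fintype_fun_eq_card ℤ)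
  omega

/-- The generators in degree `n` limit how much the rank of the differential drops over `K`, hence
how much the space of cycles in degree `n + 1` grows; those in degree `n + 1` then bound cycles
modulo boundaries. -/
theorem betti_succ_le {n k l : ℕ}
    (h : RelGen k (E.boundaries n).toAddSubgroup (E.cycles n).toAddSubgroup)
    (h' : RelGen l (E.boundaries (n + 1)).toAddSubgroup (E.cycles (n + 1)).toAddSubgroup) :
    E.betti K (n + 1) ≤ k + l := by
  have h1 := E.finrank_cycles_le K h
  have h2 := E.finrank_cycles_le K h'
  have h3 := E.betti_add_finrank_boundaries K (n + 1)
  have h4 : Module.finrank K ((E.baseChange (Int.castRingHom K)).boundaries n) +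
      Module.finrank K ((E.baseChange (Int.castRingHom K)).cycles (n + 1)) =
      Fintype.card (E.ι (n + 1)) :=
    (LinearMap.finrank_range_add_finrank_ker ((E.baseChange (Int.castRingHom K)).d n)).trans
      (Module.finrank_fintype_fun_eq_card K)
  have h5 := E.finrank_boundaries_add_finrank_cycles n
  have h6 := Submodule.finrank_mono (E.boundaries_le_cycles n)
  omega

end BasedComplex

end

noncomputable section

/-! ### Push-forward and pull-back along a homomorphism of finite groups -/

section Transfer

variable {κ Γ Γ' : Type*} [Group Γ] [Group Γ'] [Finite Γ] (q : Γ →* Γ')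
  (S : Type*) {X : Type*} [Ring S] [AddCommGroup X] [Module S X]

open Classical in
/-- Summation over the fibres of a homomorphism of finite groups. -/
def pushforward : (κ × Γ → X) →ₗ[S] (κ × Γ' → X) where
  toFun x p := letI := Fintype.ofFinite Γ; ∑ g : Γ, if q g = p.2 then x (p.1, g) else 0
  map_add' x y := by
    ext p
    simp only [Pi.add_apply, ← Finset.sum_add_distrib]
    exact Finset.sum_congr rfl fun g _ => by split_ifs <;> simp
  map_smul' r x := by
    ext p
    simp only [Pi.smul_apply, Finset.smul_sum, RingHom.id_apply]
    exact Finset.sum_congr rfl fun g _ => by split_ifs <;> simp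

/-- Composition with a homomorphism of groups. -/
def pullback {Γ : Type*} [Group Γ] (q : Γ →* Γ') : (κ × Γ' → X) →ₗ[S] (κ × Γ → X) where
  toFun y p := y (p.1, q p.2)
  map_add' _ _ := rfl
  map_smul' _ _ := rfl

theorem pushforward_apply [Fintype Γ] [DecidableEq Γ'] (x : κ × Γ → X) (a : κ) (k : Γ') :
    pushforward q S x (a, k) = ∑ g : Γ, if q g = k then x (a, g) else 0 := by
  change (letI := Fintype.ofFinite Γ; ∑ g : Γ, _) = _
  refine Finset.sum_congr (congrArg (fun i : Fintype _ => @Finset.univ _ i)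
    (Subsingleton.elim _ _)) fun g _ => ?_
  congr

theorem pullback_apply {Γ : Type*} [Group Γ] (q : Γ →* Γ') (y : κ × Γ' → X) (a : κ) (g : Γ) :
    pullback S q y (a, g) = y (a, q g) := rfl

theorem pushforward_pullback [Fintype q.ker] (hq : Function.Surjective q) (y : κ × Γ' → X) :
    pushforward q S (pullback S q y) = Fintype.card q.ker • y := by
  classical
  let _ := Fintype.ofFinite Γ
  ext ⟨a, k⟩
  obtain ⟨g₀, rfl⟩ := hq k
  rw [pushforward_apply, Pi.smul_apply, ← Equiv.sum_comp (Equiv.mulLeft g₀)]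
  have h : ∀ g, (if q (Equiv.mulLeft g₀ g) = q g₀ then
      pullback S q y (a, Equiv.mulLeft g₀ g) else 0) = if g ∈ q.ker then y (a, q g₀) else 0 := by
    intro g
    simp only [Equiv.coe_mulLeft, map_mul, mul_eq_left, pullback_apply, MonoidHom.mem_ker]
    split_ifs with h
    · rw [h, mul_one]
    · rfl
  rw [Finset.sum_congr rfl fun g _ => h g, ← Finset.sum_filter, Finset.sum_const]
  congr 1
  exact (Fintype.card_subtype _).symm

/-- The fibre of `q` through `g` consists of the elements `β⁻¹ * g` with `β` in the kernel, so this
composite is the norm of the kernel acting by translation. -/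
theorem pullback_pushforward [Fintype q.ker] (x : κ × Γ → X) :
    pullback S q (pushforward q S x) = ∑ β : q.ker, fun p => x (p.1, (β : Γ)⁻¹ * p.2) := by
  classical
  let _ := Fintype.ofFinite Γ
  ext ⟨a, g⟩
  rw [pullback_apply, pushforward_apply, Finset.sum_apply, ← Finset.sum_filter]
  refine (Finset.sum_bij (fun (β : q.ker) _ => (β : Γ)⁻¹ * g) ?_ ?_ ?_ fun _ _ => rfl).symm
  · intro β _
    simp [MonoidHom.mem_ker.1 β.2]
  · intro β _ β' _ h
    simpa using h
  · intro g' hg'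
    refine ⟨⟨g * g'⁻¹, ?_⟩, Finset.mem_univ _, by simp⟩
    have := (Finset.mem_filter.1 hg').2
    simp [MonoidHom.mem_ker, this]

end Transfer

theorem MonoidAlgebra.coeff_mapDomain_eq_sum {Γ Γ' R : Type*} [Semiring R] [Fintype Γ]
    [DecidableEq Γ'] (q : Γ → Γ') (z : MonoidAlgebra R Γ) (k : Γ') :
    (MonoidAlgebra.mapDomain q z).coeff k = ∑ g : Γ, if q g = k then z.coeff g else 0 := by
  classical
  induction z using MonoidAlgebra.induction_linear with
  | zero => simp
  | add x y hx hy =>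
    rw [MonoidAlgebra.mapDomain_add, MonoidAlgebra.coeff_add, Finsupp.add_apply, hx, hy,
      ← Finset.sum_add_distrib]
    exact Finset.sum_congr rfl fun g _ => by split_ifs <;> simp
  | single g m =>
    rw [MonoidAlgebra.mapDomain_single, Finset.sum_eq_single g]
    · simp [Finsupp.single_apply]
    · intro b _ hb
      simp [hb.symm]
    · simp

namespace BasedComplex

theorem d_eq_dCoeff (E : BasedComplex.{0, w} ℤ) (n : ℕ) (x : E.X (n + 1)) :
    E.d n x = E.dCoeff ℤ n x := by
  ext b
  exact Finset.sum_congr rfl fun a _ => mul_comm _ _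

theorem underlying_dCoeff_apply {Γ : Type v} [Group Γ] [Fintype Γ]
    (D : BasedComplex.{v, w} (MonoidAlgebra ℤ Γ)) {X : Type*} [AddCommGroup X] (n : ℕ)
    (x : D.ι (n + 1) × Γ → X) (c : D.ι n) (k : Γ) :
    (D.underlying.dCoeff X n x : D.ι n × Γ → X) (c, k) =
      ∑ a : D.ι (n + 1), ∑ g : Γ, (D.mat n a c).coeff (g⁻¹ * k) • x (a, g) := by
  rw [← Fintype.sum_prod_type' (f := fun a g => (D.mat n a c).coeff (g⁻¹ * k) • x (a, g))]
  exact Finset.sum_congr (congrArg (fun i : Fintype _ => @Finset.univ _ i)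
    (Subsingleton.elim _ _)) fun _ _ => rfl

section Level

variable {G : Type u} [Group G] (D : BasedComplex.{u, w} (MonoidAlgebra ℤ G))
  {N N' : Subgroup G} [N.Normal] [N'.Normal] (h : N ≤ N')

/-- The projection `G/N → G/N'`. -/
abbrev levelHom : G ⧸ N →* G ⧸ N' := QuotientGroup.map N N' (MonoidHom.id G) h

theorem levelHom_surjective : Function.Surjective (levelHom h) := fun x => by
  obtain ⟨g, rfl⟩ := QuotientGroup.mk_surjective x
  exact ⟨QuotientGroup.mk g, rfl⟩

theorem coeff_level_mat [Fintype (G ⧸ N)] [DecidableEq (G ⧸ N')] (n : ℕ) (a : D.ι (n + 1))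
    (c : D.ι n) (k : G ⧸ N') :
    ((D.level N').mat n a c).coeff k =
      ∑ g : G ⧸ N, if levelHom h g = k then ((D.level N).mat n a c).coeff g else 0 := by
  rw [← MonoidAlgebra.coeff_mapDomain_eq_sum]
  change (MonoidAlgebra.mapDomain (QuotientGroup.mk' N') (D.mat n a c)).coeff k =
    (MonoidAlgebra.mapDomain (levelHom h)
      (MonoidAlgebra.mapDomain (QuotientGroup.mk' N) (D.mat n a c))).coeff k
  rw [MonoidAlgebra.coeff_mapDomain, MonoidAlgebra.coeff_mapDomain, MonoidAlgebra.coeff_mapDomain,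
    ← Finsupp.mapDomain_comp]
  rfl

variable [N.FiniteIndex] [N'.FiniteIndex] (S : Type*) {X : Type*} [Ring S] [AddCommGroup X]
  [Module S X]

theorem dCoeff_pushforward (n : ℕ) (x : D.ι (n + 1) × (G ⧸ N) → X) :
    (D.intLevel N').dCoeff X n (pushforward (levelHom h) S x) =
      pushforward (levelHom h) S ((D.intLevel N).dCoeff X n x : D.ι n × (G ⧸ N) → X) := by
  classical
  let _ := Fintype.ofFinite (G ⧸ N)
  let _ := Fintype.ofFinite (G ⧸ N')
  refine funext fun p => ?_
  obtain ⟨(c : D.ι n), k⟩ := p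
  refine ((D.level N').underlying_dCoeff_apply n _ c k).trans ?_
  refine Eq.trans ?_ (pushforward_apply (levelHom h) S _ c k).symm
  change ∑ a : D.ι (n + 1), ∑ g : G ⧸ N', ((D.level N').mat n a c).coeff (g⁻¹ * k) •
    pushforward (levelHom h) S x (a, g) = _
  have e : ∀ g, ((D.intLevel N).dCoeff X n x : D.ι n × (G ⧸ N) → X) (c, g) =
      ∑ a : D.ι (n + 1), ∑ g' : G ⧸ N, ((D.level N).mat n a c).coeff (g'⁻¹ * g) • x (a, g') :=
    fun g => (D.level N).underlying_dCoeff_apply n x c g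
  refine Eq.trans ?_ (Finset.sum_congr rfl fun g _ =>
    congrArg (fun z => if levelHom h g = k then z else 0) (e g).symm)
  simp only [← Finset.sum_filter]
  refine Eq.trans ?_ Finset.sum_comm
  refine Finset.sum_congr rfl fun a _ => ?_
  simp only [pushforward_apply, Finset.smul_sum]
  refine Finset.sum_comm.trans (Eq.trans ?_ Finset.sum_comm)
  refine Finset.sum_congr rfl fun g _ => ?_
  -- For a fixed `g` only its image contributes at the lower level; the coefficient there is a fibre
  -- sum, which becomes the required one after translation by `g⁻¹`.
  rw [Finset.sum_eq_single (levelHom h g), if_pos rfl, ← Finset.sum_smul, D.coeff_level_mat h,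
    Finset.sum_filter, ← Equiv.sum_comp (Equiv.mulLeft g⁻¹)]
  · congr 1
    refine Finset.sum_congr rfl fun g' _ => ?_
    have : levelHom h (g⁻¹ * g') = (levelHom h g)⁻¹ * k ↔ levelHom h g' = k := by
      rw [map_mul, map_inv, mul_right_inj]
    simp only [Equiv.coe_mulLeft, this]
  · intro g' _ hg'
    rw [if_neg hg'.symm, smul_zero]
  · simp

theorem dCoeff_pullback (n : ℕ) (y : D.ι (n + 1) × (G ⧸ N') → X) :
    (D.intLevel N).dCoeff X n (pullback S (levelHom h) y) =
      pullback S (levelHom h) ((D.intLevel N').dCoeff X n y : D.ι n × (G ⧸ N') → X) := by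
  classical
  let _ := Fintype.ofFinite (G ⧸ N)
  let _ := Fintype.ofFinite (G ⧸ N')
  refine funext fun p => ?_
  obtain ⟨(c : D.ι n), k⟩ := p
  refine ((D.level N).underlying_dCoeff_apply n _ c k).trans ?_
  refine Eq.trans ?_ ((D.level N').underlying_dCoeff_apply n y c (levelHom h k)).symm
  change ∑ a : D.ι (n + 1), ∑ g : G ⧸ N, ((D.level N).mat n a c).coeff (g⁻¹ * k) •
    y (a, levelHom h g) = ∑ a : D.ι (n + 1), ∑ g : G ⧸ N',
      ((D.level N').mat n a c).coeff (g⁻¹ * levelHom h k) • y (a, g)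
  refine Finset.sum_congr rfl fun a _ => ?_
  simp only [D.coeff_level_mat h, Finset.sum_smul]
  rw [Finset.sum_comm, ← Equiv.sum_comp ((Equiv.inv _).trans (Equiv.mulLeft k))]
  refine Finset.sum_congr rfl fun g _ => ?_
  rw [Finset.sum_eq_single (levelHom h k * (levelHom h g)⁻¹)]
  · simp
  · intro k' _ hk'
    rw [if_neg, zero_smul]
    intro h1
    apply hk'
    rw [h1]
    group
  · simp

end Level

end BasedComplex

end

/-! ### Transfers between nested levels -/

noncomputable section

namespace BasedComplex

open Matrix in
/-- A chain map between based free complexes over `ℤ` whose transpose is a chain map as well, such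
that the composition with the transpose is multiplication by `b`. -/
structure Transfer (E E' : BasedComplex.{0, w} ℤ) (b : ℕ) where
  P : ∀ n, Matrix (E.ι n) (E'.ι n) ℤ
  mul_mat : ∀ n, P (n + 1) * E'.mat n = E.mat n * P n
  transpose_mul_mat : ∀ n, (P (n + 1))ᵀ * E.mat n = E'.mat n * (P n)ᵀ
  vecMul_transpose_vecMul : ∀ n (y : E'.ι n → ℤ), (y ᵥ* (P n)ᵀ) ᵥ* P n = b • y

namespace Transfer

variable {E E' : BasedComplex.{0, w} ℤ} {b : ℕ} (T : Transfer E E' b)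

/-- The chain map of a transfer. -/
def push (n : ℕ) : E.X n →ₗ[ℤ] E'.X n := (T.P n).vecMulLinear

/-- The transposed chain map of a transfer. -/
def pull (n : ℕ) : E'.X n →ₗ[ℤ] E.X n := (T.P n).transpose.vecMulLinear

theorem push_pull (n : ℕ) (y : E'.X n) : T.push n (T.pull n y) = b • y :=
  T.vecMul_transpose_vecMul n y

theorem push_d (n : ℕ) (x : E.X (n + 1)) :
    T.push n (E.d n x) = E'.d n (T.push (n + 1) x) := by
  change Matrix.vecMul (Matrix.vecMul x (E.mat n)) (T.P n) = 
      Matrix.vecMul (Matrix.vecMul x (T.P (n + 1))) (E'.mat n)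
  rw [Matrix.vecMul_vecMul, Matrix.vecMul_vecMul, T.mul_mat]

theorem pull_d (n : ℕ) (y : E'.X (n + 1)) :
    T.pull n (E'.d n y) = E.d n (T.pull (n + 1) y) := by
  change Matrix.vecMul (Matrix.vecMul y (E'.mat n)) (T.P n).transpose =
      Matrix.vecMul (Matrix.vecMul y (T.P (n + 1)).transpose) (E.mat n)
  rw [Matrix.vecMul_vecMul, Matrix.vecMul_vecMul, T.transpose_mul_mat]

theorem push_mem_boundaries {n : ℕ} {x : E.X n} (hx : x ∈ E.boundaries n) :
    T.push n x ∈ E'.boundaries n := by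
  obtain ⟨y, rfl⟩ := hx
  exact ⟨T.push (n + 1) y, (T.push_d n y).symm⟩

theorem pull_mem_boundaries {n : ℕ} {y : E'.X n} (hy : y ∈ E'.boundaries n) :
    T.pull n y ∈ E.boundaries n := by
  obtain ⟨z, rfl⟩ := hy
  exact ⟨T.pull (n + 1) z, (T.pull_d n z).symm⟩

theorem push_mem_cycles {n : ℕ} {x : E.X n} (hx : x ∈ E.cycles n) :
    T.push n x ∈ E'.cycles n := by
  cases n with
  | zero => trivial
  | succ n =>
    change E'.d n _ = 0
    rw [← push_d, LinearMap.mem_ker.1 hx, map_zero]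

theorem pull_mem_cycles {n : ℕ} {y : E'.X n} (hy : y ∈ E'.cycles n) :
    T.pull n y ∈ E.cycles n := by
  cases n with
  | zero => trivial
  | succ n =>
    change E.d n _ = 0
    rw [← pull_d, LinearMap.mem_ker.1 hy, map_zero]

/-- The kernel of the induced map on homology in degree `n` is annihilated by `b ^ r`. -/
def KerBound (n r : ℕ) : Prop :=
  ∀ x ∈ E.cycles n, T.push n x ∈ E'.boundaries n → b ^ r • x ∈ E.boundaries n

/-- The induced map on homology. -/
def pushHomology (n : ℕ) : E.Homology n →ₗ[ℤ] E'.Homology n :=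
  Submodule.mapQ _ _ ((T.push n).restrict fun _ => T.push_mem_cycles)
    fun _ hx => T.push_mem_boundaries hx

-- The number of generators `k` is what makes this estimate useful: the torsion grows by at most `r
-- * k * log b` on the logarithmic scale.
variable {T} in
theorem KerBound.torsionOrder_le {n r k : ℕ} (hb : 0 < b) (h : T.KerBound n r)
    (hk : RelGen k (E.boundaries n).toAddSubgroup (E.cycles n).toAddSubgroup) :
    torsionOrder (E.Homology n) ≤ (b ^ r) ^ k * torsionOrder (E'.Homology n) := by
  refine torsionOrder_le_of_hom (pow_pos hb r) hk.exists_surjective (T.pushHomology n) ?_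
  intro x hx
  obtain ⟨⟨z, hz⟩, rfl⟩ := Submodule.mkQ_surjective _ x
  have h1 : T.push n z ∈ E'.boundaries n :=
    (Submodule.Quotient.mk_eq_zero ((E'.boundaries n).submoduleOf (E'.cycles n))).1 hx
  rw [← map_nsmul]
  exact (Submodule.Quotient.mk_eq_zero _).2 (h z hz h1)

end Transfer

theorem ext_vecMul {α β : Type*} [Fintype α] {A B : Matrix α β ℤ}
    (h : ∀ x : α → ℤ, Matrix.vecMul x A = Matrix.vecMul x B) : A = B := by
  classical
  ext i j
  have := congrFun (h (Pi.single i 1)) j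
  simpa using this

section Level

variable {G : Type u} [Group G] (D : BasedComplex.{u, w} (MonoidAlgebra ℤ G))
  {N N' : Subgroup G} [N.Normal] [N'.Normal] (h : N ≤ N') [N.FiniteIndex] [N'.FiniteIndex]

open Classical in
/-- The matrix of the projection `ℤ[G/N] ^ (ι n) → ℤ[G/N'] ^ (ι n)`. -/
def levelMatrix (n : ℕ) : Matrix ((D.intLevel N).ι n) ((D.intLevel N').ι n) ℤ :=
  fun (p : D.ι n × (G ⧸ N)) (p' : D.ι n × (G ⧸ N')) =>
    if p.1 = p'.1 ∧ levelHom h p.2 = p'.2 then 1 else 0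

theorem vecMul_levelMatrix (n : ℕ) (x : (D.intLevel N).X n) :
    Matrix.vecMul x (D.levelMatrix h n) = pushforward (levelHom h) ℤ x := by
  classical
  let _ := Fintype.ofFinite (G ⧸ N)
  refine funext fun p => ?_
  obtain ⟨(c : D.ι n), k⟩ := p
  refine Eq.trans ?_ (pushforward_apply (levelHom h) ℤ _ c k).symm
  have h1 : Matrix.vecMul x (D.levelMatrix h n) (c, k) = ∑ p : D.ι n × (G ⧸ N),
      x p * if p.1 = c ∧ levelHom h p.2 = k then 1 else 0 := by
    refine Finset.sum_congr (congrArg (fun i : Fintype _ => @Finset.univ _ i)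
      (Subsingleton.elim _ _)) fun p _ => ?_
    change x p * (if _ then _ else _) = _
    congr
  rw [h1, Fintype.sum_prod_type, Finset.sum_eq_single c]
  · exact Finset.sum_congr rfl fun g _ => by simp
  · intro a _ ha
    exact Finset.sum_eq_zero fun g _ => by simp [ha]
  · simp

theorem vecMul_transpose_levelMatrix (n : ℕ) (y : (D.intLevel N').X n) :
    Matrix.vecMul y (D.levelMatrix h n).transpose = pullback ℤ (levelHom h) y := by
  classical
  let _ := Fintype.ofFinite (G ⧸ N')
  refine funext fun p => ?_
  obtain ⟨(c : D.ι n), k⟩ := p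
  have h1 : Matrix.vecMul y (D.levelMatrix h n).transpose (c, k) = ∑ p : D.ι n × (G ⧸ N'),
      y p * if c = p.1 ∧ levelHom h k = p.2 then 1 else 0 := by
    refine Finset.sum_congr (congrArg (fun i : Fintype _ => @Finset.univ _ i)
      (Subsingleton.elim _ _)) fun p _ => ?_
    change y p * (if _ then _ else _) = _
    congr
  rw [h1, Finset.sum_eq_single (c, levelHom h k)]
  · rw [if_pos ⟨rfl, rfl⟩, mul_one]
    rfl
  · rintro ⟨a, g⟩ _ ha
    rw [if_neg, mul_zero]
    rintro ⟨rfl, rfl⟩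
    exact ha rfl
  · simp

/-- The transfer between the complexes of two nested normal subgroups of finite index. -/
def levelTransfer : Transfer (D.intLevel N) (D.intLevel N') (Nat.card (levelHom h).ker) where
  P := D.levelMatrix h
  mul_mat n := ext_vecMul fun x => by
    have h1 := D.dCoeff_pushforward h ℤ n x
    rw [← Matrix.vecMul_vecMul, ← Matrix.vecMul_vecMul, vecMul_levelMatrix, vecMul_levelMatrix]
    refine ((D.intLevel N').d_eq_dCoeff n _).trans (h1.trans ?_)
    exact congrArg _ ((D.intLevel N).d_eq_dCoeff n x).symm
  transpose_mul_mat n := ext_vecMul fun x => by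
    have h1 := D.dCoeff_pullback h ℤ n x
    rw [← Matrix.vecMul_vecMul, ← Matrix.vecMul_vecMul, vecMul_transpose_levelMatrix,
      vecMul_transpose_levelMatrix]
    refine ((D.intLevel N).d_eq_dCoeff n _).trans (h1.trans ?_)
    exact congrArg _ ((D.intLevel N').d_eq_dCoeff n x).symm
  vecMul_transpose_vecMul n y := by
    let _ := Fintype.ofFinite (levelHom h).ker
    rw [vecMul_transpose_levelMatrix, Nat.card_eq_fintype_card]
    refine (D.vecMul_levelMatrix h n _).trans ?_
    exact pushforward_pullback (levelHom h) ℤ (levelHom_surjective h) y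

/-- The element `y = pull (push x) - b • x` is the sum of `β x - x` over the kernel, so it lies one
filtration step below `x`; it is also killed by the projection. By induction `b ^ k • y` is a
boundary, and `pull (push x)` is one because `push x` is. After `r` steps the filtration has reached
the boundaries. -/
theorem kerBound_levelTransfer {S : Set (G ⧸ N)} (hS : ∀ β ∈ (levelHom h).ker, β ∈ S) {n r : ℕ}
    (hD : (D.level N).NilpotentTranslation S n r) : (D.levelTransfer h).KerBound n r := by
  obtain ⟨F, hF0, hFr, -, hF⟩ := hD
  let T := D.levelTransfer h
  let b := Nat.card (levelHom h).ker
  have key : ∀ k ≤ r, ∀ x : (D.intLevel N).X n, x ∈ F k →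
      T.push n x ∈ (D.intLevel N').boundaries n → b ^ k • x ∈ (D.intLevel N).boundaries n := by
    intro k
    induction k with
    | zero =>
      intro _ x hx _
      rw [hF0] at hx
      rw [pow_zero, one_smul]
      exact hx
    | succ k ih =>
      intro hk x hx hpush
      let _ := Fintype.ofFinite (levelHom h).ker
      let y : (D.intLevel N).X n := T.pull n (T.push n x) - b • x
      let L : (levelHom h).ker → (D.intLevel N).X n := fun β => (D.level N).translate n β x
      have hy : y ∈ F k := by
        have h1 : y = ∑ β : (levelHom h).ker, (L β - x) := by
          rw [Finset.sum_sub_distrib, Finset.sum_const, Finset.card_univ,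
            ← Nat.card_eq_fintype_card]
          refine congrArg (fun z => z - b • x) ?_
          refine Eq.trans ?_ (pullback_pushforward (levelHom h) ℤ x)
          refine (D.vecMul_transpose_levelMatrix h n _).trans ?_
          exact congrArg _ (D.vecMul_levelMatrix h n x)
        rw [h1]
        exact (F k).sum_mem fun β _ => hF k hk β (hS _ β.2) x hx
      have hy0 : T.push n y = 0 := by
        rw [map_sub, T.push_pull, map_nsmul, sub_self]
      have h2 := ih (by omega) y hy (by rw [hy0]; exact zero_mem _)
      have h3 : b ^ (k + 1) • x = b ^ k • T.pull n (T.push n x) - b ^ k • y := by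
        rw [smul_sub, sub_sub_cancel, pow_succ, mul_smul]
      rw [h3]
      exact sub_mem (Submodule.smul_of_tower_mem _ _ (T.pull_mem_boundaries hpush)) h2
  intro x hx hp
  exact key r le_rfl x (by rw [hFr]; exact hx) hp

end Level

end BasedComplex

end

noncomputable section

/-! ### Covolumes of lattices -/

theorem exists_factor_of_surjective {M M' V : Type*} [AddCommGroup M] [AddCommGroup M']
    [AddCommGroup V] (j : M →ₗ[ℤ] V) (p : M →ₗ[ℤ] M') (hp : Function.Surjective p)
    (h : LinearMap.ker p ≤ LinearMap.ker j) : ∃ k : M' →ₗ[ℤ] V, ∀ x, k (p x) = j x := by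
  refine ⟨(LinearMap.ker p).liftQ j h ∘ₗ (p.quotKerEquivOfSurjective hp).symm.toLinearMap,
    fun x => ?_⟩
  have : (p.quotKerEquivOfSurjective hp).symm (p x) = Submodule.Quotient.mk x := by
    rw [LinearEquiv.symm_apply_eq]; rfl
  rw [LinearMap.comp_apply, LinearEquiv.coe_coe, this]
  rfl

section Gram

variable {V W : Type*} [NormedAddCommGroup V] [InnerProductSpace ℂ V]
  [NormedAddCommGroup W] [InnerProductSpace ℂ W]

open Matrix in
theorem gram_linearCombination {κ κ' : Type*} [Fintype κ] {v : κ → V} {w : κ' → V}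
    (A : Matrix κ κ' ℂ) (h : ∀ j, w j = ∑ i, A i j • v i) :
    gram ℂ w = Aᴴ * gram ℂ v * A := by
  ext i j
  rw [gram_apply, h, h, mul_apply, inner_sum]
  refine Finset.sum_congr rfl fun l _ => ?_
  rw [inner_smul_right, sum_inner, mul_apply, mul_comm]
  congr 1
  refine Finset.sum_congr rfl fun k _ => ?_
  rw [inner_smul_left, conjTranspose_apply, gram_apply]
  rfl

theorem norm_det_gram_linearCombination {κ : Type*} [Fintype κ] [DecidableEq κ] {v w : κ → V}
    (A : Matrix κ κ ℂ) (h : ∀ j, w j = ∑ i, A i j • v i) :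
    ‖(Matrix.gram ℂ w).det‖ = ‖A.det‖ ^ 2 * ‖(Matrix.gram ℂ v).det‖ := by
  rw [gram_linearCombination A h, Matrix.det_mul, Matrix.det_mul, Matrix.det_conjTranspose,
    norm_mul, norm_mul, norm_star]
  ring

theorem norm_det_gram_comp_equiv {κ κ' : Type*} [Fintype κ] [DecidableEq κ] [Fintype κ']
    [DecidableEq κ'] (v : κ → V) (e : κ' ≃ κ) :
    ‖(Matrix.gram ℂ (v ∘ e)).det‖ = ‖(Matrix.gram ℂ v).det‖ := by
  exact congrArg norm (Matrix.det_submatrix_equiv_self e (Matrix.gram ℂ v))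

theorem norm_det_gram_comp_basis {κ M M' : Type*} [Fintype κ] [DecidableEq κ] [AddCommGroup M]
    [AddCommGroup M'] (i : M' →ₗ[ℤ] M) (b : Module.Basis κ ℤ M) (b' : κ → M')
    (j : M →ₗ[ℤ] V) :
    ‖(Matrix.gram ℂ fun a => j (i (b' a))).det‖ =
      ((b.det fun a => i (b' a)).natAbs : ℝ) ^ 2 * ‖(Matrix.gram ℂ fun a => j (b a)).det‖ := by
  have h := norm_det_gram_linearCombination (v := fun a => j (b a))
    (w := fun a => j (i (b' a))) ((b.toMatrix fun a => i (b' a)).map (Int.cast : ℤ → ℂ)) ?_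
  · rw [h, Module.Basis.det_apply]
    congr 2
    have : ((b.toMatrix fun a => i (b' a)).map (Int.cast : ℤ → ℂ)).det =
        (((b.toMatrix fun a => i (b' a)).det : ℤ) : ℂ) :=
      (RingHom.map_det (Int.castRingHom ℂ) _).symm
    rw [this, Complex.norm_intCast, Nat.cast_natAbs, Int.cast_abs]
  · intro a
    have h1 := b.sum_toMatrix_smul_self (fun a => i (b' a)) a
    conv_lhs => rw [← h1, map_sum]
    refine Finset.sum_congr rfl fun c _ => ?_
    rw [map_smul, Matrix.map_apply, Int.cast_smul_eq_zsmul]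

open Classical in
/-- The square of the covolume of the image of a lattice in a complex Hilbert space, where the
members of a basis of the lattice span a unit cube in its complexification. -/
def covolSq {M : Type*} [AddCommGroup M] [Module.Free ℤ M] [Module.Finite ℤ M] (j : M →ₗ[ℤ] V) :
    ℝ := ‖(Matrix.gram ℂ fun a => j (Module.Free.chooseBasis ℤ M a)).det‖

theorem span_image_eq_span_range_basis {M : Type*} [AddCommGroup M] (j : M →ₗ[ℤ] V)
    {κ : Type*} (b : Module.Basis κ ℤ M) :
    Submodule.span ℂ (Set.range j) = Submodule.span ℂ (Set.range fun a => j (b a)) := by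
  refine le_antisymm (Submodule.span_le.2 ?_) (Submodule.span_mono ?_)
  · rintro _ ⟨x, rfl⟩
    rw [← b.linearCombination_repr x, Finsupp.linearCombination_apply, map_finsuppSum]
    refine Submodule.sum_mem _ fun a _ => ?_
    dsimp only
    rw [map_smul, ← Int.cast_smul_eq_zsmul ℂ]
    exact Submodule.smul_mem _ _ (Submodule.subset_span ⟨a, rfl⟩)
  · rintro _ ⟨a, rfl⟩
    exact ⟨b a, rfl⟩

variable {M : Type*} [AddCommGroup M] [Module.Free ℤ M] [Module.Finite ℤ M]
  {M' : Type*} [AddCommGroup M'] [Module.Free ℤ M'] [Module.Finite ℤ M'] (j : M →ₗ[ℤ] V)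

/-- Two integral bases differ by a matrix of determinant `±1`, so the Gram determinant does not
depend on the basis. -/
theorem covolSq_eq {κ : Type*} [Fintype κ] [DecidableEq κ] (b : Module.Basis κ ℤ M) :
    covolSq j = ‖(Matrix.gram ℂ fun a => j (b a)).det‖ := by
  classical
  let c := Module.Free.chooseBasis ℤ M
  let e := b.indexEquiv c
  have h1 := norm_det_gram_comp_basis LinearMap.id b (c.reindex e.symm) j
  have h2 : (b.det fun a => LinearMap.id (R := ℤ) ((c.reindex e.symm) a)).natAbs = 1 := by
    rw [← Int.isUnit_iff_natAbs_eq]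
    exact b.isUnit_det _
  rw [h2, Nat.cast_one, one_pow, one_mul] at h1
  rw [← h1, covolSq, ← norm_det_gram_comp_equiv _ e]
  congr 3
  ext a
  simp [c]

/-- The index of a sublattice of full rank is the absolute determinant of the change of basis, and
it enters a Gram determinant squared. -/
theorem covolSq_comp_of_finite (i : M' →ₗ[ℤ] M) (hi : Function.Injective i)
    (hfin : Finite (M ⧸ LinearMap.range i)) :
    covolSq (j ∘ₗ i) = (Nat.card (M ⧸ LinearMap.range i) : ℝ) ^ 2 * covolSq j := by
  classical
  let b := Module.Free.chooseBasis ℤ M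
  let c := Module.Free.chooseBasis ℤ M'
  have h0 : Module.finrank ℤ (M ⧸ LinearMap.range i) = 0 := by
    rw [Module.finrank_eq_zero_iff_isTorsion]
    intro x
    refine ⟨⟨Nat.card (M ⧸ LinearMap.range i), mem_nonZeroDivisors_of_ne_zero ?_⟩, ?_⟩
    · exact_mod_cast Nat.card_pos.ne'
    · exact (natCast_zsmul x _).trans (card_nsmul_eq_zero' (x := x))
  have hr := Submodule.finrank_quotient_add_finrank (LinearMap.range i)
  rw [h0, zero_add, LinearMap.finrank_range_of_inj hi] at hr
  let e := Fintype.equivOfCardEq (α := Module.Free.ChooseBasisIndex ℤ M')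
    (β := Module.Free.ChooseBasisIndex ℤ M) (by
      rw [← Module.finrank_eq_card_chooseBasisIndex, ← Module.finrank_eq_card_chooseBasisIndex, hr])
  let c' := c.reindex e
  rw [covolSq_eq (j ∘ₗ i) c', covolSq_eq j b]
  refine (norm_det_gram_comp_basis i b c' j).trans ?_
  congr 3
  exact Submodule.natAbs_det_basis_change b (LinearMap.range i)
    (c'.map (LinearEquiv.ofInjective i hi))

theorem covolSq_of_inner_eq (j' : M →ₗ[ℤ] W) (c : ℝ) (hc : 0 ≤ c)
    (h : ∀ x y, inner ℂ (j' x) (j' y) = (c : ℂ) * inner ℂ (j x) (j y)) :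
    covolSq j' = c ^ Module.finrank ℤ M * covolSq j := by
  classical
  let b := Module.Free.chooseBasis ℤ M
  rw [covolSq_eq j' b, covolSq_eq j b]
  have : (Matrix.gram ℂ fun a => j' (b a)) = (c : ℂ) • Matrix.gram ℂ fun a => j (b a) := by
    ext x y
    exact h _ _
  rw [this, Matrix.det_smul, norm_mul, norm_pow, Complex.norm_real, Real.norm_of_nonneg hc,
    Module.finrank_eq_card_chooseBasisIndex]

theorem linearIndependent_of_covolSq_ne_zero {κ : Type*} [Finite κ] (b : Module.Basis κ ℤ M)
    (h : covolSq j ≠ 0) : LinearIndependent ℂ fun a => j (b a) := by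
  classical
  let _ := Fintype.ofFinite κ
  rw [covolSq_eq j b, norm_ne_zero_iff] at h
  exact Matrix.linearIndependent_of_det_gram_ne_zero h

theorem finrank_span_range (h : covolSq j ≠ 0) :
    Module.finrank ℂ (Submodule.span ℂ (Set.range j)) = Module.finrank ℤ M := by
  rw [span_image_eq_span_range_basis j (Module.Free.chooseBasis ℤ M),
    finrank_span_eq_card (linearIndependent_of_covolSq_ne_zero j _ h),
    Module.finrank_eq_card_chooseBasisIndex]

/-- Covolumes are multiplicative in short exact sequences. -/
theorem covolSq_eq_mul_ker (p : M →ₗ[ℤ] M') (hp : Function.Surjective p) (k : M' →ₗ[ℤ] V)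
    (h1 : ∀ x, j x - k (p x) ∈ Submodule.span ℂ (j '' LinearMap.ker p))
    (h2 : ∀ x ∈ LinearMap.ker p, ∀ y, inner ℂ (j x) (k y) = 0) :
    covolSq j = covolSq (j ∘ₗ (LinearMap.ker p).subtype) * covolSq k := by
  classical
  let bL := Module.Free.chooseBasis ℤ (LinearMap.ker p)
  let bQ := Module.Free.chooseBasis ℤ M'
  let e := p.quotKerEquivOfSurjective hp
  let b := Module.Basis.sumQuot bL (bQ.map e.symm)
  have hb : ∀ a, p (b (Sum.inr a)) = bQ a := by
    intro a
    have h : e (Submodule.Quotient.mk (b (Sum.inr a))) = bQ a := by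
      rw [Module.Basis.sumQuot_inr, Module.Basis.map_apply, LinearEquiv.apply_symm_apply]
    exact h
  have hspan : Submodule.span ℂ (j '' LinearMap.ker p) =
      Submodule.span ℂ (Set.range fun a => j (bL a)) := by
    refine Eq.trans ?_ (span_image_eq_span_range_basis (j ∘ₗ (LinearMap.ker p).subtype) bL)
    congr 1
    ext x
    simp
  have hex : ∀ a, ∃ c : Module.Free.ChooseBasisIndex ℤ (LinearMap.ker p) → ℂ,
      ∑ i, c i • j (bL i) = j (b (Sum.inr a)) - k (bQ a) := by
    intro a
    have := h1 (b (Sum.inr a))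
    rw [hspan, hb] at this
    exact (Submodule.mem_span_range_iff_exists_fun ℂ).1 this
  choose c hc using hex
  let v : _ ⊕ _ → V := Sum.elim (fun i => j (bL i)) fun a => k (bQ a)
  -- The adapted basis arises from the block-orthogonal family `v` by a unipotent matrix, as `j` and
  -- `k ∘ p` differ by elements in the span of the kernel.
  have h3 := norm_det_gram_linearCombination (v := v) (w := fun a => j (b a))
    (Matrix.fromBlocks 1 (Matrix.of fun i a => c a i) 0 1) ?_
  · rw [covolSq_eq j b, h3, Matrix.det_fromBlocks_zero₂₁]
    have h4 : Matrix.gram ℂ v = Matrix.fromBlocks (Matrix.gram ℂ fun i => j (bL i)) 0 0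
        (Matrix.gram ℂ fun a => k (bQ a)) := by
      ext x y
      rcases x with x | x <;> rcases y with y | y
      · rfl
      · exact h2 _ (bL x).2 _
      · change inner ℂ (k (bQ x)) (j (bL y)) = 0
        rw [← inner_conj_symm, h2 _ (bL y).2, map_zero]
      · rfl
    rw [h4, Matrix.det_fromBlocks_zero₂₁, norm_mul]
    simp only [Matrix.det_one, mul_one, norm_one, one_pow, one_mul]
    rw [norm_mul]
    rfl
  · rintro (a | a)
    · rw [Fintype.sum_sum_type, Finset.sum_eq_single a]
      · simp [v, b]
      · intro i _ hi
        simp [hi]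
      · simp
    · rw [Fintype.sum_sum_type]
      simp [v, hc, Matrix.one_apply, ite_smul]

theorem covolSq_eq_mul {L : Submodule ℤ M} (p : M →ₗ[ℤ] M') (hL : LinearMap.ker p = L)
    (hp : Function.Surjective p) (k : M' →ₗ[ℤ] V)
    (h1 : ∀ x, j x - k (p x) ∈ Submodule.span ℂ (j '' L))
    (h2 : ∀ x ∈ L, ∀ y, inner ℂ (j x) (k y) = 0) :
    covolSq j = covolSq (j ∘ₗ L.subtype) * covolSq k := by
  subst hL
  exact covolSq_eq_mul_ker j p hp k h1 h2

end Gram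

end

noncomputable section

/-! ### Fuglede-Kadison determinants over the trivial group -/

section FKDet

variable {E F : Type*} [NormedAddCommGroup E] [InnerProductSpace ℂ E] [FiniteDimensional ℂ E]
    [NormedAddCommGroup F] [InnerProductSpace ℂ F] [FiniteDimensional ℂ F] (f : E →ₗ[ℂ] F)

theorem isSymmetric_adjoint_comp_self : (LinearMap.adjoint f ∘ₗ f).IsSymmetric := fun x y => by
  rw [LinearMap.comp_apply, LinearMap.comp_apply, LinearMap.adjoint_inner_left,
    LinearMap.adjoint_inner_right]

/-- The squares of the singular values of `f`. -/
abbrev sqSingular : Fin (Module.finrank ℂ E) → ℝ := (isSymmetric_adjoint_comp_self f).eigenvalues rfl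

/-- A basis of right singular vectors of `f`. -/
abbrev singularBasis : OrthonormalBasis (Fin (Module.finrank ℂ E)) ℂ E :=
  (isSymmetric_adjoint_comp_self f).eigenvectorBasis rfl

theorem adjoint_apply_singularBasis (i : Fin (Module.finrank ℂ E)) :
    LinearMap.adjoint f (f (singularBasis f i)) = (sqSingular f i : ℂ) • singularBasis f i :=
  (isSymmetric_adjoint_comp_self f).apply_eigenvectorBasis rfl i

theorem inner_apply_singularBasis (i j : Fin (Module.finrank ℂ E)) :
    inner ℂ (f (singularBasis f i)) (f (singularBasis f j)) =
      if i = j then (sqSingular f i : ℂ) else 0 := by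
  rw [← LinearMap.adjoint_inner_right, adjoint_apply_singularBasis, inner_smul_right,
    orthonormal_iff_ite.1 (singularBasis f).orthonormal]
  split_ifs with h
  · rw [h, mul_one]
  · rw [mul_zero]

theorem sqSingular_eq (i : Fin (Module.finrank ℂ E)) :
    sqSingular f i = ‖f (singularBasis f i)‖ ^ 2 := by
  have h := inner_apply_singularBasis f i i
  rw [if_pos rfl, inner_self_eq_norm_sq_to_K] at h
  exact Complex.ofReal_injective (by rw [← h]; push_cast; rfl)

/-- Counting eigenvalues with multiplicity turns the spectral sum into one over a singular basis.
Zero singular values drop out on both sides, because `Real.log 0 = 0`. -/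
theorem logFKDet_finrank_eq :
    logFKDet (fun V => (Module.finrank ℂ V : ℝ)) f = ∑ i, Real.log (sqSingular f i) / 2 := by
  classical
  have h1 : ∀ t : Set.Ioi (0 : ℝ), Real.log t * (Module.finrank ℂ (Module.End.eigenspace
      (LinearMap.adjoint f ∘ₗ f) (((t : ℝ) : ℂ) ^ 2)) : ℝ) =
      ∑ i, if sqSingular f i = (t : ℝ) ^ 2 then Real.log t else 0 := by
    intro t
    have := (isSymmetric_adjoint_comp_self f).card_filter_eigenvalues_eq rfl (((t : ℝ) : ℂ) ^ 2)
    rw [← this, Finset.sum_ite, Finset.sum_const, Finset.sum_const_zero, add_zero, nsmul_eq_mul,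
      mul_comm]
    congr 3
    ext i
    simp only [Finset.mem_filter, Finset.mem_univ, true_and]
    rw [← Complex.ofReal_pow]
    exact Complex.ofReal_inj
  have h2 : ∀ i, ∑ᶠ t : Set.Ioi (0 : ℝ), (if sqSingular f i = (t : ℝ) ^ 2 then Real.log t else 0)
      = Real.log (sqSingular f i) / 2 := by
    intro i
    have h0 : 0 ≤ sqSingular f i := by rw [sqSingular_eq]; positivity
    rcases h0.eq_or_lt with h | h
    · rw [← h, Real.log_zero, zero_div]
      refine (finsum_congr fun t => ?_).trans finsum_zero
      have : (0 : ℝ) < (t : ℝ) ^ 2 := pow_pos t.2 2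
      rw [if_neg this.ne]
    · rw [finsum_eq_single _ (⟨√(sqSingular f i), Real.sqrt_pos.2 h⟩ : Set.Ioi (0 : ℝ))]
      · rw [if_pos (Real.sq_sqrt h.le).symm, Real.log_sqrt h.le]
      · rintro ⟨t, ht⟩ hne
        rw [if_neg]
        intro h3
        apply hne
        apply Subtype.ext
        change t = √(sqSingular f i)
        rw [h3]
        exact (Real.sqrt_sq (Set.mem_Ioi.1 ht).le).symm
  rw [logFKDet, finsum_congr h1, finsum_sum_comm]
  · exact Finset.sum_congr rfl fun i _ => h2 i
  · intro i _
    refine Set.Finite.subset (s := {t : Set.Ioi (0 : ℝ) | sqSingular f i = (t : ℝ) ^ 2}) ?_ ?_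
    · refine Set.Subsingleton.finite fun s hs t ht => Subtype.ext ?_
      have h3 : (s : ℝ) ^ 2 = (t : ℝ) ^ 2 := hs.symm.trans ht
      exact (pow_left_inj₀ (Set.mem_Ioi.1 s.2).le (Set.mem_Ioi.1 t.2).le two_ne_zero).1 h3
    · intro t ht
      by_contra h3
      exact ht (if_neg h3)

theorem logFKDet_finrank_le {K : ℝ} (hK : 1 ≤ K) (h : ∀ x, ‖f x‖ ≤ K * ‖x‖) :
    logFKDet (fun V => (Module.finrank ℂ V : ℝ)) f ≤ Module.finrank ℂ E * Real.log K := by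
  rw [logFKDet_finrank_eq]
  have h1 : ∀ i, Real.log (sqSingular f i) / 2 ≤ Real.log K := by
    intro i
    have h2 := h (singularBasis f i)
    rw [(singularBasis f).orthonormal.1 i, mul_one] at h2
    rw [sqSingular_eq, Real.log_pow]
    rcases (norm_nonneg (f (singularBasis f i))).eq_or_lt with h3 | h3
    · rw [← h3, Real.log_zero]
      simpa using Real.log_nonneg hK
    · have := Real.log_le_log h3 h2
      push_cast
      linarith
  refine (Finset.sum_le_sum fun i _ => h1 i).trans ?_
  simp

/-- The right singular vectors with nonzero singular value form an orthonormal basis of the same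
space `(ker f)ᗮ`, and `f` maps them to orthogonal vectors. The transition matrix `A` to the family
`v` affects both Gram determinants by the same factor, so their ratio is the product of the squared
nonzero singular values. -/
theorem log_norm_det_gram_comp {κ : Type*} [Fintype κ] [DecidableEq κ] {v : κ → E}
    (hv : LinearIndependent ℂ v) (hspan : Submodule.span ℂ (Set.range v) = (LinearMap.ker f)ᗮ) :
    Real.log ‖(Matrix.gram ℂ fun a => f (v a)).det‖ =
      Real.log ‖(Matrix.gram ℂ v).det‖ +
        2 * logFKDet (fun V => (Module.finrank ℂ V : ℝ)) f := by
  classical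
  let κ' := {i // sqSingular f i ≠ 0}
  let u : κ' → E := fun i => singularBasis f i
  have hu : LinearIndependent ℂ u :=
    (singularBasis f).orthonormal.linearIndependent.comp _ Subtype.val_injective
  have hker : ∀ i, sqSingular f i = 0 → singularBasis f i ∈ LinearMap.ker f := by
    intro i hi
    rw [sqSingular_eq] at hi
    simpa using hi
  have huspan : Submodule.span ℂ (Set.range u) = (LinearMap.ker f)ᗮ := by
    refine le_antisymm (Submodule.span_le.2 ?_) fun x hx => ?_
    · rintro _ ⟨i, rfl⟩
      refine (Submodule.mem_orthogonal _ _).2 fun y hy => ?_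
      have h0 : inner ℂ y (LinearMap.adjoint f (f (singularBasis f i))) = 0 := by
        rw [LinearMap.adjoint_inner_right, LinearMap.mem_ker.1 hy, inner_zero_left]
      rw [adjoint_apply_singularBasis, inner_smul_right] at h0
      refine (mul_eq_zero.1 h0).resolve_left ?_
      exact_mod_cast i.2
    · rw [← (singularBasis f).sum_repr' x]
      refine Submodule.sum_mem _ fun i _ => ?_
      by_cases hi : sqSingular f i = 0
      · rw [(Submodule.mem_orthogonal _ _).1 hx _ (hker i hi), zero_smul]
        exact zero_mem _
      · exact Submodule.smul_mem _ _ (Submodule.subset_span ⟨⟨i, hi⟩, rfl⟩)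
  have hcard : Fintype.card κ = Fintype.card κ' := by
    rw [← finrank_span_eq_card hv, ← finrank_span_eq_card hu, hspan, huspan]
  let e := Fintype.equivOfCardEq hcard
  have hex : ∀ a, ∃ c : κ → ℂ, ∑ i, c i • u (e i) = v a := by
    intro a
    have h0 : v a ∈ Submodule.span ℂ (Set.range (u ∘ e)) := by
      rw [e.surjective.range_comp, huspan, ← hspan]
      exact Submodule.subset_span ⟨a, rfl⟩
    exact (Submodule.mem_span_range_iff_exists_fun ℂ).1 h0
  choose c hc using hex
  let A : Matrix κ κ ℂ := Matrix.of fun i a => c a i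
  have h1 := norm_det_gram_linearCombination (v := fun i => u (e i)) (w := v) A
    fun a => (hc a).symm
  have h2 := norm_det_gram_linearCombination (v := fun i => f (u (e i)))
    (w := fun a => f (v a)) A fun a => by
      rw [← hc a, map_sum]
      simp only [map_smul]
      rfl
  have h3 : Matrix.gram ℂ (fun i => u (e i)) = 1 := by
    rw [Matrix.gram_eq_one_iff_orthonormal]
    exact ((singularBasis f).orthonormal.comp _ Subtype.val_injective).comp e e.injective
  have h4 : Matrix.gram ℂ (fun i => f (u (e i))) =
      Matrix.diagonal fun i => (sqSingular f (e i) : ℂ) := by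
    ext i j
    refine (inner_apply_singularBasis f (e i) (e j)).trans ?_
    rw [Matrix.diagonal_apply]
    have : ((e i).1 = (e j).1) ↔ i = j := by
      rw [← Subtype.ext_iff, e.injective.eq_iff]
    simp only [this]
  have hA : ‖A.det‖ ^ 2 ≠ 0 := by
    intro h0
    rw [h0, zero_mul, norm_eq_zero] at h1
    exact Matrix.det_gram_ne_zero_iff_linearIndependent.2 hv h1
  have hprod : ‖(Matrix.diagonal fun i => (sqSingular f (e i) : ℂ)).det‖ =
      ∏ i, sqSingular f (e i) := by
    rw [Matrix.det_diagonal, norm_prod]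
    refine Finset.prod_congr rfl fun i _ => ?_
    rw [Complex.norm_real, Real.norm_of_nonneg]
    rw [sqSingular_eq]; positivity
  rw [h2, h4, hprod, h1, h3, Matrix.det_one, norm_one, mul_one, Real.log_mul hA
    (Finset.prod_ne_zero_iff.2 fun i _ => (e i).2), Real.log_prod fun i _ => (e i).2,
    logFKDet_finrank_eq, ← Finset.sum_div, mul_div_cancel₀ _ two_ne_zero]
  congr 1
  rw [e.sum_comp (fun i : κ' => Real.log (sqSingular f i)),
    ← Finset.sum_subtype (Finset.univ.filter fun i => sqSingular f i ≠ 0) (by simp)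
      (fun i => Real.log (sqSingular f i))]
  refine Finset.sum_subset (Finset.filter_subset _ _) fun i _ hi => ?_
  have : sqSingular f i = 0 := by simpa using hi
  rw [this, Real.log_zero]

theorem two_mul_logFKDet_constr {κ : Type*} [Fintype κ] [DecidableEq κ] {v : κ → F}
    (hv : LinearIndependent ℂ v) :
    2 * logFKDet (fun V => (Module.finrank ℂ V : ℝ))
      ((EuclideanSpace.basisFun κ ℂ).toBasis.constr ℂ v) = Real.log ‖(Matrix.gram ℂ v).det‖ := by
  let B := EuclideanSpace.basisFun κ ℂ
  have ha : ∀ j, B.toBasis.constr ℂ v (B j) = v j := fun j => by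
    have := B.toBasis.constr_basis ℂ v j
    rwa [OrthonormalBasis.coe_toBasis] at this
  have hker : LinearMap.ker (B.toBasis.constr ℂ v) = ⊥ := by
    refine LinearMap.ker_eq_bot'.2 fun x hx => ?_
    have h1 := B.sum_repr x
    rw [← h1, map_sum] at hx
    simp only [map_smul, ha] at hx
    rw [← h1]
    refine Finset.sum_eq_zero fun j _ => ?_
    rw [Fintype.linearIndependent_iff.1 hv _ hx j, zero_smul]
  have h := log_norm_det_gram_comp (B.toBasis.constr ℂ v) (v := B) B.orthonormal.linearIndependent
    (by rw [hker, Submodule.bot_orthogonal_eq_top, ← OrthonormalBasis.coe_toBasis,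
      Module.Basis.span_eq])
  rw [Matrix.gram_eq_one_iff_orthonormal.2 B.orthonormal, Matrix.det_one, norm_one, Real.log_one,
    zero_add] at h
  simp only [ha] at h
  exact h.symm

theorem two_mul_logFKDet_constr_submodule {κ : Type*} [Fintype κ] [DecidableEq κ]
    {U : Submodule ℂ F} {v : κ → U} (hv : LinearIndependent ℂ fun a => (v a : F)) :
    2 * logFKDet (fun V => (Module.finrank ℂ V : ℝ))
      ((EuclideanSpace.basisFun κ ℂ).toBasis.constr ℂ v) =
        Real.log ‖(Matrix.gram ℂ fun a => (v a : F)).det‖ :=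
  two_mul_logFKDet_constr (LinearIndependent.of_comp U.subtype hv)

end FKDet

end

/-! ### Integral lattices in the Hilbert chain complex and the determinant of the differential -/

noncomputable section

namespace BasedComplex

variable (E : BasedComplex.{0, w} ℤ)

/-- The inclusion of the integral chains into the Hilbert chain modules. -/
def toL2Hom (n : ℕ) : E.X n →ₗ[ℤ] E.L2 n := (E.toL2 n).toIntLinearMap

theorem inner_toL2Hom (n : ℕ) (x y : E.X n) :
    inner ℂ (E.toL2Hom n x) (E.toL2Hom n y) = ((∑ a, x a * y a : ℤ) : ℂ) := by
  rw [PiLp.inner_apply]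
  push_cast
  refine Finset.sum_congr rfl fun a _ => ?_
  change inner ℂ (x a : ℂ) (y a : ℂ) = _
  simp [mul_comm]

/-- The Gram matrix has integer entries, and its determinant is nonzero as the standard form is
positive definite; a nonzero integer has absolute value at least `1`. This is the source of all
lower bounds on covolumes below. -/
theorem one_le_covolSq {n : ℕ} {M : Type*} [AddCommGroup M] [Module.Free ℤ M] [Module.Finite ℤ M]
    (i : M →ₗ[ℤ] E.X n) (hi : Function.Injective i) : 1 ≤ covolSq (E.toL2Hom n ∘ₗ i) := by
  classical
  let b := Module.Free.chooseBasis ℤ M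
  let A : Matrix (Module.Free.ChooseBasisIndex ℤ M) (E.ι n) ℤ := Matrix.of fun a => i (b a)
  have h1 : (Matrix.gram ℂ fun a => (E.toL2Hom n ∘ₗ i) (b a)) =
      (A * A.transpose).map (Int.castRingHom ℂ) := by
    ext x y
    exact E.inner_toL2Hom n _ _
  have h2 : (A * A.transpose).det ≠ 0 := by
    intro h0
    obtain ⟨v, hv, hv0⟩ := Matrix.exists_mulVec_eq_zero_iff.2 h0
    apply hv
    rw [← Matrix.mulVec_mulVec] at hv0
    have h3 : (A.transpose.mulVec v) ⬝ᵥ (A.transpose.mulVec v) = 0 := by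
      rw [Matrix.dotProduct_mulVec, Matrix.vecMul_transpose, hv0, zero_dotProduct]
    have h4 : A.transpose.mulVec v = 0 := dotProduct_self_eq_zero.1 h3
    have h5 : i (∑ a, v a • b a) = 0 := by
      rw [map_sum, ← h4]
      ext c
      simp only [map_smul, Finset.sum_apply, Pi.smul_apply, smul_eq_mul]
      exact Finset.sum_congr rfl fun a _ => mul_comm _ _
    have h6 := hi (h5.trans (map_zero i).symm)
    exact funext (Fintype.linearIndependent_iff.1 b.linearIndependent v h6)
  rw [covolSq_eq _ b, h1, ← RingHom.mapMatrix_apply, ← RingHom.map_det]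
  change 1 ≤ ‖((A * A.transpose).det : ℂ)‖
  rw [Complex.norm_intCast]
  exact_mod_cast Int.one_le_abs h2

theorem covolSq_toL2Hom (n : ℕ) : covolSq (E.toL2Hom n) = 1 := by
  classical
  have h : (Matrix.gram ℂ fun a => E.toL2Hom n (Pi.basisFun ℤ (E.ι n) a)) = 1 := by
    ext x y
    rw [Matrix.gram_apply, inner_toL2Hom]
    simp [Matrix.one_apply, Pi.single_apply, eq_comm]
  rw [covolSq_eq _ (Pi.basisFun ℤ (E.ι n)), h, Matrix.det_one, norm_one]

theorem span_range_toL2Hom (n : ℕ) : Submodule.span ℂ (Set.range (E.toL2Hom n)) = ⊤ := by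
  classical
  rw [span_image_eq_span_range_basis _ (Pi.basisFun ℤ (E.ι n)), eq_top_iff,
    ← (EuclideanSpace.basisFun (E.ι n) ℂ).toBasis.span_eq]
  refine Submodule.span_mono ?_
  rintro _ ⟨a, rfl⟩
  refine ⟨a, ?_⟩
  ext c
  change ((Pi.basisFun ℤ (E.ι n) a c : ℤ) : ℂ) = _
  simp [Pi.single_apply]

theorem toL2Hom_d (n : ℕ) (x : E.X (n + 1)) :
    E.toL2Hom n (E.d n x) = E.l2d n (E.toL2Hom (n + 1) x) := E.toL2_d n x

theorem range_l2d (n : ℕ) :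
    LinearMap.range (E.l2d n) = Submodule.span ℂ (E.toL2Hom n '' E.boundaries n) := by
  rw [LinearMap.range_eq_map, ← span_range_toL2Hom, Submodule.map_span]
  congr 1
  ext y
  constructor
  · rintro ⟨_, ⟨x, rfl⟩, rfl⟩
    exact ⟨E.d n x, ⟨x, rfl⟩, E.toL2Hom_d n x⟩
  · rintro ⟨_, ⟨x, rfl⟩, rfl⟩
    exact ⟨_, ⟨x, rfl⟩, (E.toL2Hom_d n x).symm⟩

theorem finrank_span_image {n : ℕ} (M : Submodule ℤ (E.X n)) :
    Module.finrank ℂ (Submodule.span ℂ (E.toL2Hom n '' M)) = Module.finrank ℤ M := by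
  have h := finrank_span_range (E.toL2Hom n ∘ₗ M.subtype)
    (zero_lt_one.trans_le (E.one_le_covolSq M.subtype M.subtype_injective)).ne'
  rw [← h]
  have : Set.range (E.toL2Hom n ∘ₗ M.subtype) = E.toL2Hom n '' M := by
    ext x
    simp
  rw [this]

/-- One inclusion is clear, and the dimensions agree because a sublattice of the integral chains
spans a complex space of dimension equal to its rank. -/
theorem ker_l2d (n : ℕ) :
    LinearMap.ker (E.l2d n) = Submodule.span ℂ (E.toL2Hom (n + 1) '' E.cycles (n + 1)) := by
  refine (Submodule.eq_of_le_of_finrank_le (Submodule.span_le.2 ?_) ?_).symm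
  · rintro _ ⟨x, hx, rfl⟩
    change E.l2d n _ = 0
    rw [← toL2Hom_d, LinearMap.mem_ker.1 hx, map_zero]
  · have h1 := LinearMap.finrank_range_add_finrank_ker (E.l2d n)
    rw [range_l2d, finrank_span_image, finrank_euclideanSpace,
      ← E.finrank_boundaries_add_finrank_cycles n] at h1
    rw [finrank_span_image]
    omega

/-- Half the logarithm of the covolume of the boundaries and of the cycles determine the
Fuglede-Kadison determinant of the differential. -/
theorem two_mul_logFKDet_l2d (n : ℕ) :
    2 * logFKDet (fun V => (Module.finrank ℂ V : ℝ)) (E.l2d n) =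
      Real.log (covolSq (E.toL2Hom n ∘ₗ (E.boundaries n).subtype)) +
        Real.log (covolSq (E.toL2Hom (n + 1) ∘ₗ (E.cycles (n + 1)).subtype)) := by
  classical
  let U := LinearMap.ker (E.l2d n)
  let P : E.L2 (n + 1) →ₗ[ℂ] E.L2 (n + 1) := Uᗮ.starProjection
  let k₀ : E.X (n + 1) →ₗ[ℤ] E.L2 (n + 1) := P.restrictScalars ℤ ∘ₗ E.toL2Hom (n + 1)
  have hk₀ : LinearMap.ker (E.d n) ≤ LinearMap.ker k₀ := by
    intro x hx
    change Uᗮ.starProjection (E.toL2Hom (n + 1) x) = 0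
    rw [Submodule.starProjection_apply_eq_zero_iff]
    refine Submodule.le_orthogonal_orthogonal U ?_
    change E.l2d n _ = 0
    rw [← toL2Hom_d, LinearMap.mem_ker.1 hx, map_zero]
  let p : E.X (n + 1) →ₗ[ℤ] E.boundaries n := (E.d n).codRestrict _ fun x => ⟨x, rfl⟩
  have hsurj : Function.Surjective p := fun ⟨_, x, hx⟩ => ⟨x, Subtype.ext hx⟩
  have hp : LinearMap.ker p = E.cycles (n + 1) := LinearMap.ker_codRestrict _ _ _
  obtain ⟨k, hk'⟩ := exists_factor_of_surjective k₀ p hsurj (hp.le.trans hk₀)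
  have hk : ∀ x, k (p x) = Uᗮ.starProjection (E.toL2Hom (n + 1) x) := hk'
  have hkU : ∀ y, k y ∈ Uᗮ := by
    intro y
    obtain ⟨x, rfl⟩ := hsurj y
    rw [hk]
    exact Submodule.starProjection_apply_mem _ _
  -- The map `k` sends a boundary to its unique preimage orthogonal to the kernel. The full chain
  -- lattice has covolume `1`, so the covolume of the image of `k` is the inverse of that of the
  -- cycles, while the differential maps this image onto the lattice of boundaries.
  have h1 := covolSq_eq_mul (E.toL2Hom (n + 1)) p hp hsurj k ?_ ?_
  rotate_left
  · intro x
    rw [hk, ← E.ker_l2d]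
    have := Uᗮ.sub_starProjection_mem_orthogonal (E.toL2Hom (n + 1) x)
    rwa [Submodule.orthogonal_orthogonal] at this
  · intro x hx y
    refine (Submodule.mem_orthogonal _ _).1 (hkU y) _ ?_
    change E.l2d n _ = 0
    rw [← toL2Hom_d, LinearMap.mem_ker.1 hx, map_zero]
  rw [covolSq_toL2Hom] at h1
  have hk0 : covolSq k ≠ 0 := fun h0 => by rw [h0, mul_zero] at h1; exact one_ne_zero h1
  have hz0 : covolSq (E.toL2Hom (n + 1) ∘ₗ (E.cycles (n + 1)).subtype) ≠ 0 :=
    fun h0 => by rw [h0, zero_mul] at h1; exact one_ne_zero h1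
  let b := Module.Free.chooseBasis ℤ (E.boundaries n)
  have h2 := log_norm_det_gram_comp (E.l2d n) (linearIndependent_of_covolSq_ne_zero k b hk0) ?_
  · have h3 : (Matrix.gram ℂ fun a => E.l2d n (k (b a))) =
        Matrix.gram ℂ fun a => (E.toL2Hom n ∘ₗ (E.boundaries n).subtype) (b a) := by
      congr 1
      ext1 a
      obtain ⟨x, hx⟩ := hsurj (b a)
      change _ = E.toL2Hom n (b a).1
      rw [← hx, hk]
      change _ = E.toL2Hom n (E.d n x)
      rw [toL2Hom_d, ← sub_eq_zero, ← map_sub, ← LinearMap.mem_ker, ← neg_mem_iff, neg_sub]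
      have := Uᗮ.sub_starProjection_mem_orthogonal (E.toL2Hom (n + 1) x)
      rwa [Submodule.orthogonal_orthogonal] at this
    rw [h3, ← covolSq_eq, ← covolSq_eq k b] at h2
    rw [h2]
    have h4 := congrArg Real.log h1
    rw [Real.log_one, Real.log_mul hz0 hk0] at h4
    linarith
  · rw [← span_image_eq_span_range_basis k b]
    refine le_antisymm (Submodule.span_le.2 ?_) fun x hx => ?_
    · rintro _ ⟨y, rfl⟩
      exact hkU y
    · rw [← Submodule.starProjection_eq_self_iff.2 hx]
      have h5 : x ∈ Submodule.span ℂ (Set.range (E.toL2Hom (n + 1))) := by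
        rw [span_range_toL2Hom]; trivial
      have h6 : P x ∈ (Submodule.span ℂ (Set.range (E.toL2Hom (n + 1)))).map P := ⟨x, h5, rfl⟩
      rw [Submodule.map_span] at h6
      refine Submodule.span_mono ?_ h6
      rintro _ ⟨_, ⟨z, rfl⟩, rfl⟩
      exact ⟨_, hk z⟩

end BasedComplex

end

/-! ### Harmonic chains and the regulator -/

noncomputable section

namespace BasedComplex

variable (E : BasedComplex.{0, w} ℤ)

theorem l2d_of_mem_harmonic (n : ℕ) (u : E.L2 (n + 1)) (hu : u ∈ E.Harmonic (n + 1)) :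
    E.l2d n u = 0 := by
  have h1 := E.adjoint_l2d_of_mem_harmonic (n + 1) u hu
  have h2 : LinearMap.adjoint (E.l2d n) (E.l2d n u) +
      E.l2d (n + 1) (LinearMap.adjoint (E.l2d (n + 1)) u) = 0 := hu
  rw [h1, map_zero, add_zero] at h2
  have h3 : inner ℂ (E.l2d n u) (E.l2d n u) = 0 := by
    rw [← LinearMap.adjoint_inner_left, h2, inner_zero_left]
  exact inner_self_eq_zero.1 h3

/-- The complexified cycles. -/
def l2cycles (n : ℕ) : Submodule ℂ (E.L2 n) := Submodule.span ℂ (E.toL2Hom n '' E.cycles n)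

theorem mem_harmonic_iff {n : ℕ} {u : E.L2 n} :
    u ∈ E.Harmonic n ↔ u ∈ E.l2cycles n ∧ LinearMap.adjoint (E.l2d n) u = 0 := by
  refine ⟨fun hu => ⟨?_, E.adjoint_l2d_of_mem_harmonic n u hu⟩, fun ⟨h1, h2⟩ => ?_⟩
  · cases n with
    | zero =>
      have : E.l2cycles 0 = ⊤ := by
        rw [← E.span_range_toL2Hom 0, l2cycles]
        congr 1
        exact Set.image_univ
      rw [this]; trivial
    | succ n =>
      rw [l2cycles, ← ker_l2d]
      exact E.l2d_of_mem_harmonic n u hu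
  · cases n with
    | zero =>
      change E.l2d 0 (LinearMap.adjoint (E.l2d 0) u) = 0
      rw [h2, map_zero]
    | succ n =>
      rw [l2cycles, ← ker_l2d] at h1
      change LinearMap.adjoint (E.l2d n) (E.l2d n u) +
        E.l2d (n + 1) (LinearMap.adjoint (E.l2d (n + 1)) u) = 0
      rw [h2, LinearMap.mem_ker.1 h1, map_zero, map_zero, add_zero]

theorem range_l2d_le_l2cycles (n : ℕ) : LinearMap.range (E.l2d n) ≤ E.l2cycles n := by
  rw [range_l2d]
  exact Submodule.span_mono (Set.image_mono (E.boundaries_le_cycles n))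

theorem inner_l2d_harmonic {n : ℕ} {u : E.L2 n} (hu : u ∈ E.Harmonic n) (y : E.L2 (n + 1)) :
    inner ℂ (E.l2d n y) u = 0 := by
  rw [← LinearMap.adjoint_inner_right, E.adjoint_l2d_of_mem_harmonic n u hu, inner_zero_right]

/-- The Hodge decomposition of cycles. -/
theorem mem_range_l2d_of_mem_l2cycles {n : ℕ} {x : E.L2 n} (hx : x ∈ E.l2cycles n)
    (hx' : x ∈ (E.Harmonic n)ᗮ) : x ∈ LinearMap.range (E.l2d n) := by
  let U := LinearMap.range (E.l2d n)
  have h1 : U.starProjection x ∈ U := Submodule.starProjection_apply_mem _ _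
  have h2 : x - U.starProjection x ∈ Uᗮ := U.sub_starProjection_mem_orthogonal x
  have h3 : x - U.starProjection x ∈ E.Harmonic n := by
    refine E.mem_harmonic_iff.2 ⟨sub_mem hx (E.range_l2d_le_l2cycles n h1), ?_⟩
    refine ext_inner_left ℂ fun y => ?_
    rw [LinearMap.adjoint_inner_right, inner_zero_right]
    exact (Submodule.mem_orthogonal _ _).1 h2 _ ⟨y, rfl⟩
  have h4 : U.starProjection x ∈ (E.Harmonic n)ᗮ := by
    obtain ⟨y, hy⟩ := h1
    rw [← hy]
    exact (Submodule.mem_orthogonal' _ _).2 fun u hu => E.inner_l2d_harmonic hu y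
  have h5 := inner_self_eq_zero.1 ((Submodule.mem_orthogonal _ _).1 (sub_mem hx' h4) _ h3)
  rw [sub_eq_zero] at h5
  rw [h5]
  exact h1

/-- The projection from the cycles to the homology modulo torsion. -/
def toFreeHomology (n : ℕ) : E.cycles n →ₗ[ℤ] E.FreeHomology n :=
  (Submodule.mkQ (Submodule.torsion ℤ (E.Homology n))) ∘ₗ
    Submodule.mkQ ((E.boundaries n).submoduleOf (E.cycles n))

theorem toFreeHomology_surjective (n : ℕ) : Function.Surjective (E.toFreeHomology n) :=
  (Submodule.mkQ_surjective _).comp (Submodule.mkQ_surjective _)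

theorem toFreeHomology_eq_zero_iff {n : ℕ} {z : E.cycles n} :
    E.toFreeHomology n z = 0 ↔ ∃ m : ℤ, m ≠ 0 ∧ m • (z : E.X n) ∈ E.boundaries n := by
  have h1 : E.toFreeHomology n z = 0 ↔
      (Submodule.Quotient.mk z : E.Homology n) ∈ Submodule.torsion ℤ (E.Homology n) :=
    Submodule.Quotient.mk_eq_zero _
  rw [h1, Submodule.mem_torsion_iff]
  constructor
  · rintro ⟨⟨m, hm⟩, h⟩
    exact ⟨m, nonZeroDivisors.ne_zero hm, (Submodule.Quotient.mk_eq_zero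
      ((E.boundaries n).submoduleOf (E.cycles n)) (x := m • z)).1 h⟩
  · rintro ⟨m, hm, h⟩
    exact ⟨⟨m, mem_nonZeroDivisors_of_ne_zero hm⟩, (Submodule.Quotient.mk_eq_zero
      ((E.boundaries n).submoduleOf (E.cycles n)) (x := m • z)).2 h⟩

/-- Half the logarithm of the squared covolume of the cycles. -/
def logVolCycles (n : ℕ) : ℝ := Real.log (covolSq (E.toL2Hom n ∘ₗ (E.cycles n).subtype)) / 2

/-- Half the logarithm of the squared covolume of the saturation of the boundaries. -/
def logVolBoundaries (n : ℕ) : ℝ :=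
  Real.log (covolSq (E.toL2Hom n ∘ₗ (E.cycles n).subtype ∘ₗ
    (LinearMap.ker (E.toFreeHomology n)).subtype)) / 2

theorem logVolCycles_nonneg (n : ℕ) : 0 ≤ E.logVolCycles n :=
  div_nonneg (Real.log_nonneg (E.one_le_covolSq _ (Submodule.subtype_injective _))) zero_le_two

theorem logVolBoundaries_nonneg (n : ℕ) : 0 ≤ E.logVolBoundaries n :=
  div_nonneg (Real.log_nonneg (E.one_le_covolSq ((E.cycles n).subtype ∘ₗ
    (LinearMap.ker (E.toFreeHomology n)).subtype)
    ((Submodule.subtype_injective _).comp (Submodule.subtype_injective _)))) zero_le_two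

theorem logVolCycles_zero : E.logVolCycles 0 = 0 := by
  have hs : Function.Surjective (E.cycles 0).subtype := fun x => ⟨⟨x, trivial⟩, rfl⟩
  have hr : LinearMap.range (E.cycles 0).subtype = ⊤ := LinearMap.range_eq_top.2 hs
  have hsub : Subsingleton (E.X 0 ⧸ LinearMap.range (E.cycles 0).subtype) := by
    rw [Submodule.Quotient.subsingleton_iff]; exact hr
  have h := covolSq_comp_of_finite (E.toL2Hom 0) (E.cycles 0).subtype
    (Submodule.subtype_injective _) inferInstance
  rw [covolSq_toL2Hom, Nat.card_unique] at h
  rw [logVolCycles, h]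
  simp

/-- The canonical map to the harmonic chains, with values in the Hilbert chain module. -/
def freeHomologyToL2 (n : ℕ) : E.FreeHomology n →ₗ[ℤ] E.L2 n :=
  ((E.Harmonic n).subtype.restrictScalars ℤ) ∘ₗ E.freeHomologyToHarmonic n

/-- The cycles are an extension of the free homology by the saturation of the boundaries. By Hodge
theory a cycle differs from its harmonic projection by an element in the complex span of the
boundaries, and that span is orthogonal to the harmonic chains. -/
theorem covolSq_cycles (n : ℕ) : covolSq (E.toL2Hom n ∘ₗ (E.cycles n).subtype) =
    covolSq (E.toL2Hom n ∘ₗ (E.cycles n).subtype ∘ₗ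
      (LinearMap.ker (E.toFreeHomology n)).subtype) * covolSq (E.freeHomologyToL2 n) := by
  have hB : ∀ z : E.cycles n, E.toFreeHomology n z = 0 →
      E.toL2Hom n z ∈ LinearMap.range (E.l2d n) := by
    intro z hz
    obtain ⟨m, hm, x, hx⟩ := E.toFreeHomology_eq_zero_iff.1 hz
    have hm' : (m : ℂ) ≠ 0 := by exact_mod_cast hm
    refine (Submodule.smul_mem_iff _ hm').1 ?_
    rw [Int.cast_smul_eq_zsmul, ← map_smul, ← hx, toL2Hom_d]
    exact ⟨_, rfl⟩
  refine covolSq_eq_mul_ker (E.toL2Hom n ∘ₗ (E.cycles n).subtype) (E.toFreeHomology n)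
    (E.toFreeHomology_surjective n) (E.freeHomologyToL2 n) (fun z => ?_) fun z hz y => ?_
  · have h1 : E.toL2Hom n z - (E.Harmonic n).starProjection (E.toL2Hom n z) ∈
        LinearMap.range (E.l2d n) := by
      refine E.mem_range_l2d_of_mem_l2cycles (sub_mem (Submodule.subset_span ⟨z, z.2, rfl⟩) ?_)
        (Submodule.sub_starProjection_mem_orthogonal _)
      exact (E.mem_harmonic_iff.1 (Submodule.starProjection_apply_mem _ _)).1
    rw [range_l2d] at h1
    refine Submodule.span_mono ?_ h1
    rintro _ ⟨x, hx, rfl⟩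
    refine ⟨⟨x, E.boundaries_le_cycles n hx⟩, E.toFreeHomology_eq_zero_iff.2 ⟨1, one_ne_zero, ?_⟩,
      rfl⟩
    rwa [one_smul]
  · obtain ⟨x, hx⟩ := hB z hz
    change inner ℂ (E.toL2Hom n z) _ = 0
    rw [← hx]
    exact E.inner_l2d_harmonic (E.freeHomologyToHarmonic n y).2 x

theorem covolSq_freeHomologyToL2_ne_zero (n : ℕ) : covolSq (E.freeHomologyToL2 n) ≠ 0 := by
  intro h0
  have h1 := E.covolSq_cycles n
  rw [h0, mul_zero] at h1
  have h2 := E.one_le_covolSq (E.cycles n).subtype (Submodule.subtype_injective _)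
  rw [h1] at h2
  exact absurd h2 (by norm_num)

theorem log_covolSq_freeHomologyToL2 (n : ℕ) :
    Real.log (covolSq (E.freeHomologyToL2 n)) = 2 * E.logDetAlpha n := by
  classical
  let b := Module.Free.chooseBasis ℤ (E.FreeHomology n)
  have h0 : LinearIndependent ℂ fun j => E.freeHomologyToL2 n (b j) :=
    linearIndependent_of_covolSq_ne_zero (E.freeHomologyToL2 n) b
      (E.covolSq_freeHomologyToL2_ne_zero n)
  have h1 := two_mul_logFKDet_constr_submodule (U := E.Harmonic n)
    (v := fun j => E.freeHomologyToHarmonic n (b j)) h0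
  rw [covolSq_eq _ b]
  exact h1.symm

theorem logDetAlpha_eq (n : ℕ) : E.logDetAlpha n = E.logVolCycles n - E.logVolBoundaries n := by
  have h1 := E.log_covolSq_freeHomologyToL2 n
  have h2 := E.one_le_covolSq ((E.cycles n).subtype ∘ₗ
    (LinearMap.ker (E.toFreeHomology n)).subtype)
    ((Submodule.subtype_injective _).comp (Submodule.subtype_injective _))
  have h3 := congrArg Real.log (E.covolSq_cycles n)
  rw [Real.log_mul (zero_lt_one.trans_le h2).ne' (E.covolSq_freeHomologyToL2_ne_zero n), h1] at h3
  rw [logVolCycles, logVolBoundaries]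
  linarith

/-- The quotient of the saturated boundaries by the boundaries is the torsion subgroup of the
homology, so its order is the index of the two lattices. -/
theorem log_covolSq_boundaries (n : ℕ) :
    Real.log (covolSq (E.toL2Hom n ∘ₗ (E.boundaries n).subtype)) =
      2 * (Real.log (torsionOrder (E.Homology n)) + E.logVolBoundaries n) := by
  let S := LinearMap.ker (E.toFreeHomology n)
  let i : E.boundaries n →ₗ[ℤ] S := LinearMap.codRestrict S
    (LinearMap.codRestrict (E.cycles n) (E.boundaries n).subtype
      fun x => E.boundaries_le_cycles n x.2)
    fun x => E.toFreeHomology_eq_zero_iff.2 ⟨1, one_ne_zero, by rw [one_smul]; exact x.2⟩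
  have hi : Function.Injective i := fun x y h =>
    Subtype.ext (congrArg (fun s : S => ((s : E.cycles n) : E.X n)) h)
  let t : S →ₗ[ℤ] E.Homology n := Submodule.mkQ _ ∘ₗ S.subtype
  have ht : LinearMap.range t = Submodule.torsion ℤ (E.Homology n) := by
    ext y
    constructor
    · rintro ⟨⟨z, hz⟩, rfl⟩
      exact (Submodule.Quotient.mk_eq_zero _).1 hz
    · intro hy
      obtain ⟨z, rfl⟩ := Submodule.mkQ_surjective _ y
      exact ⟨⟨z, (Submodule.Quotient.mk_eq_zero _).2 hy⟩, rfl⟩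
  have htk : LinearMap.ker t = LinearMap.range i := by
    ext ⟨z, hz⟩
    constructor
    · intro h
      have h1 : (z : E.X n) ∈ E.boundaries n := (Submodule.Quotient.mk_eq_zero
        ((E.boundaries n).submoduleOf (E.cycles n))).1 h
      exact ⟨⟨z, h1⟩, rfl⟩
    · rintro ⟨x, hx⟩
      have h1 : (z : E.X n) = x := congrArg (fun s : S => ((s : E.cycles n) : E.X n)) hx.symm
      refine (Submodule.Quotient.mk_eq_zero ((E.boundaries n).submoduleOf (E.cycles n))).2 ?_
      change (z : E.X n) ∈ E.boundaries n
      rw [h1]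
      exact x.2
  let e : (S ⧸ LinearMap.range i) ≃ Submodule.torsion ℤ (E.Homology n) :=
    ((Submodule.quotEquivOfEq _ _ htk.symm).trans
      (t.quotKerEquivRange.trans (LinearEquiv.ofEq _ _ ht))).toEquiv
  have hfin : Finite (Submodule.torsion ℤ (E.Homology n)) :=
    Module.finite_of_fg_torsion _ Submodule.torsion_isTorsion
  have hfin' : Finite (S ⧸ LinearMap.range i) := Finite.of_equiv _ e.symm
  have h := covolSq_comp_of_finite (E.toL2Hom n ∘ₗ (E.cycles n).subtype ∘ₗ S.subtype) i hi hfin'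
  rw [Nat.card_congr e] at h
  have h2 := E.one_le_covolSq ((E.cycles n).subtype ∘ₗ S.subtype)
    ((Submodule.subtype_injective _).comp (Submodule.subtype_injective _))
  have h3 : (torsionOrder (E.Homology n) : ℝ) ≠ 0 := by
    exact_mod_cast (Nat.card_pos (α := Submodule.torsion ℤ (E.Homology n))).ne'
  have h4 : Real.log (covolSq (E.toL2Hom n ∘ₗ (E.boundaries n).subtype)) =
      Real.log ((torsionOrder (E.Homology n) : ℝ) ^ 2 *
        covolSq (E.toL2Hom n ∘ₗ (E.cycles n).subtype ∘ₗ S.subtype)) := congrArg Real.log h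
  rw [h4, Real.log_mul (pow_ne_zero 2 h3) (zero_lt_one.trans_le h2).ne', Real.log_pow,
    logVolBoundaries]
  push_cast
  ring

/-- All three terms on the right are nonnegative, so an upper bound on the determinant bounds each
of them separately. -/
theorem logFKDet_l2d_eq (n : ℕ) :
    logFKDet (fun V => (Module.finrank ℂ V : ℝ)) (E.l2d n) =
      Real.log (torsionOrder (E.Homology n)) + E.logVolBoundaries n + E.logVolCycles (n + 1) := by
  have h1 := E.two_mul_logFKDet_l2d n
  rw [log_covolSq_boundaries] at h1
  rw [logVolCycles]
  linarith

end BasedComplex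

end

/-! ### Comparison of regulators along a transfer -/

noncomputable section

theorem card_quotient_le_of_nsmul_mem {M : Type*} [AddCommGroup M] [Module.Free ℤ M]
    [Module.Finite ℤ M] {b : ℕ} (hb : 0 < b) (N : Submodule ℤ M) (h : ∀ x : M, b • x ∈ N) :
    Finite (M ⧸ N) ∧ Nat.card (M ⧸ N) ≤ b ^ Module.finrank ℤ M := by
  let c := Module.finBasis ℤ M
  have h1 : RelGen (Module.finrank ℤ M) ⊥ (⊤ : AddSubgroup (M ⧸ N)) := by
    refine ⟨fun i => N.mkQ (c i), fun z _ => ?_⟩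
    obtain ⟨x, rfl⟩ := N.mkQ_surjective z
    refine ⟨c.repr x, ?_⟩
    rw [AddSubgroup.mem_bot, sub_eq_zero]
    conv_lhs => rw [← c.sum_repr x, map_sum]
    simp only [map_smul]
  have h2 := card_le_of_relGen hb h1 fun x _ => by
    obtain ⟨x, rfl⟩ := N.mkQ_surjective x
    rw [← map_nsmul]
    exact (Submodule.Quotient.mk_eq_zero N).2 (h x)
  have e : (⊤ : AddSubgroup (M ⧸ N)) ≃ M ⧸ N := AddSubgroup.topEquiv.toEquiv
  have := h2.1
  exact ⟨Finite.of_equiv _ e, (Nat.card_congr e).symm.le.trans h2.2⟩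

namespace BasedComplex

theorem toL2Hom_ext (E : BasedComplex.{0, w} ℤ) {n : ℕ} {V : Type*} [AddCommGroup V] [Module ℂ V]
    {f g : E.L2 n →ₗ[ℂ] V} (h : ∀ x, f (E.toL2Hom n x) = g (E.toL2Hom n x)) : f = g := by
  refine LinearMap.ext_on (E.span_range_toL2Hom n) ?_
  rintro _ ⟨x, rfl⟩
  exact h x

theorem finrank_freeHomology_le (E : BasedComplex.{0, w} ℤ) (n : ℕ) :
    Module.finrank ℤ (E.FreeHomology n) ≤ Fintype.card (E.ι n) := by
  refine (LinearMap.finrank_le_finrank_of_surjective (E.toFreeHomology_surjective n)).trans ?_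
  refine (Submodule.finrank_le _).trans ?_
  rw [Module.finrank_fintype_fun_eq_card]

namespace Transfer

variable {E E' : BasedComplex.{0, w} ℤ} {b : ℕ} (T : Transfer E E' b)

open Classical in
/-- The complexification of the chain map of a transfer. -/
def pushL2 (n : ℕ) : E.L2 n →ₗ[ℂ] E'.L2 n :=
  Matrix.toEuclideanLin ((T.P n).map (Int.cast : ℤ → ℂ)).transpose

theorem pushL2_toL2Hom (n : ℕ) (x : E.X n) :
    T.pushL2 n (E.toL2Hom n x) = E'.toL2Hom n (T.push n x) := by
  ext c
  simp [toL2Hom, toL2, push, pushL2, Matrix.toEuclideanLin, Matrix.toLpLin_apply, Matrix.vecMul,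
    Matrix.mulVec, dotProduct, mul_comm]

theorem adjoint_pushL2_toL2Hom (n : ℕ) (y : E'.X n) :
    LinearMap.adjoint (T.pushL2 n) (E'.toL2Hom n y) = E.toL2Hom n (T.pull n y) := by
  classical
  have h : LinearMap.adjoint (T.pushL2 n) =
      Matrix.toEuclideanLin ((T.P n).map (Int.cast : ℤ → ℂ)) := by
    rw [pushL2, ← Matrix.toEuclideanLin_conjTranspose_eq_adjoint]
    congr 1
    ext i j
    simp
  rw [h]
  ext c
  simp [toL2Hom, toL2, pull, Matrix.toEuclideanLin, Matrix.toLpLin_apply, Matrix.mulVec,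
    dotProduct, mul_comm]

theorem pushL2_l2d (n : ℕ) : T.pushL2 n ∘ₗ E.l2d n = E'.l2d n ∘ₗ T.pushL2 (n + 1) :=
  E.toL2Hom_ext fun x => by
    simp only [LinearMap.comp_apply]
    rw [← toL2Hom_d, pushL2_toL2Hom, push_d, toL2Hom_d, pushL2_toL2Hom]

theorem adjoint_pushL2_l2d (n : ℕ) : LinearMap.adjoint (T.pushL2 n) ∘ₗ E'.l2d n =
    E.l2d n ∘ₗ LinearMap.adjoint (T.pushL2 (n + 1)) :=
  E'.toL2Hom_ext fun x => by
    simp only [LinearMap.comp_apply]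
    rw [← toL2Hom_d, adjoint_pushL2_toL2Hom, pull_d, toL2Hom_d, adjoint_pushL2_toL2Hom]

theorem pushL2_mem_harmonic {n : ℕ} {u : E.L2 n} (hu : u ∈ E.Harmonic n) :
    T.pushL2 n u ∈ E'.Harmonic n := by
  obtain ⟨h1, h2⟩ := E.mem_harmonic_iff.1 hu
  refine E'.mem_harmonic_iff.2 ⟨?_, ?_⟩
  · have h3 : T.pushL2 n u ∈ (E.l2cycles n).map (T.pushL2 n) := ⟨u, h1, rfl⟩
    rw [l2cycles, Submodule.map_span] at h3
    refine Submodule.span_mono ?_ h3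
    rintro _ ⟨_, ⟨x, hx, rfl⟩, rfl⟩
    exact ⟨_, T.push_mem_cycles hx, (T.pushL2_toL2Hom n x).symm⟩
  · have h3 := congrArg LinearMap.adjoint (T.adjoint_pushL2_l2d n)
    rw [LinearMap.adjoint_comp, LinearMap.adjoint_comp, LinearMap.adjoint_adjoint,
      LinearMap.adjoint_adjoint] at h3
    have h4 := LinearMap.congr_fun h3 u
    rw [LinearMap.comp_apply, LinearMap.comp_apply, h2, map_zero] at h4
    exact h4

theorem adjoint_pushL2_mem_harmonic {n : ℕ} {u : E'.L2 n} (hu : u ∈ E'.Harmonic n) :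
    LinearMap.adjoint (T.pushL2 n) u ∈ E.Harmonic n := by
  obtain ⟨h1, h2⟩ := E'.mem_harmonic_iff.1 hu
  refine E.mem_harmonic_iff.2 ⟨?_, ?_⟩
  · have h3 : LinearMap.adjoint (T.pushL2 n) u ∈
        (E'.l2cycles n).map (LinearMap.adjoint (T.pushL2 n)) := ⟨u, h1, rfl⟩
    rw [l2cycles, Submodule.map_span] at h3
    refine Submodule.span_mono ?_ h3
    rintro _ ⟨_, ⟨x, hx, rfl⟩, rfl⟩
    exact ⟨_, T.pull_mem_cycles hx, (T.adjoint_pushL2_toL2Hom n x).symm⟩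
  · have h3 := congrArg LinearMap.adjoint (T.pushL2_l2d n)
    rw [LinearMap.adjoint_comp, LinearMap.adjoint_comp] at h3
    have h4 := LinearMap.congr_fun h3 u
    rw [LinearMap.comp_apply, LinearMap.comp_apply, h2, map_zero] at h4
    exact h4

end Transfer

/-- If the adjoint maps `U'` into `U`, then `f` maps the orthogonal complement of `U` into that of
`U'`. -/
theorem map_starProjection_eq {V W : Type*} [NormedAddCommGroup V] [InnerProductSpace ℂ V]
    [FiniteDimensional ℂ V] [NormedAddCommGroup W] [InnerProductSpace ℂ W]
    [FiniteDimensional ℂ W] (f : V →ₗ[ℂ] W) {U : Submodule ℂ V} {U' : Submodule ℂ W}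
    (h : ∀ x ∈ U, f x ∈ U') (h' : ∀ y ∈ U', LinearMap.adjoint f y ∈ U) (x : V) :
    f (U.starProjection x) = U'.starProjection (f x) := by
  refine (Submodule.eq_starProjection_of_mem_orthogonal
    (h _ (Submodule.starProjection_apply_mem _ _)) ?_).symm
  rw [← map_sub]
  refine (Submodule.mem_orthogonal _ _).2 fun y hy => ?_
  rw [← LinearMap.adjoint_inner_left]
  exact (Submodule.mem_orthogonal _ _).1 (U.sub_starProjection_mem_orthogonal x) _ (h' y hy)

namespace Transfer

variable {E E' : BasedComplex.{0, w} ℤ} {b : ℕ} (T : Transfer E E' b)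

theorem exists_pushFreeHomology (n : ℕ) : ∃ p : E.FreeHomology n →ₗ[ℤ] E'.FreeHomology n,
    ∀ z : E.cycles n, p (E.toFreeHomology n z) =
      E'.toFreeHomology n ⟨T.push n z, T.push_mem_cycles z.2⟩ := by
  refine ⟨Submodule.mapQ _ _ (T.pushHomology n) ?_, fun z => rfl⟩
  rintro x ⟨a, ha⟩
  refine ⟨a, ?_⟩
  have h : (a : ℤ) • x = 0 := ha
  change (a : ℤ) • T.pushHomology n x = 0
  rw [← map_smul, h, map_zero]

-- The push-forward is injective on free homology, because its kernel is killed by a power of `b`.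
-- It scales inner products by `b`, because `pull ∘ push` is multiplication by `b` modulo torsion.
-- Its cokernel is killed by `b`, hence has order at most `b` to the rank. Both ranks are bounded by
-- the chain rank of the target `E'`.
variable {T} in
theorem KerBound.abs_logDetAlpha_le {n r : ℕ} (hb : 0 < b) (h : T.KerBound n r) :
    |E.logDetAlpha n| ≤ |E'.logDetAlpha n| + 2 * Fintype.card (E'.ι n) * Real.log b := by
  obtain ⟨p, hp⟩ := T.exists_pushFreeHomology n
  have hpush : ∀ z : E.cycles n, E'.freeHomologyToL2 n (p (E.toFreeHomology n z)) =
      T.pushL2 n (E.freeHomologyToL2 n (E.toFreeHomology n z)) := by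
    intro z
    rw [hp]
    change (E'.Harmonic n).starProjection (E'.toL2Hom n (T.push n z)) =
      T.pushL2 n ((E.Harmonic n).starProjection (E.toL2Hom n z))
    rw [map_starProjection_eq (T.pushL2 n) (fun _ => T.pushL2_mem_harmonic)
      fun _ => T.adjoint_pushL2_mem_harmonic, pushL2_toL2Hom]
  have hpull : ∀ z : E'.cycles n,
      LinearMap.adjoint (T.pushL2 n) (E'.freeHomologyToL2 n (E'.toFreeHomology n z)) =
      E.freeHomologyToL2 n (E.toFreeHomology n ⟨T.pull n z, T.pull_mem_cycles z.2⟩) := by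
    intro z
    change LinearMap.adjoint (T.pushL2 n) ((E'.Harmonic n).starProjection (E'.toL2Hom n z)) =
      (E.Harmonic n).starProjection (E.toL2Hom n (T.pull n z))
    rw [map_starProjection_eq (LinearMap.adjoint (T.pushL2 n))
      (fun _ => T.adjoint_pushL2_mem_harmonic) fun _ hx => by
        rw [LinearMap.adjoint_adjoint]; exact T.pushL2_mem_harmonic hx, adjoint_pushL2_toL2Hom]
  have hb0 : ∀ k, (b : ℤ) ^ k ≠ 0 := fun k => pow_ne_zero _ (by exact_mod_cast hb.ne')
  have hpp : ∀ z : E.cycles n,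
      E.toFreeHomology n ⟨T.pull n (T.push n z), T.pull_mem_cycles (T.push_mem_cycles z.2)⟩ =
        b • E.toFreeHomology n z := by
    intro z
    rw [← map_nsmul, ← sub_eq_zero, ← map_sub]
    refine E.toFreeHomology_eq_zero_iff.2 ⟨(b : ℤ) ^ r, hb0 r, ?_⟩
    -- This cycle is killed by the push-forward, so `KerBound` shows that its class is torsion.
    have h1 := h (T.pull n (T.push n z) - b • (z : E.X n))
      (sub_mem (T.pull_mem_cycles (T.push_mem_cycles z.2)) (nsmul_mem z.2 b))
      (by rw [map_sub, T.push_pull, map_nsmul, sub_self]; exact zero_mem _)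
    rw [← Nat.cast_pow, natCast_zsmul]
    exact h1
  have hinner : ∀ x y, inner ℂ ((E'.freeHomologyToL2 n ∘ₗ p) x) ((E'.freeHomologyToL2 n ∘ₗ p) y) =
      ((b : ℝ) : ℂ) * inner ℂ (E.freeHomologyToL2 n x) (E.freeHomologyToL2 n y) := by
    intro x y
    obtain ⟨x, rfl⟩ := E.toFreeHomology_surjective n x
    obtain ⟨y, rfl⟩ := E.toFreeHomology_surjective n y
    rw [LinearMap.comp_apply, LinearMap.comp_apply, hpush y, ← LinearMap.adjoint_inner_left, hp,
      hpull, hpp, map_nsmul, ← Nat.cast_smul_eq_nsmul ℂ, inner_smul_left]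
    simp
  have hinj : Function.Injective p := by
    rw [← LinearMap.ker_eq_bot, LinearMap.ker_eq_bot']
    intro x hx
    obtain ⟨z, rfl⟩ := E.toFreeHomology_surjective n x
    rw [hp, toFreeHomology_eq_zero_iff] at hx
    obtain ⟨m, hm, hx⟩ := hx
    refine E.toFreeHomology_eq_zero_iff.2 ⟨(b : ℤ) ^ r * m, mul_ne_zero (hb0 r) hm, ?_⟩
    have h1 := h (m • (z : E.X n)) (Submodule.smul_mem _ _ z.2) (by rw [map_smul]; exact hx)
    rw [mul_smul, ← Nat.cast_pow, natCast_zsmul]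
    exact h1
  obtain ⟨hfin, hcard⟩ := card_quotient_le_of_nsmul_mem hb (LinearMap.range p) fun y => by
    obtain ⟨z, rfl⟩ := E'.toFreeHomology_surjective n y
    refine ⟨E.toFreeHomology n ⟨T.pull n z, T.pull_mem_cycles z.2⟩, ?_⟩
    rw [hp, ← map_nsmul]
    congr 1
    exact Subtype.ext (T.push_pull n z)
  have h1 := covolSq_comp_of_finite (E'.freeHomologyToL2 n) p hinj hfin
  rw [covolSq_of_inner_eq (E.freeHomologyToL2 n) (E'.freeHomologyToL2 n ∘ₗ p) b
    (Nat.cast_nonneg b) hinner] at h1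
  set c := Nat.card (E'.FreeHomology n ⧸ LinearMap.range p) with hc
  have hc0 : 0 < c := Nat.card_pos
  have hbR : (0 : ℝ) < b := by exact_mod_cast hb
  have h2 := congrArg Real.log h1
  rw [Real.log_mul (pow_pos hbR _).ne' (E.covolSq_freeHomologyToL2_ne_zero n),
    Real.log_mul (pow_pos (by exact_mod_cast hc0) _).ne' (E'.covolSq_freeHomologyToL2_ne_zero n),
    log_covolSq_freeHomologyToL2, log_covolSq_freeHomologyToL2, Real.log_pow, Real.log_pow] at h2
  have hlb : 0 ≤ Real.log b := Real.log_natCast_nonneg b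
  have hr' : (Module.finrank ℤ (E'.FreeHomology n) : ℝ) ≤ Fintype.card (E'.ι n) := by
    exact_mod_cast E'.finrank_freeHomology_le n
  have hr : (Module.finrank ℤ (E.FreeHomology n) : ℝ) ≤ Fintype.card (E'.ι n) := by
    refine le_trans ?_ hr'
    exact_mod_cast LinearMap.finrank_le_finrank_of_injective hinj
  have h3 : 0 ≤ Real.log c := Real.log_natCast_nonneg c
  have h4 : Real.log c ≤ Fintype.card (E'.ι n) * Real.log b := by
    refine (Real.log_le_log (by exact_mod_cast hc0) (y := (b : ℝ) ^
      Module.finrank ℤ (E'.FreeHomology n)) (by exact_mod_cast hcard)).trans ?_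
    rw [Real.log_pow]
    exact mul_le_mul_of_nonneg_right hr' hlb
  have h5 := mul_le_mul_of_nonneg_right hr hlb
  have h6 : 0 ≤ (Module.finrank ℤ (E.FreeHomology n) : ℝ) * Real.log b :=
    mul_nonneg (Nat.cast_nonneg _) hlb
  push_cast at h2
  have h7 := neg_abs_le (E'.logDetAlpha n)
  have h8 := le_abs_self (E'.logDetAlpha n)
  rw [abs_le]
  constructor <;> nlinarith

end Transfer

end BasedComplex

end

/-! ### Norm bounds independent of the level and their consequences -/

noncomputable section

/-- Schur's test. -/
theorem norm_toEuclideanLin_transpose_le {α β : Type*} [Fintype α] [DecidableEq α] [Fintype β]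
    (M : Matrix α β ℤ) {L : ℝ} (hL : 0 ≤ L) (h1 : ∀ p, ∑ q, |(M p q : ℝ)| ≤ L)
    (h2 : ∀ q, ∑ p, |(M p q : ℝ)| ≤ L) (x : EuclideanSpace ℂ α) :
    ‖Matrix.toEuclideanLin (M.map (Int.cast : ℤ → ℂ)).transpose x‖ ≤ L * ‖x‖ := by
  refine le_of_sq_le_sq ?_ (mul_nonneg hL (norm_nonneg _))
  rw [mul_pow, EuclideanSpace.norm_sq_eq, EuclideanSpace.norm_sq_eq]
  have h3 : ∀ q, ‖Matrix.toEuclideanLin (M.map (Int.cast : ℤ → ℂ)).transpose x q‖ ^ 2 ≤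
      L * ∑ p, |(M p q : ℝ)| * ‖x p‖ ^ 2 := by
    intro q
    have h4 : ‖Matrix.toEuclideanLin (M.map (Int.cast : ℤ → ℂ)).transpose x q‖ ≤
        ∑ p, |(M p q : ℝ)| * ‖x p‖ := by
      have : Matrix.toEuclideanLin (M.map (Int.cast : ℤ → ℂ)).transpose x q =
          ∑ p, (M p q : ℂ) * x p := rfl
      rw [this]
      refine (norm_sum_le _ _).trans (Finset.sum_le_sum fun p _ => ?_)
      rw [norm_mul, Complex.norm_intCast]
    refine (pow_le_pow_left₀ (norm_nonneg _) h4 2).trans ?_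
    -- Cauchy–Schwarz with the weights `|M p q|`: column sums are used here, row sums after
    -- exchanging the order of summation.
    refine (Finset.sum_sq_le_sum_mul_sum_of_sq_le_mul Finset.univ
      (f := fun p => |(M p q : ℝ)|) (g := fun p => |(M p q : ℝ)| * ‖x p‖ ^ 2)
      (fun p _ => abs_nonneg _) (fun p _ => by positivity) fun p _ =>
        le_of_eq (by ring)).trans ?_
    exact mul_le_mul_of_nonneg_right (h2 q) (Finset.sum_nonneg fun p _ => by positivity)
  refine (Finset.sum_le_sum fun q _ => h3 q).trans ?_
  rw [← Finset.mul_sum, Finset.sum_comm, sq, mul_assoc]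
  refine mul_le_mul_of_nonneg_left ?_ hL
  rw [Finset.mul_sum]
  refine Finset.sum_le_sum fun p _ => ?_
  rw [← Finset.sum_mul]
  exact mul_le_mul_of_nonneg_right (h1 p) (by positivity)

theorem sum_abs_coeff_mapDomain_le {G Q : Type*} [Fintype Q] (q : G → Q) (z : MonoidAlgebra ℤ G) :
    ∑ h, |((MonoidAlgebra.mapDomain q z).coeff h : ℝ)| ≤
      ∑ g ∈ z.coeff.support, |(z.coeff g : ℝ)| := by
  classical
  have h1 : ∀ h, |((MonoidAlgebra.mapDomain q z).coeff h : ℝ)| ≤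
      ∑ g ∈ z.coeff.support, if q g = h then |(z.coeff g : ℝ)| else 0 := by
    intro h
    rw [MonoidAlgebra.coeff_mapDomain, Finsupp.mapDomain, Finsupp.sum, Finsupp.finsetSum_apply]
    push_cast
    refine (Finset.abs_sum_le_sum_abs _ _).trans (Finset.sum_le_sum fun g _ => ?_)
    rw [Finsupp.single_apply]
    split_ifs <;> simp
  refine (Finset.sum_le_sum fun h _ => h1 h).trans ?_
  rw [Finset.sum_comm]
  refine Finset.sum_le_sum fun g _ => ?_
  simp

namespace BasedComplex

/-- Reduction to a quotient group does not increase the `ℓ¹`-norm of a group ring element. Hence the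
row and column sums at every level are bounded by the total `ℓ¹`-norm of the original matrix. -/
theorem norm_l2d_le {G : Type u} [Group G] (D : BasedComplex.{u, w} (MonoidAlgebra ℤ G)) (n : ℕ) :
    ∃ K : ℝ, 1 ≤ K ∧ ∀ (N : Subgroup G) [N.Normal] [N.FiniteIndex] (x : (D.intLevel N).L2 (n + 1)),
      ‖(D.intLevel N).l2d n x‖ ≤ K * ‖x‖ := by
  classical
  let s : D.ι (n + 1) → D.ι n → ℝ :=
    fun a c => ∑ g ∈ (D.mat n a c).coeff.support, |((D.mat n a c).coeff g : ℝ)|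
  have hs : ∀ a c, 0 ≤ s a c := fun a c => Finset.sum_nonneg fun _ _ => abs_nonneg _
  let L : ℝ := ∑ a, ∑ c, s a c
  have hL : 0 ≤ L := Finset.sum_nonneg fun a _ => Finset.sum_nonneg fun c _ => hs a c
  have hrow : ∀ a, ∑ c, s a c ≤ L := fun a =>
    Finset.single_le_sum (f := fun a => ∑ c, s a c)
      (fun a _ => Finset.sum_nonneg fun c _ => hs a c) (Finset.mem_univ a)
  have hcol : ∀ c, ∑ a, s a c ≤ L := fun c => by
    refine Finset.sum_le_sum fun a _ => ?_
    exact Finset.single_le_sum (f := fun c => s a c) (fun c _ => hs a c) (Finset.mem_univ c)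
  refine ⟨1 + L, by linarith, fun N _ _ x => ?_⟩
  let _ := Fintype.ofFinite (G ⧸ N)
  have hz : ∀ a c, ∑ h, |(((D.level N).mat n a c).coeff h : ℝ)| ≤ s a c :=
    fun a c => sum_abs_coeff_mapDomain_le _ _
  refine (norm_toEuclideanLin_transpose_le ((D.intLevel N).mat n) hL ?_ ?_ x).trans
    (mul_le_mul_of_nonneg_right (by linarith) (norm_nonneg _))
  · rintro ⟨(a : D.ι (n + 1)), g⟩
    have h1 : ∑ q, |(((D.intLevel N).mat n (a, g) q : ℤ) : ℝ)| =
        ∑ q : D.ι n × (G ⧸ N), |(((D.level N).mat n a q.1).coeff (g⁻¹ * q.2) : ℝ)| :=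
      Finset.sum_congr (congrArg (fun i : Fintype _ => @Finset.univ _ i)
        (Subsingleton.elim _ _)) fun _ _ => rfl
    refine h1.le.trans (le_trans ?_ (hrow a))
    rw [Fintype.sum_prod_type]
    refine Finset.sum_le_sum fun c _ => le_trans (le_of_eq ?_) (hz a c)
    exact Equiv.sum_comp (Equiv.mulLeft g⁻¹) fun h => |(((D.level N).mat n a c).coeff h : ℝ)|
  · rintro ⟨(c : D.ι n), k⟩
    have h1 : ∑ p, |(((D.intLevel N).mat n p (c, k) : ℤ) : ℝ)| =
        ∑ p : D.ι (n + 1) × (G ⧸ N), |(((D.level N).mat n p.1 c).coeff (p.2⁻¹ * k) : ℝ)| :=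
      Finset.sum_congr (congrArg (fun i : Fintype _ => @Finset.univ _ i)
        (Subsingleton.elim _ _)) fun _ _ => rfl
    refine h1.le.trans (le_trans ?_ (hcol c))
    rw [Fintype.sum_prod_type]
    refine Finset.sum_le_sum fun a _ => le_trans (le_of_eq ?_) (hz a c)
    exact Equiv.sum_comp ((Equiv.inv _).trans (Equiv.mulRight k))
      fun h => |(((D.level N).mat n a c).coeff h : ℝ)|

section Integers

variable (E : BasedComplex.{0, w} ℤ)

theorem log_torsionOrder_nonneg (n : ℕ) : 0 ≤ Real.log (torsionOrder (E.Homology n)) :=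
  Real.log_natCast_nonneg _

theorem logFKDet_l2d_le {K : ℝ} (hK : 1 ≤ K) {n : ℕ} (h : ∀ x, ‖E.l2d n x‖ ≤ K * ‖x‖) :
    Real.log (torsionOrder (E.Homology n)) + E.logVolBoundaries n + E.logVolCycles (n + 1) ≤
      Fintype.card (E.ι (n + 1)) * Real.log K := by
  rw [← logFKDet_l2d_eq]
  refine (logFKDet_finrank_le (E.l2d n) hK h).trans_eq ?_
  rw [finrank_euclideanSpace]

theorem log_torsionOrder_le {K : ℝ} (hK : 1 ≤ K) {n : ℕ} (h : ∀ x, ‖E.l2d n x‖ ≤ K * ‖x‖) :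
    Real.log (torsionOrder (E.Homology n)) ≤ Fintype.card (E.ι (n + 1)) * Real.log K := by
  have h1 := E.logFKDet_l2d_le hK h
  have h2 := E.logVolBoundaries_nonneg n
  have h3 := E.logVolCycles_nonneg (n + 1)
  linarith

theorem abs_logDetAlpha_zero_le {K : ℝ} (hK : 1 ≤ K) (h : ∀ x, ‖E.l2d 0 x‖ ≤ K * ‖x‖) :
    |E.logDetAlpha 0| ≤ Fintype.card (E.ι 1) * Real.log K := by
  have h1 := E.logFKDet_l2d_le hK h
  have h2 := E.logVolBoundaries_nonneg 0
  have h3 := E.logVolCycles_nonneg 1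
  have h4 := E.log_torsionOrder_nonneg 0
  rw [logDetAlpha_eq, logVolCycles_zero, zero_sub, abs_neg, abs_of_nonneg h2]
  rw [zero_add] at h1
  linarith

theorem abs_logDetAlpha_succ_le {K K' : ℝ} (hK : 1 ≤ K) (hK' : 1 ≤ K') {n : ℕ}
    (h : ∀ x, ‖E.l2d n x‖ ≤ K * ‖x‖) (h' : ∀ x, ‖E.l2d (n + 1) x‖ ≤ K' * ‖x‖) :
    |E.logDetAlpha (n + 1)| ≤ Fintype.card (E.ι (n + 1)) * Real.log K +
      Fintype.card (E.ι (n + 2)) * Real.log K' := by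
  have h1 := E.logFKDet_l2d_le hK h
  have h2 := E.logVolBoundaries_nonneg n
  have h3 := E.logVolCycles_nonneg (n + 1)
  have h4 := E.log_torsionOrder_nonneg n
  have h1' := E.logFKDet_l2d_le hK' h'
  have h2' := E.logVolBoundaries_nonneg (n + 1)
  have h3' := E.logVolCycles_nonneg (n + 2)
  have h4' := E.log_torsionOrder_nonneg (n + 1)
  have e : n + 1 + 1 = n + 2 := rfl
  rw [e] at h1'
  rw [logDetAlpha_eq, abs_le]
  constructor <;> linarith

/-- Replacing the volume of the boundaries by that of the cycles minus the regulator makes the cycle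
volumes occur in pairs of opposite sign. Only the last survives, as the volume in degree `0`
vanishes. -/
theorem sum_logFKDet_l2d (M : ℕ) :
    ∑ n ∈ Finset.range M, (-1 : ℝ) ^ n * logFKDet (fun V => (Module.finrank ℂ V : ℝ)) (E.l2d n) =
      ∑ n ∈ Finset.range M, (-1 : ℝ) ^ n * (Real.log (torsionOrder (E.Homology n)) -
        E.logDetAlpha n) - (-1) ^ M * E.logVolCycles M := by
  induction M with
  | zero => simp [logVolCycles_zero]
  | succ M ih =>
    rw [Finset.sum_range_succ, Finset.sum_range_succ, ih, logFKDet_l2d_eq, logDetAlpha_eq, pow_succ]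
    ring

theorem logFKDet_l2d_of_isEmpty {n : ℕ} (h : IsEmpty (E.ι (n + 1))) :
    logFKDet (fun V => (Module.finrank ℂ V : ℝ)) (E.l2d n) = 0 := by
  rw [logFKDet_finrank_eq]
  have : IsEmpty (Fin (Module.finrank ℂ (E.L2 (n + 1)))) := by
    rw [finrank_euclideanSpace, Fintype.card_eq_zero]
    infer_instance
  exact Finset.sum_of_isEmpty _

theorem logVolCycles_of_isEmpty {n : ℕ} (h : IsEmpty (E.ι n)) : E.logVolCycles n = 0 := by
  cases n with
  | zero => exact E.logVolCycles_zero
  | succ n =>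
    have h1 := E.logFKDet_l2d_eq n
    rw [E.logFKDet_l2d_of_isEmpty h] at h1
    have h2 := E.logVolBoundaries_nonneg n
    have h3 := E.logVolCycles_nonneg (n + 1)
    have h4 := E.log_torsionOrder_nonneg n
    linarith

end Integers

end BasedComplex

end

/-! ### Von Neumann dimensions and the torsion invariants -/

noncomputable section

namespace BasedComplex

section VonNeumann

variable {Γ : Type v} [Group Γ] [Finite Γ] (D : BasedComplex.{v, w} (MonoidAlgebra ℤ Γ))

/-- The left translation by a group element on the Hilbert chain modules. -/
def translateL2 (n : ℕ) (g : Γ) : D.underlying.L2 n ≃ₗᵢ[ℂ] D.underlying.L2 n :=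
  LinearIsometryEquiv.piLpCongrLeft 2 ℂ ℂ
    (show D.underlying.ι n ≃ D.underlying.ι n from
      (Equiv.prodCongr (Equiv.refl (D.ι n)) (Equiv.mulLeft g)))

theorem translateL2_toL2Hom (n : ℕ) (g : Γ) (x : D.underlying.X n) :
    D.translateL2 n g (D.underlying.toL2Hom n x) =
      D.underlying.toL2Hom n (D.translate n g x) := rfl

theorem d_translate (n : ℕ) (g : Γ) (x : D.underlying.X (n + 1)) :
    D.underlying.d n (D.translate (n + 1) g x) = D.translate n g (D.underlying.d n x) := by
  obtain ⟨y, rfl⟩ := (D.toUnderlying (n + 1)).surjective x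
  rw [← toUnderlying_of_smul, ← toUnderlying_d, ← toUnderlying_d, map_smul, toUnderlying_of_smul]

theorem l2d_translateL2 (n : ℕ) (g : Γ) (x : D.underlying.L2 (n + 1)) :
    D.underlying.l2d n (D.translateL2 (n + 1) g x) = D.translateL2 n g (D.underlying.l2d n x) := by
  have h : D.underlying.l2d n ∘ₗ (D.translateL2 (n + 1) g).toLinearEquiv.toLinearMap =
      (D.translateL2 n g).toLinearEquiv.toLinearMap ∘ₗ D.underlying.l2d n :=
    D.underlying.toL2Hom_ext fun x => by
      change D.underlying.l2d n (D.translateL2 (n + 1) g (D.underlying.toL2Hom (n + 1) x)) =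
        D.translateL2 n g (D.underlying.l2d n (D.underlying.toL2Hom (n + 1) x))
      rw [translateL2_toL2Hom, ← toL2Hom_d, ← toL2Hom_d, translateL2_toL2Hom, d_translate]
  exact LinearMap.congr_fun h x

theorem adjoint_l2d_translateL2 (n : ℕ) (g : Γ) (y : D.underlying.L2 n) :
    LinearMap.adjoint (D.underlying.l2d n) (D.translateL2 n g y) =
      D.translateL2 (n + 1) g (LinearMap.adjoint (D.underlying.l2d n) y) := by
  refine ext_inner_left ℂ fun z => ?_
  obtain ⟨x, rfl⟩ := (D.translateL2 (n + 1) g).surjective z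
  rw [LinearMap.adjoint_inner_right, l2d_translateL2, LinearIsometryEquiv.inner_map_map,
    LinearIsometryEquiv.inner_map_map, LinearMap.adjoint_inner_right]

/-- The von Neumann dimension of an invariant subspace. -/
theorem card_mul_vnDim {n : ℕ} {V : Submodule ℂ (D.underlying.L2 n)}
    (hV : ∀ g, ∀ x ∈ V, D.translateL2 n g x ∈ V) :
    (Nat.card Γ : ℝ) * D.vnDim n V = Module.finrank ℂ V := by
  classical
  let _ := Fintype.ofFinite Γ
  let B := EuclideanSpace.basisFun (D.underlying.ι n) ℂ
  have hcomm : ∀ g x, D.translateL2 n g (V.starProjection x) =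
      V.starProjection (D.translateL2 n g x) := by
    intro g x
    refine map_starProjection_eq (D.translateL2 n g).toLinearEquiv.toLinearMap (hV g) ?_ x
    intro y hy
    have h1 : LinearMap.adjoint (D.translateL2 n g).toLinearEquiv.toLinearMap y =
        D.translateL2 n g⁻¹ y := by
      refine ext_inner_left ℂ fun z => ?_
      rw [LinearMap.adjoint_inner_right]
      have h2 : y = D.translateL2 n g (D.translateL2 n g⁻¹ y) := by
        ext p
        obtain ⟨(a : D.ι n), k⟩ := p
        change y (a, k) = y (a, g⁻¹⁻¹ * (g⁻¹ * k))
        rw [inv_inv, mul_inv_cancel_left]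
      conv_lhs => rw [h2]
      exact (D.translateL2 n g).inner_map_map _ _
    rw [h1]
    exact hV _ _ hy
  have hB0 : ∀ i j : D.underlying.ι n, B i j = if j = i then 1 else 0 := fun i j => by
    rw [EuclideanSpace.basisFun_apply, PiLp.single_apply]
  have hB : ∀ a g, B (a, g) = D.translateL2 n g (B (D.unitIndex n a)) := by
    intro a g
    ext p
    obtain ⟨(c : D.ι n), k⟩ := p
    have h3 : D.translateL2 n g (B (D.unitIndex n a)) (c, k) =
        B (D.unitIndex n a) (c, g⁻¹ * k) := rfl
    refine (hB0 (a, g) (c, k)).trans (Eq.trans ?_ (h3.trans (hB0 _ (c, g⁻¹ * k))).symm)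
    have h4 : ((c, k) : D.underlying.ι n) = (a, g) ↔
        ((c, g⁻¹ * k) : D.underlying.ι n) = D.unitIndex n a := by
      change ((c, k) : D.ι n × Γ) = (a, g) ↔ ((c, g⁻¹ * k) : D.ι n × Γ) = (a, 1)
      simp only [Prod.mk.injEq, inv_mul_eq_one, eq_comm]
    exact if_congr h4 rfl rfl
  have hproj : LinearMap.IsProj V (V.starProjection : D.underlying.L2 n →ₗ[ℂ] D.underlying.L2 n) :=
    ⟨fun x => Submodule.starProjection_apply_mem V x,
      fun x hx => Submodule.starProjection_eq_self_iff.2 hx⟩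
  -- The dimension of `V` is the trace of its projection. The projection commutes with translations,
  -- so the diagonal entries are constant along each orbit `(a, g)` with `g : Γ`.
  have htr := hproj.trace
  rw [LinearMap.trace_eq_sum_inner _ B] at htr
  have hsum : ∑ p, inner ℂ (B p) (V.starProjection (B p)) =
      ∑ p : D.ι n × Γ, inner ℂ (B p) (V.starProjection (B p)) :=
    Finset.sum_congr (congrArg (fun i : Fintype _ => @Finset.univ _ i)
        (Subsingleton.elim _ _)) fun _ _ => rfl
  have h5 : ∑ p : D.ι n × Γ, inner ℂ (B p) (V.starProjection (B p)) =
      (Nat.card Γ : ℂ) * ∑ a : D.ι n,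
        inner ℂ (B (D.unitIndex n a)) (V.starProjection (B (D.unitIndex n a))) := by
    rw [Fintype.sum_prod_type, Finset.mul_sum]
    refine Finset.sum_congr rfl fun a _ => ?_
    have h6 : ∀ g : Γ, inner ℂ (B (a, g)) (V.starProjection (B (a, g))) =
        inner ℂ (B (D.unitIndex n a)) (V.starProjection (B (D.unitIndex n a))) := by
      intro g
      rw [hB, ← hcomm, LinearIsometryEquiv.inner_map_map]
    rw [Finset.sum_congr rfl fun g _ => h6 g, Finset.sum_const, Finset.card_univ, nsmul_eq_mul,
      Nat.card_eq_fintype_card]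
  have h7 := congrArg Complex.re (h5.symm.trans (hsum.symm.trans htr))
  rw [← Complex.ofReal_natCast, Complex.re_ofReal_mul, Complex.re_sum, Complex.natCast_re] at h7
  rw [← h7, vnDim]
  congr 1

/-- The eigenspaces are translation invariant since the differential and its adjoint are
equivariant; so both dimension functions differ on them by the factor `|Γ|`. -/
theorem logFKDet_vnDim (n : ℕ) : (Nat.card Γ : ℝ) * logFKDet (D.vnDim (n + 1)) (D.underlying.l2d n) =
    logFKDet (fun V => (Module.finrank ℂ V : ℝ)) (D.underlying.l2d n) := by
  rw [logFKDet, logFKDet, ← smul_eq_mul, smul_finsum]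
  refine finsum_congr fun t => ?_
  rw [smul_eq_mul, mul_left_comm, card_mul_vnDim]
  intro g x hx
  rw [Module.End.mem_eigenspace_iff] at hx ⊢
  rw [LinearMap.comp_apply] at hx ⊢
  rw [l2d_translateL2, adjoint_l2d_translateL2, hx, map_smul]

theorem card_mul_l2Torsion {M : ℕ} (hM : ∀ n, M ≤ n → IsEmpty (D.ι n)) :
    (Nat.card Γ : ℝ) * D.l2Torsion = ∑ n ∈ Finset.range M, (-1 : ℝ) ^ n *
      (Real.log (torsionOrder (D.underlying.Homology n)) - D.underlying.logDetAlpha n) := by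
  have hM' : ∀ n, M ≤ n → IsEmpty (D.underlying.ι n) := fun n hn => by
    have := hM n hn
    exact inferInstanceAs (IsEmpty (D.ι n × Γ))
  have h1 := D.underlying.sum_logFKDet_l2d M
  rw [D.underlying.logVolCycles_of_isEmpty (hM' M le_rfl), mul_zero, sub_zero] at h1
  rw [← h1, l2Torsion, ← finsum_neg_distrib, ← smul_eq_mul, smul_finsum]
  have h2 : ∀ n, (Nat.card Γ : ℝ) • -((-1 : ℝ) ^ (n + 1) *
      logFKDet (D.vnDim (n + 1)) (D.underlying.l2d n)) =
      (-1 : ℝ) ^ n * logFKDet (fun V => (Module.finrank ℂ V : ℝ)) (D.underlying.l2d n) := by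
    intro n
    rw [← D.logFKDet_vnDim, smul_eq_mul, pow_succ]
    ring
  rw [finsum_congr h2]
  refine finsum_eq_sum_of_support_subset _ fun n hn => ?_
  by_contra h3
  refine hn ?_
  rw [Finset.mem_coe, Finset.mem_range, not_lt] at h3
  change (-1 : ℝ) ^ n * _ = 0
  rw [D.underlying.logFKDet_l2d_of_isEmpty (hM' (n + 1) (by omega)), mul_zero]

end VonNeumann

theorem integralTorsion_eq (E : BasedComplex.{0, w} ℤ) {M : ℕ} (hM : ∀ n, M ≤ n → IsEmpty (E.ι n)) :
    E.integralTorsion =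
      ∑ n ∈ Finset.range M, (-1 : ℝ) ^ n * Real.log (torsionOrder (E.Homology n)) := by
  refine finsum_eq_sum_of_support_subset _ fun n hn => ?_
  by_contra h3
  refine hn ?_
  rw [Finset.mem_coe, Finset.mem_range, not_lt] at h3
  have h1 := E.logFKDet_l2d_eq n
  rw [E.logFKDet_l2d_of_isEmpty (hM (n + 1) (by omega))] at h1
  have h2 := E.logVolBoundaries_nonneg n
  have h4 := E.logVolCycles_nonneg (n + 1)
  have h5 := E.log_torsionOrder_nonneg n
  change (-1 : ℝ) ^ n * _ = 0
  rw [show Real.log (torsionOrder (E.Homology n)) = 0 by linarith, mul_zero]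

end BasedComplex

end

/-! ### The quotient of `A` at a given level and the bound on generators -/

noncomputable section

/-- Substituting `e * b` turns `1 + log b` into a single logarithm. -/
theorem tendsto_one_add_log_pow_div (k : ℕ) :
    Tendsto (fun b : ℕ => (1 + Real.log b) ^ k / (b : ℝ)) atTop (𝓝 0) := by
  have h1 : Tendsto (fun x : ℝ => Real.log x ^ k / x) atTop (𝓝 0) :=
    (Real.isLittleO_pow_log_id_atTop (n := k)).tendsto_div_nhds_zero
  have h2 : Tendsto (fun b : ℕ => Real.exp 1 * (b : ℝ)) atTop atTop :=
    tendsto_natCast_atTop_atTop.const_mul_atTop (Real.exp_pos 1)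
  have h3 := (h1.comp h2).const_mul (Real.exp 1)
  rw [mul_zero] at h3
  refine h3.congr' ?_
  filter_upwards [eventually_gt_atTop 0] with b hb
  have hb' : (0 : ℝ) < b := by exact_mod_cast hb
  have he := Real.exp_pos 1
  simp only [Function.comp_apply]
  rw [Real.log_mul he.ne' hb'.ne', Real.log_exp]
  field_simp

theorem three_mul_log_add_one_le (b : ℕ) :
    (3 * (Nat.log 2 b + 1) : ℝ) ≤ 6 * (1 + Real.log b) := by
  have h1 : (Nat.log 2 b : ℝ) ≤ Real.logb 2 b := by exact_mod_cast Real.natLog_le_logb b 2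
  have h2 : Real.logb 2 b ≤ 2 * Real.log b := by
    have h3 := Real.log_two_gt_d9
    rw [Real.logb, div_le_iff₀ (by linarith)]
    nlinarith [Real.log_natCast_nonneg b]
  linarith

namespace BasedComplex

section Level

variable {G : Type u} [Group G] (N A : Subgroup G) [N.Normal]

theorem subgroupQuotientHom_injective : Function.Injective (subgroupQuotientHom N A) := by
  rw [injective_iff_map_eq_one]
  intro x hx
  obtain ⟨a, rfl⟩ := QuotientGroup.mk_surjective x
  have h1 : ((a : G) : G ⧸ N) = 1 := hx
  rw [QuotientGroup.eq_one_iff] at h1 ⊢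
  exact h1

theorem finite_subgroup_quotient [N.FiniteIndex] : Finite (A ⧸ N.subgroupOf A) :=
  Finite.of_injective _ (subgroupQuotientHom_injective N A)

variable {N A} in
theorem NilpotentAtLevel.nilpotentTranslation {D : BasedComplex.{u, w} (MonoidAlgebra ℤ G)}
    [N.FiniteIndex] {n r : ℕ} (h : D.NilpotentAtLevel N A n r) :
    (D.level N).NilpotentTranslation (Set.range (subgroupQuotientHom N A)) n r := by
  obtain ⟨h1, h2⟩ := h
  exact (D.level N).nilpotentTranslation_of_hasTrivialFiltration _ h2 (Nat.sInf_mem h1)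

variable [A.Normal]

/-- The kernel of `G/N → G/AN` is `AN/N`, and each of its elements is represented by an element of
`A`. -/
theorem ker_levelHom_sup :
    (levelHom (le_sup_right : N ≤ A ⊔ N)).ker = (subgroupQuotientHom N A).range := by
  ext x
  obtain ⟨g, rfl⟩ := QuotientGroup.mk_surjective x
  constructor
  · intro h
    have h1 : g ∈ A ⊔ N := (QuotientGroup.eq_one_iff g).1 h
    obtain ⟨a, ha, n, hn, rfl⟩ := Subgroup.mem_sup_of_normal_right.1 h1
    refine ⟨QuotientGroup.mk ⟨a, ha⟩, ?_⟩
    change (QuotientGroup.mk a : G ⧸ N) = QuotientGroup.mk (a * n)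
    rw [QuotientGroup.eq]
    simpa using hn
  · rintro ⟨y, hy⟩
    obtain ⟨a, rfl⟩ := QuotientGroup.mk_surjective y
    rw [← hy]
    exact (QuotientGroup.eq_one_iff (a : G)).2 (Subgroup.mem_sup_left a.2)

theorem card_ker_levelHom_sup :
    Nat.card (levelHom (le_sup_right : N ≤ A ⊔ N)).ker = Nat.card (A ⧸ N.subgroupOf A) := by
  rw [ker_levelHom_sup]
  exact (Nat.card_congr (MonoidHom.ofInjective (subgroupQuotientHom_injective N A)).toEquiv).symm

theorem index_eq_card_mul_index_sup :
    N.index = Nat.card (A ⧸ N.subgroupOf A) * (A ⊔ N).index := by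
  rw [← card_ker_levelHom_sup]
  let q := levelHom (le_sup_right : N ≤ A ⊔ N)
  have h1 := Subgroup.card_eq_card_quotient_mul_card_subgroup q.ker
  rw [Nat.card_congr (QuotientGroup.quotientKerEquivOfSurjective q
    (levelHom_surjective _)).toEquiv, mul_comm] at h1
  exact h1


variable (D : BasedComplex.{u, w} (MonoidAlgebra ℤ G))

theorem card_intLevel_ι [N.FiniteIndex] (n : ℕ) :
    Fintype.card ((D.intLevel N).ι n) = Fintype.card (D.ι n) * N.index := by
  rw [← Nat.card_eq_fintype_card, ← Nat.card_eq_fintype_card, Subgroup.index, ← Nat.card_prod]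
  rfl

theorem exists_relGen_bound_level (r n : ℕ) : ∃ (c : ℝ) (e : ℕ), 0 ≤ c ∧
    ∀ (N A : Subgroup G) [N.Normal] [A.Normal] [N.FiniteIndex],
      (∀ x ∈ A, ∀ y ∈ A, x * y = y * x) → (∀ j ≤ n, D.NilpotentAtLevel N A j r) →
      ∃ k : ℕ, (k : ℝ) ≤ c * (A ⊔ N).index * (1 + Real.log (Nat.card (A ⧸ N.subgroupOf A))) ^ e ∧
        ∀ j ≤ n, RelGen k ((D.intLevel N).boundaries j).toAddSubgroup
          ((D.intLevel N).cycles j).toAddSubgroup := by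
  obtain ⟨e, he⟩ := exists_relGen_bound.{u, w} r n
  let m := ∑ j ∈ Finset.range (n + 1), Fintype.card (D.ι j)
  refine ⟨m * 6 ^ e, e, by positivity, fun N A _ _ _ hA hD => ?_⟩
  have hfin := finite_subgroup_quotient N A
  let _ : CommGroup (A ⧸ N.subgroupOf A) :=
    { (inferInstance : Group (A ⧸ N.subgroupOf A)) with
      mul_comm := fun x y => by
        obtain ⟨a, rfl⟩ := QuotientGroup.mk_surjective x
        obtain ⟨b, rfl⟩ := QuotientGroup.mk_surjective y
        exact congrArg QuotientGroup.mk (Subtype.ext (hA a a.2 b b.2)) }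
  have h1 := he (D.level N) (subgroupQuotientHom N A) m (subgroupQuotientHom_injective N A)
    (fun j hj => Finset.single_le_sum (f := fun j => Fintype.card (D.ι j))
      (fun _ _ => Nat.zero_le _) (Finset.mem_range.2 (by omega)))
    fun j hj => (hD j hj).nilpotentTranslation
  refine ⟨_, ?_, h1⟩
  set b := Nat.card (A ⧸ N.subgroupOf A) with hb
  have hb0 : 0 < b := Nat.card_pos
  have h2 : Nat.card (G ⧸ N) / b = (A ⊔ N).index := by
    have := index_eq_card_mul_index_sup N A
    rw [Subgroup.index, ← hb] at this
    rw [this, Nat.mul_div_cancel_left _ hb0]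
  rw [h2]
  push_cast
  have h3 := pow_le_pow_left₀ (by positivity) (three_mul_log_add_one_le b) e
  rw [mul_pow 6] at h3
  refine (mul_le_mul_of_nonneg_left h3
    (by positivity : (0 : ℝ) ≤ m * (A ⊔ N).index)).trans_eq ?_
  ring

end Level

end BasedComplex

end

/-! ### All invariants bounded at a single level -/

noncomputable section

namespace BasedComplex

variable {G : Type u} [Group G] (D : BasedComplex.{u, w} (MonoidAlgebra ℤ G))

/-- The constants depend on the complex, on `r` and on the degree, but not on `N` or `A`; this
uniformity is what permits passing to the limit. -/
theorem exists_level_bounds (K : Type*) [Field K] (r n : ℕ) : ∃ (c : ℝ) (k : ℕ),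
    ∀ (N A : Subgroup G) [N.Normal] [A.Normal] [N.FiniteIndex],
      (∀ x ∈ A, ∀ y ∈ A, x * y = y * x) → (∀ j ≤ n, D.NilpotentAtLevel N A j r) →
      let B : ℝ := c * ((A ⊔ N).index * (1 + Real.log (Nat.card (A ⧸ N.subgroupOf A))) ^ k)
      (minGenerators ((D.intLevel N).Homology n) : ℝ) ≤ B ∧
      ((D.intLevel N).betti K n : ℝ) ≤ B ∧
      Real.log (torsionOrder ((D.intLevel N).Homology n)) ≤ B ∧
      |(D.intLevel N).logDetAlpha n| ≤ B := by
  obtain ⟨c, e, hc, hgen⟩ := D.exists_relGen_bound_level r n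
  choose Q hQ1 hQ using fun n => D.norm_l2d_le n
  have hl : ∀ n, 0 ≤ Real.log (Q n) := fun n => Real.log_nonneg (hQ1 n)
  let s : ℕ → ℝ := fun j => Fintype.card (D.ι j)
  have hs : ∀ j, 0 ≤ s j := fun j => Nat.cast_nonneg _
  -- For `n = 0` the truncated `n - 1` is `0`, and the first summand is a harmless nonnegative
  -- surplus.
  let t : ℝ := s n * Real.log (Q (n - 1)) + s (n + 1) * Real.log (Q n)
  have ht1 : 0 ≤ s n * Real.log (Q (n - 1)) := mul_nonneg (hs _) (hl _)
  have ht2 : 0 ≤ s (n + 1) * Real.log (Q n) := mul_nonneg (hs _) (hl _)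
  have hcr : 0 ≤ c * r := mul_nonneg hc (Nat.cast_nonneg r)
  refine ⟨c * (2 + r) + t + 2 * s n, e + 1, fun N A _ _ _ hA hD => ?_⟩
  obtain ⟨d, hd, hgen⟩ := hgen N A hA hD
  have hfin := finite_subgroup_quotient N A
  have : (A ⊔ N).FiniteIndex := Subgroup.finiteIndex_of_le le_sup_right
  have hT := D.kerBound_levelTransfer (le_sup_right : N ≤ A ⊔ N)
    (S := Set.range (subgroupQuotientHom N A))
    (fun β hβ => by rw [ker_levelHom_sup] at hβ; exact hβ) (hD n le_rfl).nilpotentTranslation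
  let E := D.intLevel N
  let E' := D.intLevel (A ⊔ N)
  have hcardb := card_ker_levelHom_sup N A
  set b := Nat.card (levelHom (le_sup_right : N ≤ A ⊔ N)).ker with hb
  rw [← hcardb] at hd ⊢
  have hb0 : 0 < b := by rw [hcardb]; exact Nat.card_pos
  set f : ℝ := ((A ⊔ N).index : ℝ) with hf
  have hf0 : 0 ≤ f := Nat.cast_nonneg _
  set l : ℝ := Real.log b with hl'
  have hl0 : 0 ≤ l := Real.log_natCast_nonneg b
  -- The exponent exceeds that of the generator bound by one, because the torsion estimate
  -- multiplies the number of generators by `log b`.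
  set F : ℝ := f * (1 + l) ^ (e + 1) with hF
  have hF0 : 0 ≤ F := by positivity
  have hpow : 1 ≤ (1 + l) ^ e := one_le_pow₀ (by linarith)
  have hF1 : f * (1 + l) ^ e + f * (1 + l) ^ e * l = F := by rw [hF]; ring
  have hfe : f ≤ f * (1 + l) ^ e := le_mul_of_one_le_right hf0 hpow
  have hfel : f * l ≤ f * (1 + l) ^ e * l := mul_le_mul_of_nonneg_right hfe hl0
  have hfl0 : 0 ≤ f * l := mul_nonneg hf0 hl0
  have hd1 : (d : ℝ) ≤ c * F := hd.trans (by
    rw [mul_assoc]; exact mul_le_mul_of_nonneg_left (by linarith) hc)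
  have hdl : (d : ℝ) * l ≤ c * F := by
    refine (mul_le_mul_of_nonneg_right hd hl0).trans ?_
    rw [mul_assoc c, mul_assoc c]
    exact mul_le_mul_of_nonneg_left (by linarith) hc
  have hcard : ∀ j, (Fintype.card (E'.ι j) : ℝ) = s j * f := fun j => by
    refine (congrArg Nat.cast (card_intLevel_ι (A ⊔ N) D j)).trans ?_
    push_cast
    rfl
  have hα' : |E'.logDetAlpha n| ≤ t * f := by
    cases n with
    | zero =>
      have h1 := E'.abs_logDetAlpha_zero_le (hQ1 0) (hQ 0 (A ⊔ N))
      rw [hcard] at h1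
      have h2 := mul_nonneg ht1 hf0
      change _ ≤ (_ + _) * f
      linarith
    | succ n =>
      have h1 := E'.abs_logDetAlpha_succ_le (hQ1 n) (hQ1 (n + 1)) (hQ n (A ⊔ N))
        (hQ (n + 1) (A ⊔ N))
      rw [hcard, hcard] at h1
      change _ ≤ (_ + _) * f
      rw [Nat.add_sub_cancel]
      linarith
  have ht0 : 0 ≤ t := add_nonneg ht1 ht2
  have htf : t * f ≤ t * F := mul_le_mul_of_nonneg_left (by linarith) ht0
  have hB : ∀ {y z : ℝ}, y ≤ z * F → z ≤ c * (2 + r) + t + 2 * s n →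
      y ≤ (c * (2 + r) + t + 2 * s n) * F := fun h1 h2 =>
    h1.trans (mul_le_mul_of_nonneg_right h2 hF0)
  have hsn := hs n
  refine ⟨?_, ?_, ?_, ?_⟩
  · refine hB (z := c) (le_trans ?_ hd1) (by linarith)
    exact_mod_cast minGenerators_le (hgen n le_rfl).exists_surjective
  · refine hB (z := c * 2) ?_ (by linarith)
    have h1 : E.betti K n ≤ d + d := by
      cases n with
      | zero => exact (E.betti_zero_le K (hgen 0 le_rfl)).trans (Nat.le_add_left _ _)
      | succ n => exact E.betti_succ_le K (hgen n (Nat.le_succ n)) (hgen (n + 1) le_rfl)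
    have h2 : (E.betti K n : ℝ) ≤ d + d := by exact_mod_cast h1
    refine h2.trans ?_
    linarith
  · refine hB (z := c * r + t) ?_ (by linarith)
    have h1 := hT.torsionOrder_le hb0 (hgen n le_rfl)
    have h2 : (1 : ℝ) ≤ torsionOrder (E.Homology n) := by
      have : Finite (Submodule.torsion ℤ (E.Homology n)) :=
        Module.finite_of_fg_torsion _ Submodule.torsion_isTorsion
      exact_mod_cast (Nat.card_pos (α := Submodule.torsion ℤ (E.Homology n)))
    have h3 : (0 : ℝ) < torsionOrder (E'.Homology n) := by
      have : Finite (Submodule.torsion ℤ (E'.Homology n)) :=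
        Module.finite_of_fg_torsion _ Submodule.torsion_isTorsion
      exact_mod_cast (Nat.card_pos (α := Submodule.torsion ℤ (E'.Homology n)))
    have hbR : (0 : ℝ) < b := by exact_mod_cast hb0
    have h4 : Real.log (torsionOrder (E.Homology n)) ≤
        Real.log (((b : ℝ) ^ r) ^ d * torsionOrder (E'.Homology n)) :=
      Real.log_le_log (by linarith) (by exact_mod_cast h1)
    rw [Real.log_mul (by positivity) h3.ne', Real.log_pow, Real.log_pow] at h4
    have h5 := E'.log_torsionOrder_le (hQ1 n) (hQ n (A ⊔ N))
    rw [hcard] at h5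
    have h6 : (r : ℝ) * (d * l) ≤ r * (c * F) := mul_le_mul_of_nonneg_left hdl (Nat.cast_nonneg r)
    have h7 : s (n + 1) * f * Real.log (Q n) ≤ t * f := by
      change _ ≤ (_ + _) * f
      have := mul_nonneg ht1 hf0
      linarith
    have h8 : (d : ℝ) * (r * Real.log b) = r * (d * l) := by rw [hl']; ring
    linarith
  · refine hB (z := t + 2 * s n) ?_ (by linarith)
    have h1 := hT.abs_logDetAlpha_le hb0
    rw [hcard] at h1
    have h2 : 2 * s n * (f * l) ≤ 2 * s n * F := mul_le_mul_of_nonneg_left (by linarith)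
      (by linarith)
    have h3 : 2 * (s n * f) * Real.log b = 2 * s n * (f * l) := by rw [hl']; ring
    linarith

end BasedComplex

end

/-! ### Passage to the limit -/

noncomputable section

section Limits

variable {G : Type u} [Group G] {I : Type*} [Preorder I] {Gs : I → Subgroup G}
  (A : Subgroup G)

/-- Any finite subset of `A` eventually injects into the quotient: each of the finitely many
nontrivial differences leaves some `Gs i`, and then all later ones by monotonicity. -/
theorem tendsto_card_subgroup_quotient [∀ i, (Gs i).Normal] [∀ i, (Gs i).FiniteIndex]
    (hanti : Antitone Gs) (hinter : ⨅ i, Gs i = ⊥) [Infinite A] :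
    Tendsto (fun i => Nat.card (A ⧸ (Gs i).subgroupOf A)) atTop atTop := by
  rw [tendsto_atTop]
  intro m
  obtain ⟨F, hF⟩ := Infinite.exists_subset_card_eq A m
  have h1 : ∀ p ∈ F ×ˢ F, ∀ᶠ i in atTop, p.1 ≠ p.2 → (p.1⁻¹ * p.2 : A) ∉ (Gs i).subgroupOf A := by
    rintro ⟨x, y⟩ -
    by_cases hxy : x = y
    · exact Eventually.of_forall fun i h => absurd hxy h
    · have h2 : ((x⁻¹ * y : A) : G) ∉ ⨅ i, Gs i := by
        rw [hinter, Subgroup.mem_bot]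
        intro h
        apply hxy
        rw [← inv_mul_eq_one]
        exact Subtype.ext h
      rw [Subgroup.mem_iInf, not_forall] at h2
      obtain ⟨i, hi⟩ := h2
      filter_upwards [eventually_ge_atTop i] with j hj _ h
      exact hi (hanti hj h)
  filter_upwards [(Filter.eventually_all_finset _).2 h1] with i hi
  have hfin := BasedComplex.finite_subgroup_quotient (Gs i) A
  let g : F → A ⧸ (Gs i).subgroupOf A := fun x => QuotientGroup.mk x.1
  have hg : Function.Injective g := by
    intro x y hxy
    by_contra hne
    exact hi (x.1, y.1) (Finset.mk_mem_product x.2 y.2) (fun h => hne (Subtype.ext h))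
      (QuotientGroup.eq.1 hxy)
  have h2 := Nat.card_le_card_of_injective g hg
  rwa [Nat.card_eq_fintype_card, Fintype.card_coe, hF] at h2

/-- The index factors as `b * f`; the factor `f` cancels, and a power of `1 + log b` divided by `b`
remains. -/
theorem tendsto_div_index_of_abs_le [∀ i, (Gs i).Normal] [∀ i, (Gs i).FiniteIndex]
    (hanti : Antitone Gs) (hinter : ⨅ i, Gs i = ⊥) [A.Normal] [Infinite A] {X : I → ℝ} {c : ℝ}
    {k : ℕ} (h : ∀ᶠ i in atTop, |X i| ≤ c * ((A ⊔ Gs i).index *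
      (1 + Real.log (Nat.card (A ⧸ (Gs i).subgroupOf A))) ^ k)) :
    Tendsto (fun i => X i / ((Gs i).index : ℝ)) atTop (𝓝 0) := by
  have h1 := ((tendsto_one_add_log_pow_div k).comp
    (tendsto_card_subgroup_quotient A hanti hinter)).const_mul c
  rw [mul_zero] at h1
  refine squeeze_zero_norm' ?_ h1
  filter_upwards [h] with i hi
  have hfin := BasedComplex.finite_subgroup_quotient (Gs i) A
  have : (A ⊔ Gs i).FiniteIndex := Subgroup.finiteIndex_of_le le_sup_right
  have hb : (0 : ℝ) < Nat.card (A ⧸ (Gs i).subgroupOf A) := by exact_mod_cast Nat.card_pos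
  have hf : (0 : ℝ) < (A ⊔ Gs i).index := by
    exact_mod_cast Nat.pos_of_ne_zero Subgroup.FiniteIndex.index_ne_zero
  rw [BasedComplex.index_eq_card_mul_index_sup (Gs i) A, Nat.cast_mul, norm_div, Real.norm_eq_abs,
    Real.norm_of_nonneg (mul_pos hb hf).le, div_le_iff₀ (mul_pos hb hf)]
  refine hi.trans_eq ?_
  simp only [Function.comp_apply]
  field_simp

end Limits

theorem mainTheorem5 {G : Type u} [Group G] {I : Type*} [Preorder I] [IsDirectedOrder I]
    (Gs : I → Subgroup G) [∀ i, (Gs i).Normal] [∀ i, (Gs i).FiniteIndex]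
    (hanti : Antitone Gs) (hinter : ⨅ i, Gs i = ⊥) (K : Type*) [Field K]
    (C : ChainComplex (ModuleCat.{v} (MonoidAlgebra ℤ G)) ℕ)
    (hC : ∃ m : ℕ, ∀ n, m < n → Subsingleton (C.X n))
    {ι : ℕ → Type w} [∀ n, Fintype (ι n)]
    (b : ∀ n, Module.Basis (ι n) (MonoidAlgebra ℤ G) (C.X n))
    (d : ℕ) (A : Subgroup G) [A.Normal] [Infinite A] (hA : ∀ x ∈ A, ∀ y ∈ A, x * y = y * x)
    (hnil : ∃ (i₀ : I) (r : ℕ), ∀ i, i₀ ≤ i → ∀ n, n ≤ d →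
      (BasedComplex.ofBases C b).NilpotentAtLevel (Gs i) A n r) :
    (∀ n, n ≤ d → Tendsto (fun i =>
      (minGenerators (((BasedComplex.ofBases C b).intLevel (Gs i)).Homology n) : ℝ)
        / ((Gs i).index : ℝ)) atTop (𝓝 0)) ∧
    (∀ n, n ≤ d → Tendsto (fun i =>
      (((BasedComplex.ofBases C b).intLevel (Gs i)).betti K n : ℝ)
        / ((Gs i).index : ℝ)) atTop (𝓝 0)) ∧
    (∀ n, n ≤ d → Tendsto (fun i =>
      Real.log (torsionOrder (((BasedComplex.ofBases C b).intLevel (Gs i)).Homology n))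
        / ((Gs i).index : ℝ)) atTop (𝓝 0)) ∧
    (∀ n, n ≤ d → Tendsto (fun i =>
      |((BasedComplex.ofBases C b).intLevel (Gs i)).logDetAlpha n|
        / ((Gs i).index : ℝ)) atTop (𝓝 0)) ∧
    ((∃ (i₁ : I) (s : ℕ), ∀ i, i₁ ≤ i → ∀ n,
        (BasedComplex.ofBases C b).NilpotentAtLevel (Gs i) A n s) →
      Tendsto (fun i => ((BasedComplex.ofBases C b).level (Gs i)).l2Torsion) atTop (𝓝 0) ∧
      Tendsto (fun i => ((BasedComplex.ofBases C b).intLevel (Gs i)).integralTorsion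
        / ((Gs i).index : ℝ)) atTop (𝓝 0)) := by
  set D := BasedComplex.ofBases C b with hD
  have key : ∀ n i₀ r, (∀ i, i₀ ≤ i → ∀ j ≤ n, D.NilpotentAtLevel (Gs i) A j r) →
      Tendsto (fun i => (minGenerators ((D.intLevel (Gs i)).Homology n) : ℝ) /
        ((Gs i).index : ℝ)) atTop (𝓝 0) ∧
      Tendsto (fun i => ((D.intLevel (Gs i)).betti K n : ℝ) / ((Gs i).index : ℝ)) atTop (𝓝 0) ∧
      Tendsto (fun i => Real.log (torsionOrder ((D.intLevel (Gs i)).Homology n)) /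
        ((Gs i).index : ℝ)) atTop (𝓝 0) ∧
      Tendsto (fun i => (D.intLevel (Gs i)).logDetAlpha n / ((Gs i).index : ℝ)) atTop (𝓝 0) := by
    intro n i₀ r h
    obtain ⟨c, k, hbound⟩ := D.exists_level_bounds K r n
    have hev := (eventually_ge_atTop i₀).mono fun i hi => hbound (Gs i) A hA (h i hi)
    refine ⟨?_, ?_, ?_, ?_⟩ <;>
      refine tendsto_div_index_of_abs_le A hanti hinter (c := c) (k := k) (hev.mono fun i hi => ?_)
    · exact (abs_of_nonneg (Nat.cast_nonneg _)).trans_le hi.1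
    · exact (abs_of_nonneg (Nat.cast_nonneg _)).trans_le hi.2.1
    · exact (abs_of_nonneg (Real.log_natCast_nonneg _)).trans_le hi.2.2.1
    · exact hi.2.2.2
  obtain ⟨i₀, r, hnil⟩ := hnil
  have key' := fun n (hn : n ≤ d) => key n i₀ r fun i hi j hj => hnil i hi j (hj.trans hn)
  refine ⟨fun n hn => (key' n hn).1, fun n hn => (key' n hn).2.1, fun n hn => (key' n hn).2.2.1,
    fun n hn => ?_, ?_⟩
  · have h1 := (key' n hn).2.2.2.abs
    rw [abs_zero] at h1
    refine h1.congr fun i => ?_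
    rw [abs_div, Nat.abs_cast]
  · rintro ⟨i₁, s, hs⟩
    have key2 := fun n => key n i₁ s fun i hi j _ => hs i hi j
    obtain ⟨m, hm⟩ := hC
    have hempty : ∀ n, m + 1 ≤ n → IsEmpty (D.ι n) := fun n hn => by
      have := hm n hn
      exact ⟨fun a => (b n).ne_zero a (Subsingleton.elim _ _)⟩
    have hempty' : ∀ i n, m + 1 ≤ n → IsEmpty ((D.intLevel (Gs i)).ι n) := fun i n hn => by
      have := hempty n hn
      exact inferInstanceAs (IsEmpty (D.ι n × (G ⧸ Gs i)))
    have hlim : ∀ (X : ℕ → I → ℝ), (∀ n, Tendsto (X n) atTop (𝓝 0)) →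
        Tendsto (fun i => ∑ n ∈ Finset.range (m + 1), (-1 : ℝ) ^ n * X n i) atTop (𝓝 0) := by
      intro X hX
      have := tendsto_finsetSum (Finset.range (m + 1)) fun n _ => (hX n).const_mul ((-1 : ℝ) ^ n)
      simpa using this
    constructor
    -- The signed logarithm of the regulator is needed here, which is why `key` gives its limit
    -- without the absolute value.
    · have hdiff := fun n => (key2 n).2.2.1.sub (key2 n).2.2.2
      simp only [sub_zero] at hdiff
      refine (hlim _ hdiff).congr fun i => ?_
      have h1 := (D.level (Gs i)).card_mul_l2Torsion hempty
      have h2 : (Nat.card (G ⧸ Gs i) : ℝ) ≠ 0 := by exact_mod_cast Nat.card_pos.ne'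
      rw [mul_comm, ← eq_div_iff h2] at h1
      rw [h1, Finset.sum_div]
      refine Finset.sum_congr rfl fun n _ => ?_
      rw [mul_div_assoc, sub_div]
      rfl
    · refine (hlim _ fun n => (key2 n).2.2.1).congr fun i => ?_
      rw [BasedComplex.integralTorsion_eq _ (hempty' i), Finset.sum_div]
      exact Finset.sum_congr rfl fun n _ => (mul_div_assoc _ _ _).symm

end
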